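/- A temporal graph $(G,\lambda)$ consists of a finite simple graph $G=(V,E)$ and a map $\lambda$ assigning to every edge a non-empty finite set $\lambda(e)\subseteq\{1,\dots,T\}$ of time slots (the times at which $e$ is active), where $T$ is the lifetime; $E_t=\{e\in E: t\in\lambda(e)\}$. A temporal coloring is a map $\phi: V\times\{1,\dots,T\}\to\mathbb N$, and $|\phi|$ is the number of colors it uses. For $1\le\Delta\le T$, $\phi$ is a proper sliding $\Delta$-window temporal coloring if for every $s$ with $1\le s\le T-\Delta+1$ and every edge $\{u,v\}$ that is active at some time in $\{s,\dots,s+\Delta-1\}$ there is a time $t\in\{s,\dots,s+\Delta-1\}$ with $t\in\lambda(\{u,v\})$ and $\phi(u,t)\ne\phi(v,t)$. Minimum SW-Temp. Coloring asks, given $(G,\lambda)$ (with an explicit list of labels for every edge) and $\Delta$, for a proper sliding $\Delta$-window temporal coloring with as few colors as possible. **Theorem.** Minimum SW-Temp. Coloring admits a linear-time FPT approximation algorithm with additive error one, parameterized by the vertex cover number of the underlying graph. That is, there are a computable function $f:\mathbb N\to\mathbb N$ and a word-RAM program that, on every instance $((G,\lambda),\Delta)$ with $1\le\Delta\le T$,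 where $G$ has vertex cover number $\nu$, halts after at most $f(\nu)\cdot N$ steps, where $N=|V|+T+\sum_{t=1}^T|E_t|$ (and with all computed numbers at most $f(\nu)\cdot N$), and outputs a proper sliding $\Delta$-window temporal coloring $\phi$ with $|\phi|\le|\psi|+1$ for every proper sliding $\Delta$-window temporal coloring $\psi$ of $(G,\lambda)$. Here the output coloring is written as one color $c$, a list of vertices, and for each time slot the colors of the listed vertices; every vertex that is not listed has color $c$ at all times. -/

import Mathlib

namespace SWColoring

/-! ## Temporal graphs and sliding window colorings -/

/-- A temporal graph `(G, λ)` on the vertex set `{0, …, n-1}`: a static underlying graph, a finite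
set of time labels for every edge (the empty set for the pairs that are not edges), and a lifetime
bounding all labels. Every edge of the underlying graph carries at least one label. -/
structure TemporalGraph (n : ℕ) where
  /-- the underlying graph -/
  graph : SimpleGraph (Fin n)
  /-- the time slots in which an edge is active -/
  label : Sym2 (Fin n) → Finset ℕ
  /-- the number `T` of time slots; the time slots are `1, …, T` -/
  lifetime : ℕ
  label_nonempty_iff : ∀ e, (label e).Nonempty ↔ e ∈ graph.edgeSet
  label_subset : ∀ e, label e ⊆ Finset.Icc 1 lifetime

variable {n : ℕ}

/-- The edge set `E_t` of the snapshot at time `t`. -/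
def TemporalGraph.snapshotEdges (G : TemporalGraph n) (t : ℕ) : Finset (Sym2 (Fin n)) :=
  Finset.univ.filter fun e => t ∈ G.label e

/-- The input size `|V| + ∑_{t=1}^T (1 + |E_t|)`. -/
def TemporalGraph.size (G : TemporalGraph n) : ℕ :=
  n + ∑ t ∈ Finset.Icc 1 G.lifetime, (1 + (G.snapshotEdges t).card)

/-- A temporal coloring is a function `φ` with `φ v t` the color of the vertex `v` at time `t`; only
its values at the time slots `1, …, T` are ever used. It is a proper sliding `Δ`-window temporal
coloring if in every window `W_s = [s, s + Δ - 1]` with `1 ≤ s ≤ T - Δ + 1`, every edge `{u, v}`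
active at some time of `W_s` is active and bichromatic at some time of `W_s`. -/
def IsProperSliding (G : TemporalGraph n) (Δ : ℕ) (φ : Fin n → ℕ → ℕ) : Prop :=
  ∀ s, 1 ≤ s → s + Δ ≤ G.lifetime + 1 →
    ∀ u v, G.graph.Adj u v →
      (∃ t ∈ Finset.Ico s (s + Δ), t ∈ G.label s(u, v)) →
      ∃ t ∈ Finset.Ico s (s + Δ), t ∈ G.label s(u, v) ∧ φ u t ≠ φ v t

/-- The size `|φ|` of a temporal coloring: the number of colors used in the time slots `1, …, T`. -/
def numColors (G : TemporalGraph n) (φ : Fin n → ℕ → ℕ) : ℕ :=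
  ((Finset.univ ×ˢ Finset.Icc 1 G.lifetime).image fun p : Fin n × ℕ => φ p.1 p.2).card

/-! ## Word RAM programs -/

/-- A memory state: registers holding natural numbers, and arrays (`mem a i` is the cell `i` of the
array `a`). A program mentions only finitely many registers and arrays. -/
structure State where
  reg : ℕ → ℕ
  mem : ℕ → ℕ → ℕ

/-- The arithmetic and comparison operations of the machine. -/
inductive Op
  | add | sub | mul | div | mod | eq | lt

/-- The value of an operation; subtraction is truncated at `0`, comparisons return `0` or `1`. -/
def Op.apply : Op → ℕ → ℕ → ℕ
  | .add, x, y => x + y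
  | .sub, x, y => x - y
  | .mul, x, y => x * y
  | .div, x, y => x / y
  | .mod, x, y => x % y
  | .eq, x, y => if x = y then 1 else 0
  | .lt, x, y => if x < y then 1 else 0

/-- Expressions: constants, registers, array cells (with a computed index), operations. -/
inductive Exp
  | lit (c : ℕ)
  | reg (x : ℕ)
  | get (a : ℕ) (i : Exp)
  | op (o : Op) (e₁ e₂ : Exp)

/-- The value of an expression. -/
def Exp.eval (s : State) : Exp → ℕ
  | .lit c => c
  | .reg x => s.reg x
  | .get a i => s.mem a (i.eval s)
  | .op o e₁ e₂ => o.apply (e₁.eval s) (e₂.eval s)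

/-- The evaluation cost of an expression: one unit for each constant, register, array access and
operation. -/
def Exp.cost : Exp → ℕ
  | .lit _ => 1
  | .reg _ => 1
  | .get _ i => i.cost + 1
  | .op _ e₁ e₂ => e₁.cost + e₂.cost + 1

/-- All values that occur in the evaluation of the expression are at most `W`. -/
def Exp.Fits (W : ℕ) (s : State) : Exp → Prop
  | .lit c => c ≤ W
  | .reg x => s.reg x ≤ W
  | .get a i => i.Fits W s ∧ s.mem a (i.eval s) ≤ W
  | .op o e₁ e₂ => e₁.Fits W s ∧ e₂.Fits W s ∧ o.apply (e₁.eval s) (e₂.eval s) ≤ W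

/-- Programs. `assign x e` puts the value of `e` into the register `x`; `store a i e` puts it into
the cell of the array `a` whose index is the value of `i`. Conditions are true iff nonzero. -/
inductive Program
  | skip
  | assign (x : ℕ) (e : Exp)
  | store (a : ℕ) (i e : Exp)
  | seq (p q : Program)
  | ite (b : Exp) (p q : Program)
  | loop (b : Exp) (p : Program)

/-- `Exec W p s t s'`: started in the state `s`, the program `p` halts in the state `s'` after `t`
time units, and no value exceeding `W` is ever computed. -/
inductive Exec (W : ℕ) : Program → State → ℕ → State → Prop
  | skip (s : State) : Exec W .skip s 1 s
  | assign (x : ℕ) (e : Exp) (s : State) (he : e.Fits W s) :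
      Exec W (.assign x e) s (e.cost + 1) ⟨Function.update s.reg x (e.eval s), s.mem⟩
  | store (a : ℕ) (i e : Exp) (s : State) (hi : i.Fits W s) (he : e.Fits W s) :
      Exec W (.store a i e) s (i.cost + e.cost + 1)
        ⟨s.reg, Function.update s.mem a (Function.update (s.mem a) (i.eval s) (e.eval s))⟩
  | seq (p q : Program) (s₁ s₂ s₃ : State) (t₁ t₂ : ℕ)
      (h₁ : Exec W p s₁ t₁ s₂) (h₂ : Exec W q s₂ t₂ s₃) :
      Exec W (.seq p q) s₁ (t₁ + t₂) s₃
  | ite_true (b : Exp) (p q : Program) (s s' : State) (t : ℕ) (hb : b.Fits W s)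
      (hne : b.eval s ≠ 0) (h : Exec W p s t s') :
      Exec W (.ite b p q) s (b.cost + 1 + t) s'
  | ite_false (b : Exp) (p q : Program) (s s' : State) (t : ℕ) (hb : b.Fits W s)
      (heq : b.eval s = 0) (h : Exec W q s t s') :
      Exec W (.ite b p q) s (b.cost + 1 + t) s'
  | loop_false (b : Exp) (p : Program) (s : State) (hb : b.Fits W s) (heq : b.eval s = 0) :
      Exec W (.loop b p) s (b.cost + 1) s
  | loop_true (b : Exp) (p : Program) (s₁ s₂ s₃ : State) (t₁ t₂ : ℕ) (hb : b.Fits W s₁)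
      (hne : b.eval s₁ ≠ 0) (h₁ : Exec W p s₁ t₁ s₂) (h₂ : Exec W (.loop b p) s₂ t₂ s₃) :
      Exec W (.loop b p) s₁ (b.cost + 1 + t₁ + t₂) s₃

/-- The initial state: the array `0` holds the input and register `0` its length; all other
registers and cells hold `0`. -/
def State.init (w : List ℕ) : State where
  reg x := if x = 0 then w.length else 0
  mem a i := if a = 0 then w.getD i 0 else 0

/-- The output of a halted program: the first `ℓ` cells of the array `1`, where `ℓ` is the content
of register `1`. -/
def State.output (s : State) : List ℕ :=
  (List.range (s.reg 1)).map (s.mem 1)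

/-! ## Encodings -/

/-- `w` is an encoding of the instance `(G, λ), Δ`: the numbers `n`, `T`, `Δ`, the number of edges,
and then for every edge (in any order) its two endpoints (in any order), the number of its labels,
and the explicit list of its labels (in any order). -/
def EncodesInstance (G : TemporalGraph n) (Δ : ℕ) (w : List ℕ) : Prop :=
  ∃ es : List (Fin n × Fin n × List ℕ),
    (es.map fun r => s(r.1, r.2.1)).Nodup ∧
    (∀ e, e ∈ G.graph.edgeSet ↔ e ∈ es.map fun r => s(r.1, r.2.1)) ∧
    (∀ r ∈ es, r.2.2.Nodup ∧ r.2.2.toFinset = G.label s(r.1, r.2.1)) ∧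
    w = [n, G.lifetime, Δ, es.length] ++
      es.flatMap fun r => [r.1.val, r.2.1.val, r.2.2.length] ++ r.2.2

/-- `w` is an encoding of the temporal coloring `φ`: a color `c`, the number and the list of some
distinct vertices `x₁, …, x_r`, and for every time slot `t = 1, …, T` the colors
`φ x₁ t, …, φ x_r t`; all other vertices have color `c` in every time slot. -/
def EncodesColoring (G : TemporalGraph n) (φ : Fin n → ℕ → ℕ) (w : List ℕ) : Prop :=
  ∃ (c : ℕ) (X : List (Fin n)),
    X.Nodup ∧
    (∀ v, v ∉ X → ∀ t ∈ Finset.Icc 1 G.lifetime, φ v t = c) ∧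
    w = [c, X.length] ++ X.map Fin.val ++
      (List.range G.lifetime).flatMap fun t => X.map fun v => φ v (t + 1)

end SWColoring

/-!
A temporal coloring with at most one color too many is found as follows. The ends `X` of a greedy
maximal matching form a vertex cover with `m ≤ 2ν` vertices (`matched_cover`,
`matched_length_le`). Every vertex outside `X` gets one extra color at all times, so that edges
with only one end in `X` are bichromatic whenever they are active, and it remains to color `X`
with the least number `k ≥ 2` of colors such that the windows of the at most `m²` pairs of
vertices in `X` are respected (`extendColoring_proper`). A proper coloring of the whole graph
restricts to such a coloring of `X` (`exists_winOK`) and has at least two colors if there is an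
edge (`two_le_numColors`), so at most one color is wasted.

For the linear dependence on the lifetime, time is cut into blocks of length `Δ`. A window meets a
block in a prefix or in a suffix of it, so for every pair only its first and its last bichromatic
active time in each block matter (`WinOK.of_covers`). An exchange argument bounds how much of a
block has to be colored. In a coloring for which these first and last times cannot be moved
outwards, some one among any `2m² + 1` active times of a pair in a block is neither a first nor a
last time of any pair, hence can be recolored freely, and by maximality the pair already has
bichromatic times on both sides of it (`exists_good_around`). So only the first and last `2m² + 1`
active times of each pair matter: the other times can be given the color `0` throughout
(`exists_covers_of_slotting`). The relevant times of a block get distinct slots whose number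
depends on `m` only (`IsSlotting`), and a coloring of a block becomes a number below `k ^ L`, its
base `k` digits being the colors of the vertices of `X` in the slots.

A window lies in two consecutive blocks, so feasibility for `k` colors is the existence of a chain
of pairwise compatible block states (`exists_reach`, `winOK_of_compat`), which a dynamic program
over the blocks decides. Testing two states takes `O(m² Δ)` steps by a scan that remembers the
last active and the last bichromatic time of a pair, and there are at most `T / Δ` pairs of
consecutive blocks, so that everything is linear in the input up to a factor depending on `m`. As
`k = max 2 m` is always feasible (all vertices of `X` get different colors), only `m + 1` values
of `k` are tried.

The program is verified with total correctness triples `Runs`, which carry the time bound and the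
bound on all computed values: weakest preconditions for loop-free code (`Runs.of_wp`), and a rule
for counting loops (`Runs.for`). Inside the program, times count from `0`.
-/

namespace SWColoring

/-! ### Expressions, state updates and frames of the word RAM -/

instance : Add Exp := ⟨.op .add⟩
instance : Sub Exp := ⟨.op .sub⟩
instance : Mul Exp := ⟨.op .mul⟩
instance : Div Exp := ⟨.op .div⟩
instance : Mod Exp := ⟨.op .mod⟩

theorem Exp.Fits.eval_le {W : ℕ} {s : State} {e : Exp} (h : e.Fits W s) : e.eval s ≤ W := by
  cases e with
  | lit c => exact h
  | reg x => exact h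
  | get a i => exact h.2
  | op o a b => exact h.2.2

section ExpLemmas
variable (W : ℕ) (s : State) (a b : Exp)

@[simp] theorem eval_lit (c : ℕ) : (Exp.lit c).eval s = c := rfl
@[simp] theorem eval_reg (x : ℕ) : (Exp.reg x).eval s = s.reg x := rfl
@[simp] theorem eval_get (x : ℕ) : (Exp.get x a).eval s = s.mem x (a.eval s) := rfl
@[simp] theorem eval_add : (a + b).eval s = a.eval s + b.eval s := rfl
@[simp] theorem eval_sub : (a - b).eval s = a.eval s - b.eval s := rfl
@[simp] theorem eval_mul : (a * b).eval s = a.eval s * b.eval s := rfl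
@[simp] theorem eval_div : (a / b).eval s = a.eval s / b.eval s := rfl
@[simp] theorem eval_mod : (a % b).eval s = a.eval s % b.eval s := rfl
@[simp] theorem eval_lt :
    (Exp.op .lt a b).eval s = if a.eval s < b.eval s then 1 else 0 := rfl
@[simp] theorem eval_eq :
    (Exp.op .eq a b).eval s = if a.eval s = b.eval s then 1 else 0 := rfl

@[simp] theorem fits_lit (c : ℕ) : (Exp.lit c).Fits W s ↔ c ≤ W := Iff.rfl
@[simp] theorem fits_reg (x : ℕ) : (Exp.reg x).Fits W s ↔ s.reg x ≤ W := Iff.rfl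
@[simp] theorem fits_get (x : ℕ) :
    (Exp.get x a).Fits W s ↔ a.Fits W s ∧ s.mem x (a.eval s) ≤ W := Iff.rfl
@[simp] theorem fits_add :
    (a + b).Fits W s ↔ a.Fits W s ∧ b.Fits W s ∧ a.eval s + b.eval s ≤ W := Iff.rfl
@[simp] theorem fits_mul :
    (a * b).Fits W s ↔ a.Fits W s ∧ b.Fits W s ∧ a.eval s * b.eval s ≤ W := Iff.rfl

/-! Truncated subtraction, division and remainder never exceed their first argument, so that they
need no bound of their own. -/

@[simp] theorem fits_sub : (a - b).Fits W s ↔ a.Fits W s ∧ b.Fits W s :=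
  ⟨fun h => ⟨h.1, h.2.1⟩, fun h => ⟨h.1, h.2, (Nat.sub_le _ _).trans h.1.eval_le⟩⟩
@[simp] theorem fits_div : (a / b).Fits W s ↔ a.Fits W s ∧ b.Fits W s :=
  ⟨fun h => ⟨h.1, h.2.1⟩, fun h => ⟨h.1, h.2, (Nat.div_le_self _ _).trans h.1.eval_le⟩⟩
@[simp] theorem fits_mod : (a % b).Fits W s ↔ a.Fits W s ∧ b.Fits W s :=
  ⟨fun h => ⟨h.1, h.2.1⟩, fun h => ⟨h.1, h.2, (Nat.mod_le _ _).trans h.1.eval_le⟩⟩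
@[simp] theorem fits_lt :
    (Exp.op .lt a b).Fits W s ↔
      a.Fits W s ∧ b.Fits W s ∧ (if a.eval s < b.eval s then 1 else 0) ≤ W := Iff.rfl
@[simp] theorem fits_eq :
    (Exp.op .eq a b).Fits W s ↔
      a.Fits W s ∧ b.Fits W s ∧ (if a.eval s = b.eval s then 1 else 0) ≤ W := Iff.rfl

end ExpLemmas

/-- The state `s` with the register `x` set to `v`. -/
def State.set (s : State) (x v : ℕ) : State := ⟨Function.update s.reg x v, s.mem⟩

/-- The state `s` with the cell `i` of the array `a` set to `v`. -/
def State.put (s : State) (a i v : ℕ) : State :=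
  ⟨s.reg, Function.update s.mem a (Function.update (s.mem a) i v)⟩

@[simp] theorem State.set_reg (s : State) (x v y : ℕ) :
    (s.set x v).reg y = if y = x then v else s.reg y := by
  simp [State.set, Function.update_apply]
@[simp] theorem State.set_mem (s : State) (x v : ℕ) : (s.set x v).mem = s.mem := rfl
@[simp] theorem State.put_reg (s : State) (a i v : ℕ) : (s.put a i v).reg = s.reg := rfl
@[simp] theorem State.put_mem (s : State) (a i v b : ℕ) :
    (s.put a i v).mem b = if b = a then Function.update (s.mem a) i v else s.mem b := by
  simp only [State.put, Function.update_apply]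

/-- The registers that a program assigns to. -/
def Program.wregs : Program → List ℕ
  | .skip => []
  | .assign x _ => [x]
  | .store _ _ _ => []
  | .seq p q => p.wregs ++ q.wregs
  | .ite _ p q => p.wregs ++ q.wregs
  | .loop _ p => p.wregs

/-- The arrays that a program stores into. -/
def Program.wmems : Program → List ℕ
  | .skip => []
  | .assign _ _ => []
  | .store a _ _ => [a]
  | .seq p q => p.wmems ++ q.wmems
  | .ite _ p q => p.wmems ++ q.wmems
  | .loop _ p => p.wmems

theorem Exec.reg_eq {W : ℕ} {p : Program} {s s' : State} {t : ℕ} (h : Exec W p s t s') (x : ℕ)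
    (hx : x ∉ p.wregs) : s'.reg x = s.reg x := by
  induction h <;> simp_all [Program.wregs]

theorem Exec.mem_eq {W : ℕ} {p : Program} {s s' : State} {t : ℕ} (h : Exec W p s t s') (a : ℕ)
    (ha : a ∉ p.wmems) : s'.mem a = s.mem a := by
  induction h <;> simp_all [Program.wmems]

/-! ### Total correctness with a time bound -/

/-- Started in `s`, the program halts within `b` time units, never computes a value exceeding `W`,
and reaches a state satisfying `Q`. -/
def Runs (W : ℕ) (p : Program) (s : State) (b : ℕ) (Q : State → Prop) : Prop :=
  ∃ t s', Exec W p s t s' ∧ t ≤ b ∧ Q s'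

theorem Runs.mono {W : ℕ} {p : Program} {s : State} {b b' : ℕ} {Q Q' : State → Prop}
    (h : Runs W p s b Q) (hb : b ≤ b') (hQ : ∀ s', Q s' → Q' s') : Runs W p s b' Q' := by
  obtain ⟨t, s', h1, h2, h3⟩ := h
  exact ⟨t, s', h1, h2.trans hb, hQ s' h3⟩

/-- What a program does not write is unchanged. -/
theorem Runs.frame {W : ℕ} {p : Program} {s : State} {b : ℕ} {Q : State → Prop}
    (h : Runs W p s b Q) :
    Runs W p s b fun s' => (∀ x, x ∉ p.wregs → s'.reg x = s.reg x) ∧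
      (∀ a, a ∉ p.wmems → s'.mem a = s.mem a) ∧ Q s' := by
  obtain ⟨t, s', h1, h2, h3⟩ := h
  exact ⟨t, s', h1, h2, h1.reg_eq, h1.mem_eq, h3⟩

theorem Runs.seq {W : ℕ} {p q : Program} {s : State} {b₁ b₂ : ℕ} {R Q : State → Prop}
    (hp : Runs W p s b₁ R)
    (hq : ∀ s', (∀ x, x ∉ p.wregs → s'.reg x = s.reg x) →
      (∀ a, a ∉ p.wmems → s'.mem a = s.mem a) → R s' → Runs W q s' b₂ Q) :
    Runs W (.seq p q) s (b₁ + b₂) Q := by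
  obtain ⟨t, s', h1, h2, h3⟩ := hp
  obtain ⟨t', s'', h1', h2', h3'⟩ := hq s' h1.reg_eq h1.mem_eq h3
  exact ⟨_, _, .seq _ _ _ _ _ _ _ h1 h1', by omega, h3'⟩

theorem Runs.ite {W : ℕ} {p q : Program} {e : Exp} {s : State} {b : ℕ} {Q : State → Prop}
    (he : e.Fits W s) (hp : e.eval s ≠ 0 → Runs W p s b Q) (hq : e.eval s = 0 → Runs W q s b Q) :
    Runs W (.ite e p q) s (e.cost + 1 + b) Q := by
  by_cases h : e.eval s = 0
  · obtain ⟨t, s', h1, h2, h3⟩ := hq h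
    exact ⟨_, _, .ite_false _ _ _ _ _ _ he h h1, by omega, h3⟩
  · obtain ⟨t, s', h1, h2, h3⟩ := hp h
    exact ⟨_, _, .ite_true _ _ _ _ _ _ he h h1, by omega, h3⟩

/-- The time bound of a loop-free program: both branches of a conditional are counted. The value at
loops has no meaning and is never used, because `Program.wp` is unsatisfiable there. -/
def Program.cost : Program → ℕ
  | .skip => 1
  | .assign _ e => e.cost + 1
  | .store _ i e => i.cost + e.cost + 1
  | .seq p q => p.cost + q.cost
  | .ite b p q => b.cost + 1 + (p.cost + q.cost)
  | .loop _ _ => 0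

/-- The weakest precondition of a loop-free program (no precondition is offered for loops). -/
def Program.wp (W : ℕ) : Program → (State → Prop) → State → Prop
  | .skip, Q, s => Q s
  | .assign x e, Q, s => e.Fits W s ∧ Q (s.set x (e.eval s))
  | .store a i e, Q, s => i.Fits W s ∧ e.Fits W s ∧ Q (s.put a (i.eval s) (e.eval s))
  | .seq p q, Q, s => p.wp W (q.wp W Q) s
  | .ite b p q, Q, s =>
      b.Fits W s ∧ (b.eval s ≠ 0 → p.wp W Q s) ∧ (b.eval s = 0 → q.wp W Q s)
  | .loop _ _, _, _ => False

/-- Loop-free programs are verified by computing their weakest precondition. -/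
theorem Runs.of_wp {W : ℕ} {p : Program} {s : State} {Q : State → Prop} (h : p.wp W Q s) :
    Runs W p s p.cost Q := by
  induction p generalizing s Q with
  | skip => exact ⟨_, _, .skip _, le_rfl, h⟩
  | assign x e => exact ⟨_, _, .assign _ _ _ h.1, le_rfl, h.2⟩
  | store a i e => exact ⟨_, _, .store _ _ _ _ h.1 h.2.1, le_rfl, h.2.2⟩
  | seq p q ihp ihq => exact (ihp h).seq fun s' _ _ h' => ihq h'
  | ite b p q ihp ihq =>
    exact .ite h.1 (fun hb => (ihp (h.2.1 hb)).mono (Nat.le_add_right _ _) fun _ => id)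
      (fun hb => (ihq (h.2.2 hb)).mono (Nat.le_add_left _ _) fun _ => id)
  | loop b p => exact h.elim

/-- `for x = 0, …, y - 1 do p`, where `y` is a register. -/
def Program.for (x y : ℕ) (p : Program) : Program :=
  .seq (.assign x (.lit 0))
    (.loop (.op .lt (.reg x) (.reg y)) (.seq p (.assign x (.reg x + .lit 1))))

/-- The rule for counting loops. In the step, `s` agrees with the initial state on everything that
the loop does not write. The invariant is required after `x` has been incremented. -/
theorem Runs.for {W : ℕ} {x y : ℕ} {p : Program} {s₀ : State} {n : ℕ} {b : ℕ → ℕ}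
    (I : ℕ → State → Prop) (hn : s₀.reg y = n) (hW : n ≤ W) (hW' : 1 ≤ W) (hxy : y ≠ x)
    (hy : y ∉ p.wregs) (hx : x ∉ p.wregs) (h0 : I 0 (s₀.set x 0))
    (step : ∀ i < n, ∀ s : State, (∀ r, r ∉ x :: p.wregs → s.reg r = s₀.reg r) →
      (∀ a, a ∉ p.wmems → s.mem a = s₀.mem a) → s.reg x = i → I i s →
      Runs W p s (b i) fun s' => I (i + 1) (s'.set x (i + 1))) :
    Runs W (.for x y p) s₀ ((∑ i ∈ Finset.range n, (b i + 8)) + 6)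
      fun s' => s'.reg x = n ∧ I n s' := by
  have main : ∀ d i, i + d = n → ∀ s : State, (∀ r, r ∉ x :: p.wregs → s.reg r = s₀.reg r) →
      (∀ a, a ∉ p.wmems → s.mem a = s₀.mem a) → s.reg x = i → I i s →
      Runs W (.loop (.op .lt (.reg x) (.reg y)) (.seq p (.assign x (.reg x + .lit 1)))) s
        ((∑ j ∈ Finset.Ico i n, (b j + 8)) + 4) fun s' => s'.reg x = n ∧ I n s' := by
    intro d
    induction d with
    | zero =>
      intro i hi s hr ha hsx hI
      have hsy : s.reg y = n := by rw [hr y (by simp [hxy, hy]), hn]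
      have hi' : i = n := by omega
      subst hi'
      refine ⟨_, _, .loop_false _ _ _ ?_ ?_, ?_, hsx, hI⟩
      · simp [hsx, hsy, hW]
      · simp [hsx, hsy]
      · simp [Exp.cost]
    | succ d ih =>
      intro i hi s hr ha hsx hI
      have hsy : s.reg y = n := by rw [hr y (by simp [hxy, hy]), hn]
      obtain ⟨t, s', h1, h2, h3⟩ := step i (by omega) s hr ha hsx hI
      have hx' : s'.reg x = i := by rw [h1.reg_eq x hx, hsx]
      have he : Exec W (.assign x (.reg x + .lit 1)) s' 4 (s'.set x (i + 1)) := by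
        have := Exec.assign (W := W) x (.reg x + .lit 1) s' (by simp [hx']; omega)
        rwa [eval_add, eval_reg, hx'] at this
      obtain ⟨t', s'', h1', h2', h3'⟩ := ih (i + 1) (by omega) (s'.set x (i + 1))
        (by
          intro r hr'
          simp only [List.mem_cons, not_or] at hr'
          simp only [State.set_reg, if_neg hr'.1]
          rw [h1.reg_eq r hr'.2, hr r (by simp [hr'])])
        (by
          intro a ha'
          rw [State.set_mem, h1.mem_eq a ha', ha a ha'])
        (by simp) h3
      refine ⟨_, _, .loop_true _ _ _ _ _ _ _ ?_ ?_ (.seq _ _ _ _ _ _ _ h1 he) h1', ?_, h3'⟩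
      · simp [hsx, hsy, hW, hW', show i < n by omega]; omega
      · simp [hsx, hsy, show i < n by omega]
      · rw [Finset.sum_eq_sum_Ico_succ_bot (show i < n by omega)]
        simp only [Exp.cost]
        omega
  have h1 : Exec W (.assign x (.lit 0)) s₀ 2 (s₀.set x 0) := Exec.assign x _ _ (Nat.zero_le _)
  obtain ⟨t, s', h2, h3, h4⟩ := main n 0 (by omega) (s₀.set x 0) (by
    intro r hr
    simp only [List.mem_cons, not_or] at hr
    simp [hr.1]) (by intros; rfl) (by simp) h0
  refine ⟨_, _, .seq _ _ _ _ _ _ _ h1 h2, ?_, h4⟩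
  rw [Finset.range_eq_Ico]
  omega

/-- The rule for counting loops with a uniform bound for the body. -/
theorem Runs.for_const {W : ℕ} {x y : ℕ} {p : Program} {s₀ : State} {n b : ℕ}
    (I : ℕ → State → Prop) (hn : s₀.reg y = n) (hW : n ≤ W) (hW' : 1 ≤ W) (hxy : y ≠ x)
    (hy : y ∉ p.wregs) (hx : x ∉ p.wregs) (h0 : I 0 (s₀.set x 0))
    (step : ∀ i < n, ∀ s : State, (∀ r, r ∉ x :: p.wregs → s.reg r = s₀.reg r) →
      (∀ a, a ∉ p.wmems → s.mem a = s₀.mem a) → s.reg x = i → I i s →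
      Runs W p s b fun s' => I (i + 1) (s'.set x (i + 1))) :
    Runs W (.for x y p) s₀ (n * (b + 8) + 6) fun s' => s'.reg x = n ∧ I n s' := by
  have := Runs.for (b := fun _ => b) I hn hW hW' hxy hy hx h0 step
  simpa using this

/-! ### The exchange argument -/

section Exchange

variable {m D N T M k : ℕ} {act : ℕ → ℕ → Prop} {c c' c'' : ℕ → ℕ → ℕ} {rank : ℕ → ℕ}

/-- The pair `e` (of the vertices `e / m` and `e % m` among `0, …, m - 1`) is active and bichromatic
at the time `t` under the coloring `c t x` of the vertices `x`. -/
def Good (m : ℕ) (act : ℕ → ℕ → Prop) (c : ℕ → ℕ → ℕ) (t e : ℕ) : Prop :=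
  act t e ∧ c t (e / m) ≠ c t (e % m)

/-- Every window of `D` consecutive times among `0, …, T - 1` in which a pair is active contains a
time at which this pair is active and bichromatic. -/
def WinOK (m D T : ℕ) (act : ℕ → ℕ → Prop) (c : ℕ → ℕ → ℕ) : Prop :=
  ∀ s, s + D ≤ T → ∀ e < m * m, (∃ t, s ≤ t ∧ t < s + D ∧ act t e) →
    ∃ t, s ≤ t ∧ t < s + D ∧ Good m act c t e

/-- Every good time of a pair under `c` lies, within its block of `D` consecutive times, between two
good times of the same pair under `c'`. -/
def Covers (m D : ℕ) (act : ℕ → ℕ → Prop) (c c' : ℕ → ℕ → ℕ) : Prop :=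
  ∀ t e, Good m act c t e →
    (∃ t' ≤ t, t' / D = t / D ∧ Good m act c' t' e) ∧
    (∃ t', t ≤ t' ∧ t' / D = t / D ∧ Good m act c' t' e)

theorem Covers.refl : Covers m D act c c := fun t _ h => ⟨⟨t, le_rfl, rfl, h⟩, ⟨t, le_rfl, rfl, h⟩⟩

theorem Covers.trans (h : Covers m D act c c') (h' : Covers m D act c' c'') :
    Covers m D act c c'' := by
  intro t e hg
  obtain ⟨⟨t₁, h₁, hb₁, hg₁⟩, ⟨t₂, h₂, hb₂, hg₂⟩⟩ := h t e hg
  obtain ⟨⟨t₃, h₃, hb₃, hg₃⟩, -⟩ := h' t₁ e hg₁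
  obtain ⟨-, ⟨t₄, h₄, hb₄, hg₄⟩⟩ := h' t₂ e hg₂
  exact ⟨⟨t₃, h₃.trans h₁, hb₃.trans hb₁, hg₃⟩, ⟨t₄, h₂.trans h₄, hb₄.trans hb₂, hg₄⟩⟩

/-- A window meets a block of its own length in a prefix or in a suffix of the block, so that only
the first and the last good time of a pair in a block matter. -/
theorem WinOK.of_covers (hD : 0 < D) (h : WinOK m D T act c) (hc : Covers m D act c c') :
    WinOK m D T act c' := by
  intro s hs e he hact
  obtain ⟨t, hst, hts, hg⟩ := h s hs e he hact
  obtain ⟨⟨t₁, h₁, hb₁, hg₁⟩, ⟨t₂, h₂, hb₂, hg₂⟩⟩ := hc t e hg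
  have e0 := Nat.div_add_mod t D
  have e1 := Nat.div_add_mod t₁ D
  have e2 := Nat.div_add_mod t₂ D
  have l1 := Nat.mod_lt t₁ hD
  have l2 := Nat.mod_lt t₂ hD
  rw [hb₁] at e1
  rw [hb₂] at e2
  by_cases hsb : s ≤ D * (t / D)
  · exact ⟨t₁, by omega, by omega, hg₁⟩
  · exact ⟨t₂, by omega, by omega, hg₂⟩

/-- Among the colorings with `k` colors covering `c` there is one that is maximal for the covering
preorder. -/
theorem exists_maximal_covers (hact : ∀ t e, act t e → t < N ∧ e < m * m)
    (hc : ∀ t x, c t x < k) :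
    ∃ c', Covers m D act c c' ∧ (∀ t x, c' t x < k) ∧
      ∀ c'', (∀ t x, c'' t x < k) → Covers m D act c' c'' → Covers m D act c'' c' := by
  -- the covering preorder is the inclusion order of these subsets of a finite set
  let U : (ℕ → ℕ → ℕ) → Set (Bool × ℕ × ℕ) := fun c => {p | p.2.1 < N ∧ ∃ t, t / D = p.2.1 / D ∧
    (if p.1 then t ≤ p.2.1 else p.2.1 ≤ t) ∧ Good m act c t p.2.2}
  have hU : ∀ c c', Covers m D act c c' ↔ U c ⊆ U c' := by
    intro c c'
    constructor
    · rintro h ⟨b, t, e⟩ ⟨htN, t₀, hb, hle, hg⟩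
      obtain ⟨⟨t₁, h₁, hb₁, hg₁⟩, ⟨t₂, h₂, hb₂, hg₂⟩⟩ := h t₀ e hg
      cases b
      · exact ⟨htN, t₂, hb₂.trans hb, by simp at hle ⊢; omega, hg₂⟩
      · exact ⟨htN, t₁, hb₁.trans hb, by simp at hle ⊢; omega, hg₁⟩
    · intro h t e hg
      have htN := (hact t e hg.1).1
      obtain ⟨-, t₁, hb₁, h₁, hg₁⟩ := @h (true, t, e) ⟨htN, t, rfl, by simp, hg⟩
      obtain ⟨-, t₂, hb₂, h₂, hg₂⟩ := @h (false, t, e) ⟨htN, t, rfl, by simp, hg⟩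
      exact ⟨⟨t₁, by simpa using h₁, hb₁, hg₁⟩, ⟨t₂, by simpa using h₂, hb₂, hg₂⟩⟩
  let F : Set (Set (Bool × ℕ × ℕ)) := {u | ∃ c', Covers m D act c c' ∧ (∀ t x, c' t x < k) ∧
      u = U c'}
  have hF : F.Finite := by
    refine Set.Finite.subset (Set.Finite.powerset
      (Set.finite_univ.prod ((Set.finite_Iio N).prod (Set.finite_Iio (m * m))))) ?_
    rintro u ⟨c', -, -, rfl⟩ ⟨b, t, e⟩ ⟨htN, t₀, hb, hle, hg⟩
    exact ⟨trivial, htN, (hact _ _ hg.1).2⟩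
  obtain ⟨u, hu⟩ := hF.exists_maximal ⟨U c, c, .refl, hc, rfl⟩
  obtain ⟨⟨c', h1, h2, rfl⟩, hmax⟩ := hu
  refine ⟨c', h1, h2, fun c'' h3 h4 => ?_⟩
  rw [hU] at h4 ⊢
  exact hmax ⟨c'', h1.trans ((hU _ _).2 h4), h3, rfl⟩ h4

/-- Let `c` be maximal for the covering preorder and let `A` consist of more than `2 m²` active
times of the pair `e` in one block. Some `τ ∈ A` is neither the first nor the last good time of a
pair in the block; recoloring at `τ` so that `e` becomes bichromatic yields a coloring that covers
`c` and hence is covered by `c`. So `e` has good times under `c` on both sides of `τ`. -/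
theorem exists_good_around (hk : 2 ≤ k) (hact : ∀ t e, act t e → t < N ∧ e < m * m)
    (hloop : ∀ t e, act t e → e / m ≠ e % m) (hc : ∀ t x, c t x < k)
    (hmax : ∀ c'', (∀ t x, c'' t x < k) → Covers m D act c c'' → Covers m D act c'' c)
    {q e : ℕ} {A : Finset ℕ} (hA : ∀ t ∈ A, act t e ∧ t / D = q)
        (hcard : 2 * (m * m) + 1 ≤ A.card) :
    ∃ τ ∈ A, (∃ t ≤ τ, t / D = q ∧ Good m act c t e) ∧
      (∃ t, τ ≤ t ∧ t / D = q ∧ Good m act c t e) := by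
  classical
  let g : ℕ → Finset ℕ := fun e => (Finset.range N).filter fun t => t / D = q ∧ Good m act c t e
  have hg : ∀ t e, Good m act c t e → t / D = q → t ∈ g e := by
    intro t e h hq
    simp [g, h, hq, (hact t e h.1).1]
  have hg' : ∀ t e, t ∈ g e → t / D = q ∧ Good m act c t e := by
    intro t e h
    simpa [g] using (Finset.mem_filter.1 h).2
  let lo : ℕ → ℕ := fun e => sInf (g e : Set ℕ)
  let hi : ℕ → ℕ := fun e => (g e).sup id
  let F : Finset ℕ := (Finset.range (m * m)).image lo ∪ (Finset.range (m * m)).image hi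
  have hF : F.card < A.card := by
    have h1 := Finset.card_union_le ((Finset.range (m * m)).image lo)
        ((Finset.range (m * m)).image hi)
    have h2 := Finset.card_image_le (s := Finset.range (m * m)) (f := lo)
    have h3 := Finset.card_image_le (s := Finset.range (m * m)) (f := hi)
    simp only [Finset.card_range] at h2 h3
    change (Finset.image lo _ ∪ Finset.image hi _).card < _
    omega
  obtain ⟨τ, hτA, hτF⟩ := Finset.exists_mem_notMem_of_card_lt_card hF
  obtain ⟨hτe, hτq⟩ := hA τ hτA
  let c'' : ℕ → ℕ → ℕ := Function.update c τ fun x => if x = e / m then 1 else 0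
  have hne : ∀ t e', t ≠ τ → Good m act c t e' → Good m act c'' t e' := by
    intro t e' ht h
    simpa [Good, c'', Function.update_of_ne ht] using h
  have hgood : Good m act c'' τ e := by
    refine ⟨hτe, ?_⟩
    simp [c'', (hloop τ e hτe).symm]
  have hcov : Covers m D act c c'' := by
    intro t e' ht
    by_cases htτ : t = τ
    · subst htτ
      have hmem := hg t e' ht hτq
      have he' : e' ∈ Finset.range (m * m) := Finset.mem_range.2 (hact t e' ht.1).2
      have hlo : lo e' ∈ g e' := Nat.sInf_mem (s := (g e' : Set ℕ)) ⟨t, hmem⟩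
      have hhi : hi e' ∈ g e' := by
        obtain ⟨y, hy, hy'⟩ := Finset.exists_mem_eq_sup (g e') ⟨t, hmem⟩ id
        change (g e').sup id ∈ _
        rw [hy']
        exact hy
      have hlt : lo e' ≤ t := Nat.sInf_le (s := (g e' : Set ℕ)) hmem
      have hth : t ≤ hi e' := Finset.le_sup (f := id) hmem
      have n1 : lo e' ≠ t := fun h =>
        hτF (Finset.mem_union_left _ (Finset.mem_image.2 ⟨e', he', h⟩))
      have n2 : hi e' ≠ t := fun h =>
        hτF (Finset.mem_union_right _ (Finset.mem_image.2 ⟨e', he', h⟩))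
      exact ⟨⟨lo e', hlt, (hg' _ _ hlo).1.trans hτq.symm, hne _ _ n1 (hg' _ _ hlo).2⟩,
        ⟨hi e', hth, (hg' _ _ hhi).1.trans hτq.symm, hne _ _ n2 (hg' _ _ hhi).2⟩⟩
    · exact ⟨⟨t, le_rfl, rfl, hne t e' htτ ht⟩, ⟨t, le_rfl, rfl, hne t e' htτ ht⟩⟩
  have hk' : ∀ t x, c'' t x < k := by
    intro t x
    by_cases htτ : t = τ
    · subst htτ
      simp only [c'', Function.update_self]
      split <;> omega
    · simpa [c'', Function.update_of_ne htτ] using hc t x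
  obtain ⟨⟨t₁, h₁, hb₁, hg₁⟩, ⟨t₂, h₂, hb₂, hg₂⟩⟩ := hmax c'' hk' hcov τ e hgood
  exact ⟨τ, hτA, ⟨t₁, h₁, hb₁.trans hτq, hg₁⟩, ⟨t₂, h₂, hb₂.trans hτq, hg₂⟩⟩

open Classical in
/-- The number of active times of the pair `e` that precede `t` in its block. -/
noncomputable def before (D : ℕ) (act : ℕ → ℕ → Prop) (t e : ℕ) : ℕ :=
  ((Finset.range t).filter fun t' => t' / D = t / D ∧ act t' e).card

open Classical in
/-- The number of active times of the pair `e` below `N` that follow `t` in its block. -/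
noncomputable def after (D N : ℕ) (act : ℕ → ℕ → Prop) (t e : ℕ) : ℕ :=
  ((Finset.Ioo t N).filter fun t' => t' / D = t / D ∧ act t' e).card

theorem before_lt_before {t t' e : ℕ} (h : t < t') (hb : t / D = t' / D) (ha : act t e) :
    before D act t e < before D act t' e := by
  classical
  refine Finset.card_lt_card ⟨?_, ?_⟩
  · intro u hu
    simp only [Finset.mem_filter, Finset.mem_range] at hu ⊢
    exact ⟨hu.1.trans h, hu.2.1.trans hb, hu.2.2⟩
  · intro hsub
    have : t ∈ (Finset.range t).filter fun t' => t' / D = t / D ∧ act t' e :=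
      hsub (by simp [h, hb, ha])
    simp at this

theorem after_lt_after {t t' e : ℕ} (h : t < t') (ht' : t' < N) (hb : t / D = t' / D)
    (ha : act t' e) : after D N act t' e < after D N act t e := by
  classical
  refine Finset.card_lt_card ⟨?_, ?_⟩
  · intro u hu
    simp only [Finset.mem_filter, Finset.mem_Ioo] at hu ⊢
    exact ⟨⟨h.trans hu.1.1, hu.1.2⟩, hu.2.1.trans hb.symm, hu.2.2⟩
  · intro hsub
    have : t' ∈ (Finset.Ioo t' N).filter fun u => u / D = t' / D ∧ act u e :=
      hsub (by simp [h, hb, ha, ht'])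
    simp at this

/-- An assignment of slots to the times below `N`. The slot `0` is shared by times at which all
active pairs have at least `M` active times before and `M` active times after in the block. Any
other slot names a pair `e`, a direction, and a number below `M` of active times of `e` seen in this
direction. -/
def IsSlotting (m D N M : ℕ) (act : ℕ → ℕ → Prop) (rank : ℕ → ℕ) : Prop :=
  ∀ t < N,
    (rank t = 0 ∧ ∀ e < m * m, act t e → M ≤ before D act t e ∧ M ≤ after D N act t e) ∨
    (∃ e < m * m, act t e ∧ before D act t e < M ∧ rank t = e * M + before D act t e + 1) ∨
    (∃ e < m * m, act t e ∧ after D N act t e < M ∧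
      rank t = m * m * M + e * M + after D N act t e + 1)

/-! Pairs `(e, a)` with `a < M` are coded as `e * M + a`. -/

theorem code_lt {M E e a : ℕ} (he : e < E) (ha : a < M) : e * M + a < E * M := by
  have : (e + 1) * M ≤ E * M := Nat.mul_le_mul_right _ he
  rw [Nat.succ_mul] at this
  omega

theorem code_inj {M e e' a a' : ℕ} (ha : a < M) (ha' : a' < M) (h : e * M + a = e' * M + a') :
    e = e' ∧ a = a' := by
  have h1 : e = e' := by
    have h2 : (e * M + a) / M = (e' * M + a') / M := by rw [h]
    rwa [Nat.add_comm, Nat.add_mul_div_right _ _ (by omega), Nat.div_eq_of_lt ha, Nat.add_comm _ a',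
      Nat.add_mul_div_right _ _ (by omega), Nat.div_eq_of_lt ha', zero_add, zero_add] at h2
  subst h1
  exact ⟨rfl, by omega⟩

theorem IsSlotting.le (h : IsSlotting m D N M act rank) {t : ℕ} (ht : t < N) :
    rank t ≤ 2 * (m * m) * M := by
  have e0 : 2 * (m * m) * M = m * m * M + m * m * M := by ring
  obtain ⟨h1, -⟩ | ⟨e, he, -, hl, h1⟩ | ⟨e, he, -, hl, h1⟩ := h t ht
  · omega
  · have := code_lt he hl
    omega
  · have := code_lt he hl
    omega

/-- Different times of a block have different slots, except for the shared slot `0`. -/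
theorem IsSlotting.inj (h : IsSlotting m D N M act rank) {t t' : ℕ} (ht : t < N) (ht' : t' < N)
    (hb : t / D = t' / D) (h0 : rank t ≠ 0) (hr : rank t = rank t') : t = t' := by
  obtain ⟨h1, -⟩ | ⟨e, he, ha, hl, h1⟩ | ⟨e, he, ha, hl, h1⟩ := h t ht
  · exact absurd h1 h0
  · obtain ⟨h1', -⟩ | ⟨e', he', ha', hl', h1'⟩ | ⟨e', he', ha', hl', h1'⟩ := h t' ht'
    · omega
    · obtain ⟨rfl, hbb⟩ := code_inj hl hl' (by omega : e * M + _ = e' * M + _)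
      rcases lt_trichotomy t t' with hlt | rfl | hlt
      · have := before_lt_before hlt hb ha
        omega
      · rfl
      · have := before_lt_before hlt hb.symm ha'
        omega
    · have := code_lt he hl
      omega
  · obtain ⟨h1', -⟩ | ⟨e', he', ha', hl', h1'⟩ | ⟨e', he', ha', hl', h1'⟩ := h t' ht'
    · omega
    · have := code_lt he' hl'
      omega
    · obtain ⟨rfl, hbb⟩ := code_inj hl hl' (by omega : e * M + _ = e' * M + _)
      rcases lt_trichotomy t t' with hlt | rfl | hlt
      · have := after_lt_after hlt ht' hb ha'
        omega
      · rfl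
      · have := after_lt_after hlt ht hb.symm ha
        omega

open Classical in
/-- If a pair has at least `M` active times before `t` in its block, then it has `M` such times with
a private slot. -/
theorem IsSlotting.card_before (h : IsSlotting m D N M act rank) {t e : ℕ} (ht : t < N)
    (he : e < m * m) (hM : M ≤ before D act t e) :
    M ≤ ((Finset.range t).filter fun t' => (t' / D = t / D ∧ act t' e) ∧ rank t' ≠ 0).card := by
  by_contra hlt
  push Not at hlt
  have : ∃ t', t' < t ∧ t' / D = t / D ∧ act t' e ∧ rank t' = 0 := by
    by_contra hno
    push Not at hno
    refine absurd hM (not_le.2 (lt_of_le_of_lt (Finset.card_le_card ?_) hlt))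
    intro u hu
    simp only [Finset.mem_filter, Finset.mem_range] at hu ⊢
    exact ⟨hu.1, hu.2, hno u hu.1 hu.2.1 hu.2.2⟩
  -- the first active time without a private slot is preceded only by times with one
  obtain ⟨h1, h2, h3, h4⟩ := Nat.find_spec this
  obtain ⟨-, h5⟩ | ⟨e', -, -, -, h5⟩ | ⟨e', -, -, -, h5⟩ := h _ (h1.trans ht)
  · refine absurd (h5 e he h3).1 (not_le.2 (lt_of_le_of_lt (Finset.card_le_card ?_) hlt))
    intro u hu
    simp only [Finset.mem_filter, Finset.mem_range] at hu ⊢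
    refine ⟨hu.1.trans h1, ⟨hu.2.1.trans h2, hu.2.2⟩, fun h0 => ?_⟩
    exact Nat.find_min this hu.1 ⟨hu.1.trans h1, hu.2.1.trans h2, hu.2.2, h0⟩
  · omega
  · omega

open Classical in
/-- The mirror image of `IsSlotting.card_before`. -/
theorem IsSlotting.card_after (h : IsSlotting m D N M act rank) {t e : ℕ}
    (he : e < m * m) (hM : M ≤ after D N act t e) :
    M ≤ ((Finset.Ioo t N).filter fun t' => (t' / D = t / D ∧ act t' e) ∧ rank t' ≠ 0).card := by
  by_contra hlt
  push Not at hlt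
  have : ∃ d, ∃ t', t' + d = N ∧ t < t' ∧ t' < N ∧ t' / D = t / D ∧ act t' e ∧ rank t' = 0 := by
    by_contra hno
    push Not at hno
    refine absurd hM (not_le.2 (lt_of_le_of_lt (Finset.card_le_card ?_) hlt))
    intro u hu
    simp only [Finset.mem_filter, Finset.mem_Ioo] at hu ⊢
    exact ⟨hu.1, hu.2, hno (N - u) u (by omega) hu.1.1 hu.1.2 hu.2.1 hu.2.2⟩
  -- minimizing `N - t'` selects the last active time without a private slot
  obtain ⟨t', h0, h1, h1', h2, h3, h4⟩ := Nat.find_spec this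
  obtain ⟨-, h5⟩ | ⟨e', -, -, -, h5⟩ | ⟨e', -, -, -, h5⟩ := h _ h1'
  · refine absurd (h5 e he h3).2 (not_le.2 (lt_of_le_of_lt (Finset.card_le_card ?_) hlt))
    intro u hu
    simp only [Finset.mem_filter, Finset.mem_Ioo] at hu ⊢
    refine ⟨⟨h1.trans hu.1.1, hu.1.2⟩, ⟨hu.2.1.trans h2, hu.2.2⟩, fun h0' => ?_⟩
    exact Nat.find_min this (m := N - u) (by omega)
      ⟨u, by omega, h1.trans hu.1.1, hu.1.2, hu.2.1.trans h2, hu.2.2, h0'⟩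
  · omega
  · omega

/-- Every coloring is covered by one that gives all vertices the color `0` at the times without a
private slot. In a maximal coloring, the first good time of a pair in a block cannot lack a private
slot: the pair would have `M > 2 m²` earlier active times in the block, and `exists_good_around`
would give an earlier good time. The same holds for the last good time, so that recoloring the times
without a private slot preserves the first and last good times. -/
theorem exists_covers_of_slotting (hk : 2 ≤ k) (hact : ∀ t e, act t e → t < N ∧ e < m * m)
    (hloop : ∀ t e, act t e → e / m ≠ e % m) (hc : ∀ t x, c t x < k)
    (hM : 2 * (m * m) + 1 ≤ M) (hrank : IsSlotting m D N M act rank) :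
    ∃ c', Covers m D act c c' ∧ (∀ t x, c' t x < k) ∧ ∀ t x, rank t = 0 → c' t x = 0 := by
  classical
  obtain ⟨c', h1, h2, h3⟩ := exists_maximal_covers (D := D) hact hc
  refine ⟨fun t x => if rank t = 0 then 0 else c' t x, h1.trans ?_, ?_, ?_⟩
  · have key : ∀ t e, rank t ≠ 0 → Good m act c' t e →
        Good m act (fun t x => if rank t = 0 then 0 else c' t x) t e := by
      intro t e h0 h
      simpa [Good, h0] using h
    intro t e hg
    constructor
    · -- the first good time of the pair in the block has a private slot
      have hex : ∃ t', t' / D = t / D ∧ Good m act c' t' e := ⟨t, rfl, hg⟩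
      obtain ⟨h4, h5⟩ := Nat.find_spec hex
      refine ⟨_, Nat.find_min' hex ⟨rfl, hg⟩, h4, key _ _ (fun h0 => ?_) h5⟩
      obtain ⟨htN, he⟩ := hact _ _ h5.1
      obtain ⟨-, h6⟩ | ⟨e', -, -, -, h6⟩ | ⟨e', -, -, -, h6⟩ := hrank _ htN
      · have h7 := hrank.card_before htN he (h6 e he h5.1).1
        obtain ⟨τ, h8, ⟨u, h9, h10, h11⟩, -⟩ := exists_good_around (q := t / D) hk hact hloop h2 h3
          (A := (Finset.range (Nat.find hex)).filter fun t' =>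
            (t' / D = Nat.find hex / D ∧ act t' e) ∧ rank t' ≠ 0)
          (by
            intro u hu
            simp only [Finset.mem_filter] at hu
            exact ⟨hu.2.1.2, hu.2.1.1.trans h4⟩) (hM.trans h7)
        simp only [Finset.mem_filter, Finset.mem_range] at h8
        exact Nat.find_min hex (h9.trans_lt h8.1) ⟨h10, h11⟩
      · omega
      · omega
    · -- and so has the last one, found by minimizing `N - t'`
      have hex : ∃ d, ∃ t', t' + d = N ∧ t' / D = t / D ∧ Good m act c' t' e :=
        ⟨N - t, t, by have := (hact _ _ hg.1).1; omega, rfl, hg⟩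
      obtain ⟨t', h0', h4, h5⟩ := Nat.find_spec hex
      have hmin : ∀ u, u / D = t / D → Good m act c' u e → u ≤ t' := by
        intro u hu hu'
        have := Nat.find_min' hex (m := N - u) ⟨u, by have := (hact _ _ hu'.1).1; omega, hu, hu'⟩
        have := (hact _ _ hu'.1).1
        omega
      refine ⟨_, hmin t rfl hg, h4, key _ _ (fun h0 => ?_) h5⟩
      obtain ⟨htN, he⟩ := hact _ _ h5.1
      obtain ⟨-, h6⟩ | ⟨e', -, -, -, h6⟩ | ⟨e', -, -, -, h6⟩ := hrank _ htN
      · have h7 := hrank.card_after he (h6 e he h5.1).2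
        obtain ⟨τ, h8, -, ⟨u, h9, h10, h11⟩⟩ := exists_good_around (q := t / D) hk hact hloop h2 h3
          (A := (Finset.Ioo t' N).filter fun u =>
            (u / D = t' / D ∧ act u e) ∧ rank u ≠ 0)
          (by
            intro u hu
            simp only [Finset.mem_filter] at hu
            exact ⟨hu.2.1.2, hu.2.1.1.trans h4⟩) (hM.trans h7)
        simp only [Finset.mem_filter, Finset.mem_Ioo] at h8
        have := hmin u h10 h11
        omega
      · omega
      · omega
  · intro t x
    dsimp only
    split
    · omega
    · exact h2 t x
  · intro t x h0
    simp [h0]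

end Exchange

/-! ### Block states and the dynamic program -/

section Blocks

variable {m D N T M k L B : ℕ} {act : ℕ → ℕ → Prop} {rank : ℕ → ℕ}

/-- The color of the vertex `x` at the time `t` when the block of `t` has the state `a`: a digit of
`a` in base `k`. -/
def stateColor (m k : ℕ) (rank : ℕ → ℕ) (a t x : ℕ) : ℕ := a / k ^ (rank t * m + x) % k

/-- Any sequence of `L` digits in base `k` is that of a number below `k ^ L`. -/
theorem exists_digits (hk : 0 < k) (d : ℕ → ℕ) (hd : ∀ j, d j < k) (L : ℕ) :
    ∃ a < k ^ L, ∀ j < L, a / k ^ j % k = d j := by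
  induction L generalizing d with
  | zero => exact ⟨0, by simp, by simp⟩
  | succ L ih =>
    obtain ⟨a, ha, hj⟩ := ih (fun j => d (j + 1)) fun j => hd _
    refine ⟨d 0 + k * a, ?_, ?_⟩
    · have : k * (a + 1) ≤ k * k ^ L := Nat.mul_le_mul_left _ ha
      have := hd 0
      rw [pow_succ, Nat.mul_comm]
      nlinarith
    · intro j hjL
      cases j with
      | zero => simp [Nat.mod_eq_of_lt (hd 0)]
      | succ j =>
        rw [pow_succ, Nat.mul_comm (k ^ j), ← Nat.div_div_eq_div_mul, Nat.add_mul_div_left _ _ hk,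
          Nat.div_eq_of_lt (hd 0), zero_add]
        exact hj j (by omega)

/-- Every window that ends in the last time of block `i` or in block `i + 1` (up to the last time of
that block, and before `T`) is respected when the blocks `i`, `i + 1` have the states `a`, `b`.
Times are counted from the start of block `i`, and `sel` selects the state. -/
def Compat (m D T k : ℕ) (act : ℕ → ℕ → Prop) (rank : ℕ → ℕ) (i a b : ℕ) : Prop :=
  ∀ e < m * m, ∀ j < D + D, D ≤ j + 1 → i * D + j < T →
    (∃ u ≤ j, j < u + D ∧ act (i * D + u) e) →
      ∃ u ≤ j, j < u + D ∧ Good m act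
        (fun t x => stateColor m k rank (if u < D then a else b) t x) (i * D + u) e

/-- The states `a < S` of block `i` that end a chain of compatible states. -/
def Reach (m D T k S : ℕ) (act : ℕ → ℕ → Prop) (rank : ℕ → ℕ) : ℕ → ℕ → Prop
  | 0, a => a < S
  | i + 1, b => b < S ∧ ∃ a < S, Reach m D T k S act rank i a ∧ Compat m D T k act rank i a b

/-- A window starting in block `i` ends in block `i + 1` or with block `i`, and is therefore
respected if the states of these two blocks are compatible. -/
theorem winOK_of_compat (hD : 0 < D) (a : ℕ → ℕ)
    (h : ∀ i < T / D, Compat m D T k act rank i (a i) (a (i + 1))) :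
    WinOK m D T act fun t x => stateColor m k rank (a (t / D)) t x := by
  intro s hs e he hact
  have e1 := Nat.div_add_mod s D
  have l1 := Nat.mod_lt s hD
  have hi : s / D < T / D := by
    have : (s + D) / D ≤ T / D := Nat.div_le_div_right hs
    rw [Nat.add_div_right _ hD] at this
    omega
  rw [Nat.mul_comm] at e1
  obtain ⟨t, h1, h2, h3⟩ := hact
  obtain ⟨u, h4, h5, h6⟩ := h _ hi e he (s % D + D - 1) (by omega) (by omega) (by omega)
    ⟨t - s / D * D, by omega, by omega, by
      rwa [Nat.add_sub_cancel' (by omega)]⟩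
  refine ⟨s / D * D + u, by omega, by omega, ?_⟩
  have hq : (s / D * D + u) / D = s / D + if u < D then 0 else 1 := by
    rw [Nat.add_comm, Nat.add_mul_div_right _ _ hD, Nat.add_comm]
    congr 1
    split
    · exact Nat.div_eq_of_lt ‹_›
    · exact Nat.div_eq_of_lt_le (by omega) (by omega)
  have hsel : (if u < D then a (s / D) else a (s / D + 1)) = a ((s / D * D + u) / D) := by
    rw [hq]
    split <;> rfl
  rw [hsel] at h6
  exact h6

theorem compat_of_winOK (hD : 0 < D) (a : ℕ → ℕ)
    (h : WinOK m D T act fun t x => stateColor m k rank (a (t / D)) t x) (i : ℕ) :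
    Compat m D T k act rank i (a i) (a (i + 1)) := by
  intro e he j hj hDj hT ⟨u, h1, h2, h3⟩
  obtain ⟨t, h4, h5, h6⟩ := h (i * D + j + 1 - D) (by omega) e he
    ⟨i * D + u, by omega, by omega, h3⟩
  refine ⟨t - i * D, by omega, by omega, ?_⟩
  obtain ⟨u', rfl⟩ : ∃ u', t = i * D + u' := ⟨t - i * D, by omega⟩
  have hq : (i * D + u') / D = i + if u' < D then 0 else 1 := by
    rw [Nat.add_comm, Nat.add_mul_div_right _ _ hD, Nat.add_comm]
    congr 1
    split
    · exact Nat.div_eq_of_lt ‹_›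
    · exact Nat.div_eq_of_lt_le (by omega) (by omega)
  have hsel : (if u' < D then a i else a (i + 1)) = a ((i * D + u') / D) := by
    rw [hq]
    split <;> rfl
  rw [Nat.add_sub_cancel_left, hsel]
  exact h6

/-- If there is a coloring with `k ≥ 2` colors respecting all windows, then there is a chain of
compatible block states. -/
theorem exists_reach (hD : 0 < D) (hk : 2 ≤ k) (hact : ∀ t e, act t e → t < N ∧ e < m * m)
    (hloop : ∀ t e, act t e → e / m ≠ e % m) {c : ℕ → ℕ → ℕ} (hc : ∀ t x, c t x < k)
    (hM : 2 * (m * m) + 1 ≤ M) (hrank : IsSlotting m D N M act rank)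
    (hL : L = (2 * (m * m) * M + 1) * m)
    (h : WinOK m D T act c) (i : ℕ) : ∃ a, Reach m D T k (k ^ L) act rank i a := by
  classical
  obtain ⟨c', h1, h2, h3⟩ := exists_covers_of_slotting hk hact hloop hc hM hrank
  have h4 := h.of_covers hD h1
  -- the digit with index `r * m + x` of the state of a block is the color of `x` in slot `r`
  have hstate : ∀ i, ∃ a < k ^ L, ∀ t < N, t / D = i → ∀ x < m,
      stateColor m k rank a t x = c' t x := by
    intro i
    let d : ℕ → ℕ := fun j =>
      if hex : ∃ t < N, t / D = i ∧ rank t = j / m ∧ rank t ≠ 0 then c' hex.choose (j % m) else 0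
    obtain ⟨a, ha, hj⟩ := exists_digits (k := k) (by omega) d (by
      intro j
      simp only [d]
      split
      · exact h2 _ _
      · omega) L
    refine ⟨a, ha, ?_⟩
    intro t ht hti x hx
    have hlt : rank t * m + x < L := by
      rw [hL]
      exact code_lt (Nat.lt_succ_of_le (hrank.le ht)) hx
    rw [stateColor, hj _ hlt]
    have hdiv : (rank t * m + x) / m = rank t := by
      rw [Nat.add_comm, Nat.add_mul_div_right _ _ (by omega), Nat.div_eq_of_lt hx, zero_add]
    have hmod : (rank t * m + x) % m = x := by
      rw [Nat.add_comm, Nat.add_mul_mod_self_right, Nat.mod_eq_of_lt hx]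
    simp only [d, hdiv, hmod]
    split
    · rename_i hex
      obtain ⟨h5, h6, h7, h8⟩ := hex.choose_spec
      rw [hrank.inj h5 ht (h6.trans hti.symm) h8 h7]
    · rename_i hex
      by_cases h0 : rank t = 0
      · exact (h3 t x h0).symm
      · exact absurd ⟨t, ht, hti, rfl, h0⟩ hex
  choose a ha hcol using hstate
  have hwin : WinOK m D T act fun t x => stateColor m k rank (a (t / D)) t x := by
    intro s hs e he hex
    obtain ⟨t, h5, h6, h7, h8⟩ := h4 s hs e he hex
    have hm : 0 < m := Nat.pos_of_ne_zero (by rintro rfl; simp at he)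
    refine ⟨t, h5, h6, h7, ?_⟩
    have htN := (hact t e h7).1
    dsimp only
    rw [hcol _ t htN rfl _ (Nat.div_lt_of_lt_mul he), hcol _ t htN rfl _ (Nat.mod_lt _ hm)]
    exact h8
  refine ⟨a i, ?_⟩
  induction i with
  | zero => exact ha 0
  | succ i ih => exact ⟨ha _, a i, ha i, ih, compat_of_winOK hD a hwin i⟩

end Blocks

/-! ### Registers and arrays of the program -/

/-! Register `rOut` receives the length of the output. The instance is described by `rn`, `rT`, `rD`
(the window length) and `rEdges`; `rPtr`, `rEdge`, `rU`, `rV`, `rCount`, `rLab` serve to parse it.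
The derived parameters are the number `rm` of matched vertices, `rE = rm ^ 2`, the bound
`rM = 2 * rE + 1` on the slots per pair and direction, `rB = rT / rD`, the number `rBlocks = rB + 1`
of blocks, the number `rN = rBlocks * rD` of times in these blocks, the number `rL` of digits of a
block state, and `rDD = 2 * rD`. The number of colors that is tried is `rk`, and `rS = rk ^ rL` is
the number of block states. The other registers are loop variables, flags and counters.

The array `aIn` holds the input and `aOut` the output. `aX` lists the matched vertices, and `aIdx`
gives for each vertex its position in this list plus one, or `0`. `aAct` is the activity table, with
one row of `rE` cells per time. `aBefore` and `aAfter` count active times, `aRank` holds the slots,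
`aPw` the powers of `rk`, `aF` the table of the dynamic program, `aSel` the two block states that
are being compared, and `aSt` the chain of block states that is found. -/

notation "rOut" => 1
notation "rn" => 2
notation "rT" => 3
notation "rD" => 4
notation "rEdges" => 5
notation "rm" => 6
notation "rPtr" => 7
notation "rEdge" => 8
notation "rU" => 9
notation "rV" => 10
notation "rCount" => 11
notation "rLab" => 12
notation "rE" => 13
notation "rM" => 14
notation "rB" => 15
notation "rBlocks" => 16
notation "rN" => 17
notation "rL" => 18
notation "rt" => 19
notation "re" => 20
notation "rTime" => 21
notation "rTry" => 22
notation "rTries" => 23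
notation "rk" => 24
notation "rFound" => 25
notation "rS" => 26
notation "rPow" => 27
notation "rI" => 28
notation "rb" => 29
notation "ra" => 30
notation "rOk" => 31
notation "rj" => 32
notation "rDD" => 33
notation "rLastAct" => 34
notation "rLastGood" => 35
notation "rCur" => 36
notation "rBack" => 37
notation "rx" => 38

notation "aIn" => 0
notation "aOut" => 1
notation "aIdx" => 2
notation "aX" => 3
notation "aAct" => 4
notation "aBefore" => 5
notation "aAfter" => 6
notation "aRank" => 7
notation "aPw" => 8
notation "aF" => 9
notation "aSel" => 10
notation "aSt" => 11

open Program Exp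

/-! ### Testing two consecutive block states for compatibility -/

/-- The activity relation stored in the array `A`: row `t` holds the `m²` pairs. -/
def actOf (m : ℕ) (A : ℕ → ℕ) (t e : ℕ) : Prop := e < m * m ∧ A (t * (m * m) + e) ≠ 0

/-- The registers and arrays that are fixed while the dynamic program runs for `k` colors. -/
structure DPCtx (W m D T k B N L S : ℕ) (A rank : ℕ → ℕ) (s : State) : Prop where
  m_eq : s.reg rm = m
  E_eq : s.reg rE = m * m
  D_eq : s.reg rD = D
  DD_eq : s.reg rDD = D + D
  T_eq : s.reg rT = T
  k_eq : s.reg rk = k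
  B_eq : s.reg rB = B
  S_eq : s.reg rS = S
  act_eq : s.mem aAct = A
  rank_eq : s.mem aRank = rank
  pw_eq : ∀ j ≤ L, s.mem aPw j = k ^ j

theorem DPCtx.congr {W m D T k B N L S : ℕ} {A rank : ℕ → ℕ} {s s' : State}
    (h : DPCtx W m D T k B N L S A rank s)
    (hr : ∀ r ∈ [rm, rE, rD, rDD, rT, rk, rB, rS], s'.reg r = s.reg r)
    (ha : ∀ a ∈ [aAct, aRank, aPw], s'.mem a = s.mem a) :
    DPCtx W m D T k B N L S A rank s' := by
  obtain ⟨h1, h2, h3, h4, h5, h6, h7, h8, h9, h10, h11⟩ := h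
  simp only [List.mem_cons, List.not_mem_nil, or_false, forall_eq_or_imp, forall_eq] at hr ha
  constructor <;> simp_all

/-- The color of the vertex `xE` at the time `tE` in the block state `aE`. -/
def colorExp (aE tE xE : Exp) : Exp :=
  aE / .get aPw (.get aRank tE * .reg rm + xE) % .reg rk

/-- Update the last active and the last good time (plus one) of the pair `re` in a scan of the
blocks `rI`, `rI + 1` that has reached the offset `rj`. -/
def scanUpdate : Program :=
  .seq (.assign rTime (.reg rI * .reg rD + .reg rj))
  (.ite (.get aAct (.reg rTime * .reg rE + .reg re))
    (.seq (.assign rLastAct (.reg rj + .lit 1))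
      (.ite (.op .eq (colorExp (.get aSel (.reg rj / .reg rD)) (.reg rTime) (.reg re / .reg rm))
          (colorExp (.get aSel (.reg rj / .reg rD)) (.reg rTime) (.reg re % .reg rm)))
        .skip (.assign rLastGood (.reg rj + .lit 1)))) .skip)

/-- Reject if the window that ends at the offset `rj` contains an active but no good time. -/
def scanTest : Program :=
  .ite (.op .lt (.reg rD) (.reg rj + .lit 2))
    (.ite (.op .lt (.reg rTime) (.reg rT))
      (.ite (.op .lt (.reg rj + .lit 1) (.reg rLastAct + .reg rD))
        (.ite (.op .lt (.reg rj + .lit 1) (.reg rLastGood + .reg rD))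
          .skip (.assign rOk (.lit 0))) .skip) .skip) .skip

/-- Set `rOk` to `1` or `0` according to whether the states `ra`, `rb` of the blocks `rI`, `rI + 1`
are compatible. -/
def checkProg : Program :=
  .seq (.store aSel (.lit 0) (.reg ra)) <|
  .seq (.store aSel (.lit 1) (.reg rb)) <|
  .seq (.assign rOk (.lit 1)) <|
  .for re rE <|
    .seq (.assign rLastAct (.lit 0)) <|
    .seq (.assign rLastGood (.lit 0)) <|
    .for rj rDD (.seq scanUpdate scanTest)

open Classical in
/-- `u + 1` for the largest `u < j` with `p u`, and `0` if there is none. -/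
noncomputable def lastIdx (p : ℕ → Prop) : ℕ → ℕ
  | 0 => 0
  | j + 1 => if p j then j + 1 else lastIdx p j

theorem lastIdx_le (p : ℕ → Prop) (j : ℕ) : lastIdx p j ≤ j := by
  induction j with
  | zero => simp [lastIdx]
  | succ j ih =>
    rw [lastIdx]
    split <;> omega

/-- The window of length `D` that ends at `j - 1` contains a time with `p` iff the last such time
below `j` is recent enough. -/
theorem lt_lastIdx_add (p : ℕ → Prop) {D j : ℕ} (h : D ≤ j) :
    j < lastIdx p j + D ↔ ∃ u < j, j < u + 1 + D ∧ p u := by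
  have main : ∀ j' ≤ j, j < lastIdx p j' + D ↔ ∃ u < j', j < u + 1 + D ∧ p u := by
    intro j'
    induction j' with
    | zero => simp [lastIdx, h]
    | succ j' ih =>
      intro hj
      rw [lastIdx]
      split
      · rename_i hp
        constructor
        · intro h1
          exact ⟨j', by omega, h1, hp⟩
        · rintro ⟨u, h1, h2, h3⟩
          omega
      · rename_i hp
        rw [ih (by omega)]
        constructor
        · rintro ⟨u, h1, h2, h3⟩
          exact ⟨u, by omega, h2, h3⟩
        · rintro ⟨u, h1, h2, h3⟩
          refine ⟨u, ?_, h2, h3⟩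
          rcases Nat.lt_succ_iff_lt_or_eq.1 h1 with h4 | rfl
          · exact h4
          · exact absurd h3 hp
  exact main j le_rfl

section Check

variable {W m D T k B N L S : ℕ} {A rank : ℕ → ℕ}

/-- The condition of `Compat` for the pair `e` and the window that ends at offset `j`. -/
def CompatAt (m D T k : ℕ) (act : ℕ → ℕ → Prop) (rank : ℕ → ℕ) (i a b e j : ℕ) : Prop :=
  D ≤ j + 1 → i * D + j < T →
    (∃ u ≤ j, j < u + D ∧ act (i * D + u) e) →
      ∃ u ≤ j, j < u + D ∧ Good m act
        (fun t x => stateColor m k rank (if u < D then a else b) t x) (i * D + u) e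

/-- Sizes that make all values of the dynamic program fit: there are `B + 1` blocks of length `D`,
which contain the times below `N ≥ T`, and `S = k ^ L` block states, and all cells and tables have
indices at most `W`. -/
structure DPBounds (W m D T k B N L S : ℕ) (A rank : ℕ → ℕ) : Prop where
  D_pos : 0 < D
  k_ge : 2 ≤ k
  k_le : k ≤ W
  S_eq : S = k ^ L
  T_le : T ≤ N
  N_eq : N = (B + 1) * D
  cells : N * (m * m) + 4 * N + m * m + m + 4 ≤ W
  A_le : ∀ i, A i ≤ 1
  rank_le : ∀ t < N, rank t * m + m ≤ L
  rank_le' : ∀ t < N, rank t ≤ W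
  L_le : L ≤ W
  table : (B + 2) * S + 1 ≤ W

theorem scanTest_runs {s : State} {j t x y : ℕ} (hj : s.reg rj = j) (ht : s.reg rTime = t)
    (hD : s.reg rD = D) (hT : s.reg rT = T) (hx : s.reg rLastAct = x) (hy : s.reg rLastGood = y)
    (hok : s.reg rOk ≤ 1) (hW : j + 2 ≤ W) (hDW : D ≤ W) (htW : t ≤ W) (hTW : T ≤ W)
    (hxW : x + D ≤ W) (hyW : y + D ≤ W) :
    Runs W scanTest s scanTest.cost fun s' => s'.reg rOk ≤ 1 ∧
      (s'.reg rOk ≠ 0 ↔ s.reg rOk ≠ 0 ∧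
        (D ≤ j + 1 → t < T → j + 1 < x + D → j + 1 < y + D)) := by
  apply Runs.of_wp
  have hW' : 1 ≤ W := by omega
  have h1 : D < j + 2 ↔ D ≤ j + 1 := by omega
  have e1 : x ≤ W := by omega
  have e2 : y ≤ W := by omega
  have e3 : j ≤ W := by omega
  have e4 : j + 1 ≤ W := by omega
  have e5 : 2 ≤ W := by omega
  by_cases c1 : D ≤ j + 1 <;> by_cases c2 : t < T <;> by_cases c3 : j + 1 < x + D <;>
    by_cases c4 : j + 1 < y + D <;>
    simp [scanTest, Program.wp, hj, ht, hD, hT, hx, hy, h1, c1, c2, c3, c4, hW', hok, hW, hDW, htW,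
      hTW, hxW, hyW, e1, e2, e3, e4, e5]

theorem scanUpdate_runs (hB : DPBounds W m D T k B N L S A rank) {i a b e j : ℕ} {s : State}
    (hs : DPCtx W m D T k B N L S A rank s) (hi : i < B) (ha : a < S) (hb : b < S) (he : e < m * m)
    (hj : j < D + D) (hI : s.reg rI = i) (hsel0 : s.mem aSel 0 = a) (hsel1 : s.mem aSel 1 = b)
    (hse : s.reg re = e) (hsj : s.reg rj = j)
    (hla : s.reg rLastAct = lastIdx (fun u => actOf m A (i * D + u) e) j)
    (hlg : s.reg rLastGood = lastIdx (fun u => Good m (actOf m A)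
      (fun t x => stateColor m k rank (if u < D then a else b) t x) (i * D + u) e) j) :
    Runs W scanUpdate s scanUpdate.cost fun s' => s'.reg rTime = i * D + j ∧
      s'.reg rLastAct = lastIdx (fun u => actOf m A (i * D + u) e) (j + 1) ∧
      s'.reg rLastGood = lastIdx (fun u => Good m (actOf m A)
        (fun t x => stateColor m k rank (if u < D then a else b) t x) (i * D + u) e) (j + 1) := by
  obtain ⟨D_pos, k_ge, k_le, S_eq, T_le, N_eq, cells, A_le, rank_le, rank_le', L_le, table⟩ := hB
  apply Runs.of_wp
  have hW : 1 ≤ W := by omega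
  have hm : 0 < m := Nat.pos_of_ne_zero (by rintro rfl; simp at he)
  have ht : i * D + j < N := by
    have : (i + 2) * D ≤ (B + 1) * D := Nat.mul_le_mul_right _ (by omega)
    have e1 : (i + 2) * D = i * D + (D + D) := by ring
    omega
  have hcell : (i * D + j) * (m * m) + e < N * (m * m) := code_lt ht he
  have hmul : (i * D + j) * (m * m) ≤ W := by omega
  have hcell' : (i * D + j) * (m * m) + e ≤ W := by omega
  have hdiv : e / m < m := Nat.div_lt_of_lt_mul he
  have hmod : e % m < m := Nat.mod_lt _ hm
  have hSW : S ≤ W := by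
    have : 1 * S ≤ (B + 2) * S := Nat.mul_le_mul_right _ (by omega)
    omega
  have hr1 := rank_le _ ht
  have hr2 := rank_le' _ ht
  have hsel : s.mem aSel (j / D) = if j < D then a else b := by
    split
    · rw [Nat.div_eq_of_lt ‹_›, hsel0]
    · rw [Nat.div_eq_of_lt_le (k := 1) (by omega) (by omega), hsel1]
  have hselW : (if j < D then a else b) ≤ W := by split <;> omega
  have hpW : ∀ x < m, k ^ (rank (i * D + j) * m + x) ≤ W := by
    intro x hx
    exact (Nat.pow_le_pow_right (by omega) (by omega)).trans (S_eq ▸ hSW)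
  have hp1 := hs.pw_eq (rank (i * D + j) * m + e / m) (by omega)
  have hp2 := hs.pw_eq (rank (i * D + j) * m + e % m) (by omega)
  have hpW1 := hpW _ hdiv
  have hpW2 := hpW _ hmod
  have hD2 : D + D ≤ N := by
    have : 2 * D ≤ (B + 1) * D := Nat.mul_le_mul_right _ (by omega)
    omega
  have hcellW := (A_le ((i * D + j) * (m * m) + e)).trans hW
  have hiB : i ≤ W := by
    have : i * 1 ≤ i * D := Nat.mul_le_mul_left _ D_pos
    omega
  have w1 : rank (i * D + j) * m + e / m ≤ W := by omega
  have w2 : rank (i * D + j) * m + e % m ≤ W := by omega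
  have w3 : rank (i * D + j) * m ≤ W := by omega
  have w4 : i * D + j ≤ W := by omega
  have w5 : i * D ≤ W := by omega
  have w6 : D ≤ W := by omega
  have w7 : j + 1 ≤ W := by omega
  have w8 : j ≤ W := by omega
  have w9 : e ≤ W := by omega
  have w10 : m ≤ W := by omega
  have w11 : m * m ≤ W := by omega
  clear cells table N_eq T_le hcell rank_le rank_le' A_le hpW
  by_cases c1 : A ((i * D + j) * (m * m) + e) = 0
  · have c1' : ¬ actOf m A (i * D + j) e := fun h => h.2 c1
    have c2' : ¬ Good m (actOf m A)
        (fun t x => stateColor m k rank (if j < D then a else b) t x) (i * D + j) e :=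
      fun h => c1' h.1
    simp [scanUpdate, Program.wp, lastIdx, c1', c2', hs.D_eq, hs.E_eq, hs.act_eq, hsj, hse,
      hI, c1, hla, hlg, w4, w5, w6, w8, w9, w11, hiB, hmul, hcell']
  · have c1' : actOf m A (i * D + j) e := ⟨he, c1⟩
    by_cases c2 : stateColor m k rank (if j < D then a else b) (i * D + j) (e / m) =
      stateColor m k rank (if j < D then a else b) (i * D + j) (e % m)
    · have c2' : ¬ Good m (actOf m A)
          (fun t x => stateColor m k rank (if j < D then a else b) t x) (i * D + j) e :=
        fun h => h.2 c2
      simp only [stateColor] at c2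
      simp [scanUpdate, Program.wp, colorExp, lastIdx, c1', c2', hs.D_eq, hs.m_eq, hs.E_eq,
        hs.act_eq, hsj, hse, hs.rank_eq, hs.k_eq, hp1, hp2, hsel,
        hI, c1, c2, hla, hlg, w1, w2, w3, w4, w5, w6, w7, w8, w9, w10, w11, hiB, hmul, hcell',
            hcellW,
        hselW, hr2, hpW1, hpW2, k_le, hW]
    · have c2' : Good m (actOf m A)
          (fun t x => stateColor m k rank (if j < D then a else b) t x) (i * D + j) e :=
        ⟨c1', c2⟩
      simp only [stateColor] at c2
      simp [scanUpdate, Program.wp, colorExp, lastIdx, c1', c2', hs.D_eq, hs.m_eq, hs.E_eq,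
        hs.act_eq, hsj, hse, hs.rank_eq, hs.k_eq, hp1, hp2, hsel,
        hI, c1, c2, hla, hlg, w1, w2, w3, w4, w5, w6, w7, w8, w9, w10, w11, hiB, hmul, hcell',
            hcellW,
        hselW, hr2, hpW1, hpW2, k_le, hW]

/-- The time bound of the compatibility test. -/
def checkTime (m D : ℕ) : ℕ := 8 + (m * m * (4 +
    ((D + D) * (scanUpdate.cost + scanTest.cost + 8) + 6) + 8) + 6)

theorem checkProg_runs (hB : DPBounds W m D T k B N L S A rank) {i a b : ℕ} {s : State}
    (hs : DPCtx W m D T k B N L S A rank s) (hi : i < B) (ha : a < S) (hb : b < S)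
    (hI : s.reg rI = i) (hra : s.reg ra = a) (hrb : s.reg rb = b) :
    Runs W checkProg s (checkTime m D) fun s' =>
      (s'.reg rOk ≤ 1 ∧ (s'.reg rOk ≠ 0 ↔ Compat m D T k (actOf m A) rank i a b)) := by
  have hSW : S ≤ W := by
    have : 1 * S ≤ (B + 2) * S := Nat.mul_le_mul_right _ (by omega)
    have := hB.table
    omega
  have hcells := hB.cells
  have hDp := hB.D_pos
  have hW : 1 ≤ W := by omega
  have hD2 : D + D ≤ N := by
    have : 2 * D ≤ (B + 1) * D := Nat.mul_le_mul_right _ (by omega)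
    have := hB.N_eq
    omega
  have hT := hB.T_le
  have haW : a ≤ W := by omega
  have hbW : b ≤ W := by omega
  let Q : ℕ → ℕ → Prop := CompatAt m D T k (actOf m A) rank i a b
  have hfinal : Compat m D T k (actOf m A) rank i a b ↔ ∀ e < m * m, ∀ j < D + D, Q e j := Iff.rfl
  refine Runs.mono (b := 3 + (3 + (2 + (m * m *
    (4 + ((D + D) * (scanUpdate.cost + scanTest.cost + 8) + 6) + 8) + 6)))) ?_
    (by rw [checkTime]; omega) fun s' h => h
  refine Runs.seq (R := fun s' => s'.mem aSel 0 = a)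
      (Runs.of_wp (by simp [Program.wp, hra, haW])) ?_
  intro s1 hr1 hm1 hsel1
  have hs1 := hs.congr (fun r h => hr1 r (by revert r; decide))
      (fun r h => hm1 r (by revert r; decide))
  refine Runs.seq (R := fun s' => s'.mem aSel 0 = a ∧ s'.mem aSel 1 = b)
    (Runs.of_wp (by simp [Program.wp, hr1, hrb, hbW, hsel1, hW, Program.wregs])) ?_
  intro s2 hr2 hm2 hsel2
  have hs2 := hs1.congr (fun r h => hr2 r (by revert r; decide))
      (fun r h => hm2 r (by revert r; decide))
  refine Runs.seq (R := fun s' => s'.reg rOk = 1) (Runs.of_wp (by simp [Program.wp, hW])) ?_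
  intro s3 hr3 hm3 hok3
  have hs3 := hs2.congr (fun r h => hr3 r (by revert r; decide))
      (fun r h => hm3 r (by revert r; decide))
  have hI3 : s3.reg rI = i := by rw [hr3 _ (by decide), hr2 _ (by decide), hr1 _ (by decide), hI]
  have hsel3 : s3.mem aSel 0 = a ∧ s3.mem aSel 1 = b := by rwa [hm3 _ (by decide)]
  refine Runs.mono (Runs.for_const (n := m * m)
      (b := 4 + ((D + D) * (scanUpdate.cost + scanTest.cost + 8) + 6))
    (fun e s => s.reg rOk ≤ 1 ∧ (s.reg rOk ≠ 0 ↔ ∀ e' < e, ∀ j < D + D, Q e' j))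
    hs3.E_eq (by omega) hW (by decide) (by decide) (by decide) ?_ ?_) le_rfl ?_
  · simp [hok3]
  · rintro e he s hr hm hse ⟨hok, hok'⟩
    have hs := hs3.congr (fun r h => hr r (by revert r; decide))
        (fun r h => hm r (by revert r; decide))
    refine Runs.mono (b := 2 + (2 + ((D + D) * (scanUpdate.cost + scanTest.cost + 8) + 6))) ?_
      (by omega) fun s' h => h
    refine Runs.seq (R := fun s' => s'.reg rLastAct = 0) (Runs.of_wp (by simp [Program.wp])) ?_
    intro s4 hr4 hm4 h4
    refine Runs.seq (R := fun s' => s'.reg rLastGood = 0) (Runs.of_wp (by simp [Program.wp])) ?_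
    intro s5 hr5 hm5 h5
    have hs4 := hs.congr (fun r h => hr4 r (by revert r; decide))
        (fun r h => hm4 r (by revert r; decide))
    have hs5 := hs4.congr (fun r h => hr5 r (by revert r; decide))
        (fun r h => hm5 r (by revert r; decide))
    have hok5 : s5.reg rOk = s.reg rOk := by rw [hr5 _ (by decide), hr4 _ (by decide)]
    have hLA5 : s5.reg rLastAct = 0 := by rw [hr5 _ (by decide), h4]
    have he5 : s5.reg re = e := by rw [hr5 _ (by decide), hr4 _ (by decide), hse]
    have hI5 : s5.reg rI = i := by
      rw [hr5 _ (by decide), hr4 _ (by decide), hr _ (by decide), hI3]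
    have hsel5 : s5.mem aSel 0 = a ∧ s5.mem aSel 1 = b := by
      rwa [hm5 _ (by decide), hm4 _ (by decide), hm _ (by decide)]
    refine Runs.mono (Runs.for_const (n := D + D) (b := scanUpdate.cost + scanTest.cost)
      (fun j s => s.reg rLastAct = lastIdx (fun u => actOf m A (i * D + u) e) j ∧
        s.reg rLastGood = lastIdx (fun u => Good m (actOf m A)
          (fun t x => stateColor m k rank (if u < D then a else b) t x) (i * D + u) e) j ∧
        s.reg rOk ≤ 1 ∧ (s.reg rOk ≠ 0 ↔ (∀ e' < e, ∀ j < D + D, Q e' j) ∧ ∀ j' < j, Q e j'))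
      hs5.DD_eq (by omega) hW (by decide) (by decide) (by decide) ?_ ?_) le_rfl ?_
    · simp only [State.set_reg]
      simp [hLA5, h5, lastIdx, hok5, hok, ← hok']
    · rintro j hj s6 hr6 hm6 hj6 ⟨hla6, hlg6, hok6, hok6'⟩
      have hs6 := hs5.congr (fun r h => hr6 r (by revert r; decide))
          (fun r h => hm6 r (by revert r; decide))
      have he6 : s6.reg re = e := by rw [hr6 _ (by decide), he5]
      have hI6 : s6.reg rI = i := by rw [hr6 _ (by decide), hI5]
      have hsel6 : s6.mem aSel 0 = a ∧ s6.mem aSel 1 = b := by rwa [hm6 _ (by decide)]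
      refine Runs.seq
          (scanUpdate_runs hB hs6 hi ha hb he hj hI6 hsel6.1 hsel6.2 he6 hj6 hla6 hlg6) ?_
      rintro s7 hr7 hm7 ⟨ht7, hla7, hlg7⟩
      have hs7 := hs6.congr (fun r h => hr7 r (by revert r; decide))
          (fun r h => hm7 r (by revert r; decide))
      have hok7 : s7.reg rOk = s6.reg rOk := hr7 _ (by decide)
      have hj7 : s7.reg rj = j := by rw [hr7 _ (by decide), hj6]
      have ht : i * D + j < N := by
        have : (i + 2) * D ≤ (B + 1) * D := Nat.mul_le_mul_right _ (by omega)
        have e1 : (i + 2) * D = i * D + (D + D) := by ring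
        have := hB.N_eq
        omega
      have l1 := lastIdx_le (fun u => actOf m A (i * D + u) e) (j + 1)
      have l2 := lastIdx_le (fun u => Good m (actOf m A)
          (fun t x => stateColor m k rank (if u < D then a else b) t x) (i * D + u) e) (j + 1)
      refine Runs.mono (scanTest_runs hj7 ht7 hs7.D_eq hs7.T_eq hla7 hlg7 (by omega) (by omega)
        (by omega) (by omega) (by omega) (by omega) (by omega)).frame le_rfl ?_
      rintro s8 ⟨hr8, hm8, hok8, hok8'⟩
      simp only [State.set_reg]
      refine ⟨?_, ?_, by simpa using hok8, ?_⟩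
      · simpa [hr8 rLastAct (by decide)] using hla7
      · simpa [hr8 rLastGood (by decide)] using hlg7
      · simp only [Nat.reduceEqDiff, if_false]
        rw [hok8', hok7, hok6', and_assoc]
        refine and_congr_right fun _ => ?_
        have hQ : (D ≤ j + 1 → i * D + j < T →
            j + 1 < lastIdx (fun u => actOf m A (i * D + u) e) (j + 1) + D →
            j + 1 < lastIdx (fun u => Good m (actOf m A)
              (fun t x => stateColor m k rank (if u < D then a else b) t x) (i * D + u) e)
                  (j + 1) + D)
            ↔ Q e j := by
          refine imp_congr_right fun hDj => ?_
          rw [lt_lastIdx_add _ hDj, lt_lastIdx_add _ hDj]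
          refine imp_congr_right fun _ => ?_
          have hbd : ∀ u, u < j + 1 ↔ u ≤ j := fun u => by omega
          have hbd' : ∀ u, j + 1 < u + 1 + D ↔ j < u + D := fun u => by omega
          simp only [hbd, hbd']
        rw [hQ]
        constructor
        · rintro ⟨h1, h2⟩ j' hj'
          rcases Nat.lt_succ_iff_lt_or_eq.1 hj' with h | rfl
          · exact h1 j' h
          · exact h2
        · intro h
          exact ⟨fun j' hj' => h j' (by omega), h j (by omega)⟩
    · rintro s' ⟨-, -, -, h1, h2⟩
      simp only [State.set_reg]
      refine ⟨by simpa using h1, ?_⟩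
      simp only [Nat.reduceEqDiff, if_false]
      rw [h2]
      constructor
      · rintro ⟨h3, h4⟩ e' he'
        rcases Nat.lt_succ_iff_lt_or_eq.1 he' with h | rfl
        · exact h3 e' h
        · exact h4
      · intro h
        exact ⟨fun e' he' => h e' (by omega), h e (by omega)⟩
  · rintro s' ⟨-, h1, h2⟩
    exact ⟨h1, by rw [h2, hfinal]⟩

end Check

/-! ### The dynamic program over the blocks -/

section DP

variable {W m D T k B N L S : ℕ} {A rank : ℕ → ℕ}

/-- Cell `(i, a)` of the table. -/
def cellExp (iE aE : Exp) : Exp := .get aF (iE * .reg rS + aE)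

/-- Try the state `ra` of block `rI` as a predecessor of the state `rb` of block `rI + 1`. -/
def dpTry : Program :=
  .ite (cellExp (.reg rI) (.reg ra))
    (.seq checkProg (.ite (.reg rOk)
      (.store aF ((.reg rI + .lit 1) * .reg rS + .reg rb) (.reg ra + .lit 1)) .skip)) .skip

/-- Fill the cell of the state `rb` of block `rI + 1`. -/
def dpCell : Program :=
  .seq (.store aF ((.reg rI + .lit 1) * .reg rS + .reg rb) (.lit 0)) (.for ra rS dpTry)

/-- Fill the table for the number `rk` of colors. Cell `(i, a)` holds `0` if no chain of compatible
states leads to the state `a` of block `i`, and otherwise a predecessor of `a` plus one. -/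
def dpFill : Program :=
  .seq (.for ra rS (.store aF (.reg ra) (.lit 1))) (.for rI rB (.for rb rS dpCell))

/-- Record in `rFound` a reachable state of the last block plus one, if there is one. -/
def dpFind : Program :=
  .for ra rS (.ite (cellExp (.reg rB) (.reg ra)) (.assign rFound (.reg ra + .lit 1)) .skip)

/-- The row `i` of the table is correct: the nonzero cells are those of the reachable states, and
outside the first row they name a predecessor in a chain. -/
def RowOK (m D T k S : ℕ) (A rank F : ℕ → ℕ) (i : ℕ) : Prop :=
  ∀ a < S, F (i * S + a) ≤ S ∧
    (F (i * S + a) ≠ 0 ↔ Reach m D T k S (actOf m A) rank i a) ∧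
    ∀ j, i = j + 1 → F (i * S + a) ≠ 0 →
      Reach m D T k S (actOf m A) rank j (F (i * S + a) - 1) ∧
      Compat m D T k (actOf m A) rank j (F (i * S + a) - 1) a

theorem Reach.lt {act : ℕ → ℕ → Prop} {i a : ℕ} (h : Reach m D T k S act rank i a) : a < S := by
  cases i with
  | zero => exact h
  | succ i => exact h.1

/-- Writing a cell of the row `i + 1` does not affect the rows up to `i`. -/
theorem RowOK.congr {F F' : ℕ → ℕ} {i : ℕ} (h : RowOK m D T k S A rank F i)
    (hF : ∀ a < S, F' (i * S + a) = F (i * S + a)) : RowOK m D T k S A rank F' i := by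
  intro a ha
  rw [hF a ha]
  exact h a ha

/-- The time bound of `dpTry`. -/
def dpTryTime (m D : ℕ) : ℕ :=
  (cellExp (.reg rI) (.reg ra)).cost + 1 + (checkTime m D + 20)

/-- The part of the cell specification established after trying the predecessors below `a`. -/
def CellOK (m D T k S : ℕ) (A rank : ℕ → ℕ) (i b a v : ℕ) : Prop :=
  v ≤ S ∧ (v ≠ 0 ↔ ∃ a' < a, Reach m D T k S (actOf m A) rank i a' ∧
      Compat m D T k (actOf m A) rank i a' b) ∧
    (v ≠ 0 → Reach m D T k S (actOf m A) rank i (v - 1) ∧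
      Compat m D T k (actOf m A) rank i (v - 1) b)

theorem cell_bound {B S i a : ℕ} (hi : i ≤ B) (ha : a < S) : i * S + a < (B + 1) * S :=
  code_lt (Nat.lt_succ_of_le hi) ha

theorem dpTry_runs (hB : DPBounds W m D T k B N L S A rank) {i a b : ℕ} {s : State}
    (hs : DPCtx W m D T k B N L S A rank s) (hi : i < B) (ha : a < S) (hb : b < S)
    (hI : s.reg rI = i) (hra : s.reg ra = a) (hrb : s.reg rb = b)
    (hrow : RowOK m D T k S A rank (s.mem aF) i)
    (hcell : CellOK m D T k S A rank i b a (s.mem aF ((i + 1) * S + b))) :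
    Runs W dpTry s (dpTryTime m D) fun s' =>
      (∀ j, j ≠ (i + 1) * S + b → s'.mem aF j = s.mem aF j) ∧
      CellOK m D T k S A rank i b (a + 1) (s'.mem aF ((i + 1) * S + b)) := by
  have htab := hB.table
  have e1 : (B + 2) * S = (B + 1) * S + S := by ring
  have c1 := cell_bound (B := B) hi.le ha
  have c2 : (i + 1) * S + b < (B + 1) * S := cell_bound hi hb
  have hFa := hrow a ha
  have hW : 1 ≤ W := by omega
  have hcells := hB.cells
  have hiW : i + 1 ≤ W := by
    have : B * 1 ≤ B * D := Nat.mul_le_mul_left _ hB.D_pos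
    have := hB.N_eq
    rw [Nat.succ_mul] at this
    omega
  have step : ∀ v, CellOK m D T k S A rank i b a v →
      (¬ (Reach m D T k S (actOf m A) rank i a ∧ Compat m D T k (actOf m A) rank i a b)) →
      CellOK m D T k S A rank i b (a + 1) v := by
    rintro v ⟨h1, h2, h3⟩ hno
    refine ⟨h1, h2.trans ⟨?_, ?_⟩, h3⟩
    · rintro ⟨a', h4, h5⟩
      exact ⟨a', by omega, h5⟩
    · rintro ⟨a', h4, h5⟩
      rcases Nat.lt_succ_iff_lt_or_eq.1 h4 with h | rfl
      · exact ⟨a', h, h5⟩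
      · exact absurd h5 hno
  refine Runs.ite ?_ ?_ ?_
  · simp [cellExp, hI, hra, hs.S_eq]
    omega
  · intro hne
    have hne' : s.mem aF (i * S + a) ≠ 0 := by simpa [cellExp, hI, hra, hs.S_eq] using hne
    have hreach := hFa.2.1.1 hne'
    refine Runs.seq (checkProg_runs hB hs hi ha hb hI hra hrb) ?_
    rintro s1 hr1 hm1 ⟨hok, hok'⟩
    have hs1 := hs.congr (fun r h => hr1 r (by revert r; decide))
        (fun r h => hm1 r (by revert r; decide))
    have hI1 : s1.reg rI = i := by rw [hr1 _ (by decide), hI]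
    have ha1 : s1.reg ra = a := by rw [hr1 _ (by decide), hra]
    have hb1 : s1.reg rb = b := by rw [hr1 _ (by decide), hrb]
    have hF1 : s1.mem aF = s.mem aF := hm1 _ (by decide)
    refine Runs.mono (Runs.of_wp (Q := fun s' =>
      (∀ j, j ≠ (i + 1) * S + b → s'.mem aF j = s.mem aF j) ∧
      CellOK m D T k S A rank i b (a + 1) (s'.mem aF ((i + 1) * S + b))) ?_)
          (by decide) fun s' h => h
    simp only [Program.wp, fits_reg, eval_reg, fits_add, fits_mul, fits_lit, eval_add, eval_mul,
      eval_lit, State.put_mem, hI1, ha1, hb1, hs1.S_eq, hF1, if_true, Function.update_self]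
    refine ⟨by omega, fun h0 => ⟨by omega, by omega, fun j hj => ?_, ?_⟩, fun h0 =>
        ⟨fun _ _ => trivial, ?_⟩⟩
    · rw [Function.update_of_ne hj]
    · have hc := hok'.1 h0
      refine ⟨by omega, ?_, fun _ => ⟨hreach, hc⟩⟩
      simp only [ne_eq, Nat.add_eq_zero_iff, one_ne_zero, and_false, not_false_eq_true, true_iff]
      exact ⟨a, by omega, hreach, hc⟩
    · exact step _ hcell fun h => (hok'.2 h.2) h0
  · intro h0
    have h0' : s.mem aF (i * S + a) = 0 := by simpa [cellExp, hI, hra, hs.S_eq] using h0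
    refine Runs.mono (Runs.of_wp (p := .skip) (Q := fun s' =>
      (∀ j, j ≠ (i + 1) * S + b → s'.mem aF j = s.mem aF j) ∧
      CellOK m D T k S A rank i b (a + 1) (s'.mem aF ((i + 1) * S + b))) ?_)
      (by simp [Program.cost]) fun s' h => h
    exact ⟨fun _ _ => rfl, step _ hcell fun h => hFa.2.1.2 h.1 h0'⟩

/-- The time bound of `dpCell`. -/
def dpCellTime (m D S : ℕ) : ℕ := 9 + (S * (dpTryTime m D + 8) + 6)

theorem dpCell_runs (hB : DPBounds W m D T k B N L S A rank) {i b : ℕ} {s : State}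
    (hs : DPCtx W m D T k B N L S A rank s) (hi : i < B) (hb : b < S)
    (hI : s.reg rI = i) (hrb : s.reg rb = b)
    (hrow : RowOK m D T k S A rank (s.mem aF) i) :
    Runs W dpCell s (dpCellTime m D S) fun s' =>
      (∀ j, j ≠ (i + 1) * S + b → s'.mem aF j = s.mem aF j) ∧
      CellOK m D T k S A rank i b S (s'.mem aF ((i + 1) * S + b)) := by
  have htab := hB.table
  have e1 : (B + 2) * S = (B + 1) * S + S := by ring
  have c2 : (i + 1) * S + b < (B + 1) * S := cell_bound hi hb
  have hW : 1 ≤ W := by omega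
  have hcells := hB.cells
  have hiW : i + 1 ≤ W := by
    have : B * 1 ≤ B * D := Nat.mul_le_mul_left _ hB.D_pos
    have := hB.N_eq
    rw [Nat.succ_mul] at this
    omega
  have hlow : ∀ a < S, i * S + a ≠ (i + 1) * S + b := by
    intro a ha h
    rw [Nat.succ_mul] at h
    omega
  refine Runs.seq (b₁ := 9) (R := fun s' => s'.mem aF = Function.update (s.mem aF)
      ((i + 1) * S + b) 0)
    (Runs.mono (Runs.of_wp ?_) (by decide) fun s' h => h) ?_
  · simp [Program.wp, hI, hs.S_eq, hrb]
    omega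
  intro s1 hr1 hm1 hF1
  have hs1 := hs.congr (fun r h => hr1 r (by revert r; decide))
      (fun r h => hm1 r (by revert r; decide))
  have hI1 : s1.reg rI = i := by rw [hr1 _ (by decide), hI]
  have hb1 : s1.reg rb = b := by rw [hr1 _ (by decide), hrb]
  refine Runs.mono (Runs.for_const (n := S) (b := dpTryTime m D)
    (fun a s' => (∀ j, j ≠ (i + 1) * S + b → s'.mem aF j = s.mem aF j) ∧
      CellOK m D T k S A rank i b a (s'.mem aF ((i + 1) * S + b)))
    hs1.S_eq (by omega) hW (by decide) (by decide) (by decide) ?_ ?_) le_rfl fun s' h => h.2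
  · refine ⟨fun j hj => ?_, ?_⟩
    · rw [State.set_mem, hF1, Function.update_of_ne hj]
    · rw [State.set_mem, hF1, Function.update_self]
      exact ⟨by omega, by simp, by simp⟩
  · rintro a ha s2 hr2 hm2 ha2 ⟨hF2, hcell⟩
    have hs2 := hs1.congr (fun r h => hr2 r (by revert r; decide))
        (fun r h => hm2 r (by revert r; decide))
    have hI2 : s2.reg rI = i := by rw [hr2 _ (by decide), hI1]
    have hb2 : s2.reg rb = b := by rw [hr2 _ (by decide), hb1]
    refine Runs.mono (dpTry_runs hB hs2 hi ha hb hI2 ha2 hb2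
      (hrow.congr fun a' ha' => hF2 _ (hlow a' ha')) hcell) le_rfl ?_
    rintro s3 ⟨hF3, hcell3⟩
    exact ⟨fun j hj => by rw [State.set_mem, hF3 j hj, hF2 j hj], hcell3⟩

/-- The time bound of `dpFill`. -/
def dpFillTime (m D B S : ℕ) : ℕ :=
  S * (3 + 8) + 6 + (B * (S * (dpCellTime m D S + 8) + 6 + 8) + 6)

theorem dpFill_runs (hB : DPBounds W m D T k B N L S A rank) {s : State}
    (hs : DPCtx W m D T k B N L S A rank s) :
    Runs W dpFill s (dpFillTime m D B S) fun s' => ∀ i ≤ B, RowOK m D T k S A rank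
        (s'.mem aF) i := by
  have htab := hB.table
  have e1 : (B + 2) * S = B * S + S + S := by ring
  have hW : 1 ≤ W := by omega
  have hcells := hB.cells
  have hBW : B + 1 ≤ W := by
    have : B * 1 ≤ B * D := Nat.mul_le_mul_left _ hB.D_pos
    have := hB.N_eq
    rw [Nat.succ_mul] at this
    have := hB.D_pos
    omega
  refine Runs.seq (Runs.for_const (n := S) (b := 3) (fun a s => ∀ a' < a, s.mem aF a' = 1)
    hs.S_eq (by omega) hW (by decide) (by decide) (by decide) (by simp) ?_) ?_
  · intro a ha s1 hr1 hm1 ha1 hF1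
    refine Runs.of_wp ?_
    simp only [Program.wp, fits_reg, eval_reg, fits_lit, eval_lit, ha1, State.set_mem,
        State.put_mem,
      if_true]
    refine ⟨by omega, hW, fun a' ha' => ?_⟩
    rw [Function.update_apply]
    split
    · rfl
    · exact hF1 a' (by omega)
  rintro s1 hr1 hm1 ⟨-, hF1⟩
  have hs1 := hs.congr (fun r h => hr1 r (by revert r; decide))
      (fun r h => hm1 r (by revert r; decide))
  refine Runs.mono (Runs.for_const (n := B) (b := S * (dpCellTime m D S + 8) + 6)
    (fun i s' => ∀ i' ≤ i, RowOK m D T k S A rank (s'.mem aF) i')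
    hs1.B_eq (by omega) hW (by decide) (by decide) (by decide) ?_ ?_) le_rfl fun s' h => h.2
  · intro i' hi' a ha
    obtain rfl : i' = 0 := by omega
    have hS : 1 ≤ S := by omega
    simp [Reach, hF1 a ha, ha, hS]
  intro i hi s2 hr2 hm2 hi2 hrow2
  have hs2 := hs1.congr (fun r h => hr2 r (by revert r; decide))
      (fun r h => hm2 r (by revert r; decide))
  refine Runs.mono (Runs.for_const (n := S) (b := dpCellTime m D S)
    (fun b s' => (∀ i' ≤ i, RowOK m D T k S A rank (s'.mem aF) i') ∧
      ∀ b' < b, CellOK m D T k S A rank i b' S (s'.mem aF ((i + 1) * S + b')))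
    hs2.S_eq (by omega) hW (by decide) (by decide) (by decide) ?_ ?_) le_rfl ?_
  · exact ⟨hrow2, by simp⟩
  · rintro b hb s3 hr3 hm3 hb3 ⟨hrow3, hcell3⟩
    have hs3 := hs2.congr (fun r h => hr3 r (by revert r; decide))
        (fun r h => hm3 r (by revert r; decide))
    have hi3 : s3.reg rI = i := by rw [hr3 _ (by decide), hi2]
    refine Runs.mono (dpCell_runs hB hs3 hi hb hi3 hb3 (hrow3 i le_rfl)) le_rfl ?_
    rintro s4 ⟨hF4, hcell4⟩
    refine ⟨fun i' hi' => (hrow3 i' hi').congr fun a ha => ?_, fun b' hb' => ?_⟩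
    · rw [State.set_mem]
      refine hF4 _ ?_
      have := code_lt (M := S) (show i' < i + 1 by omega) ha
      omega
    · rw [State.set_mem]
      rcases Nat.lt_succ_iff_lt_or_eq.1 hb' with h | rfl
      · rw [hF4 _ (by omega)]
        exact hcell3 b' h
      · exact hcell4
  · rintro s3 ⟨-, hrow3, hcell3⟩ i' hi'
    rw [State.set_mem]
    rcases Nat.le_succ_iff.1 hi' with h | rfl
    · exact hrow3 i' h
    · intro b hb
      obtain ⟨h1, h2, h3⟩ := hcell3 b hb
      refine ⟨h1, ?_, ?_⟩
      · rw [h2, Reach]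
        simp [hb]
      · rintro j hj h0
        obtain rfl : i = j := by omega
        exact h3 h0

theorem dpFind_runs (hB : DPBounds W m D T k B N L S A rank) {s : State}
    (hs : DPCtx W m D T k B N L S A rank s) (hf : s.reg rFound = 0)
    (hrow : RowOK m D T k S A rank (s.mem aF) B) :
    Runs W dpFind s (S * (20 + 8) + 6) fun s' =>
      (s'.reg rFound = 0 → ∀ a, ¬ Reach m D T k S (actOf m A) rank B a) ∧
      (s'.reg rFound ≠ 0 → Reach m D T k S (actOf m A) rank B (s'.reg rFound - 1)) := by
  have htab := hB.table
  have e1 : (B + 2) * S = B * S + S + S := by ring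
  have hW : 1 ≤ W := by omega
  have hcells := hB.cells
  have hBW : B + 1 ≤ W := by
    have : B * 1 ≤ B * D := Nat.mul_le_mul_left _ hB.D_pos
    have := hB.N_eq
    rw [Nat.succ_mul] at this
    have := hB.D_pos
    omega
  refine Runs.mono (Runs.for_const (n := S) (b := 20)
    (fun a s' => (s'.reg rFound = 0 → ∀ a' < a, ¬ Reach m D T k S (actOf m A) rank B a') ∧
      (s'.reg rFound ≠ 0 → Reach m D T k S (actOf m A) rank B (s'.reg rFound - 1)))
    hs.S_eq (by omega) hW (by decide) (by decide) (by decide) (by simp [hf]) ?_) le_rfl ?_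
  · rintro a ha s1 hr1 hm1 ha1 ⟨h0, h1⟩
    have hs1 := hs.congr (fun r h => hr1 r (by revert r; decide))
        (fun r h => hm1 r (by revert r; decide))
    have hF1 : s1.mem aF = s.mem aF := hm1 _ (by decide)
    obtain ⟨h2, h3, -⟩ := hrow a ha
    refine Runs.mono (Runs.of_wp (Q := fun s' => _) ?_) (by decide) fun s' h => h
    simp only [Program.wp, cellExp, fits_get, eval_get, fits_reg, eval_reg, fits_add, fits_mul,
        fits_lit,
      eval_add, eval_mul, eval_lit, hs1.B_eq, hs1.S_eq, ha1, hF1, State.set_reg, if_true]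
    refine ⟨by omega, fun h4 => ⟨by omega, by simp, fun _ => ?_⟩, fun h4 =>
        ⟨fun h5 a' ha' => ?_, h1⟩⟩
    · simpa using h3.1 h4
    · rcases Nat.lt_succ_iff_lt_or_eq.1 ha' with h | rfl
      · exact h0 h5 a' h
      · exact fun h => h3.2 h h4
  · rintro s' ⟨-, h1, h2⟩
    exact ⟨fun h a ha => h1 h a ha.lt ha, h2⟩

end DP

/-! ### Searching for the number of colors -/

section Search

variable {W m D T k B N L S : ℕ} {A rank : ℕ → ℕ}

/-- Tabulate the powers of the number of colors and set `rS` to the number of block states. -/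
def powProg : Program :=
  .seq (.store aPw (.lit 0) (.lit 1)) <|
  .seq (.for rPow rL (.store aPw (.reg rPow + .lit 1) (.get aPw (.reg rPow) * .reg rk))) <|
  .assign rS (.get aPw (.reg rL))

/-- Try `rTry + 2` colors unless a smaller number of colors was sufficient. -/
def tryProg : Program :=
  .ite (.reg rFound) .skip <|
  .seq (.assign rk (.reg rTry + .lit 2)) <| .seq powProg <| .seq dpFill dpFind

/-- Find the least number of colors, starting from `2`. -/
def searchProg : Program := .for rTry rTries tryProg

/-- The registers and arrays that are fixed while the number of colors varies. -/
structure SearchCtx (m D T B L : ℕ) (A rank : ℕ → ℕ) (s : State) : Prop where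
  m_eq : s.reg rm = m
  E_eq : s.reg rE = m * m
  D_eq : s.reg rD = D
  DD_eq : s.reg rDD = D + D
  T_eq : s.reg rT = T
  B_eq : s.reg rB = B
  L_eq : s.reg rL = L
  act_eq : s.mem aAct = A
  rank_eq : s.mem aRank = rank

theorem SearchCtx.congr {s s' : State} (h : SearchCtx m D T B L A rank s)
    (hr : ∀ r ∈ [rm, rE, rD, rDD, rT, rB, rL], s'.reg r = s.reg r)
    (ha : ∀ a ∈ [aAct, aRank], s'.mem a = s.mem a) :
    SearchCtx m D T B L A rank s' := by
  obtain ⟨h1, h2, h3, h4, h5, h6, h7, h8, h9⟩ := h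
  simp only [List.mem_cons, List.not_mem_nil, or_false, forall_eq_or_imp, forall_eq] at hr ha
  constructor <;> simp_all

/-- The time bound of `powProg`. -/
def powTime (L : ℕ) : ℕ := 3 + (L * (8 + 8) + 6 + 3)

theorem powProg_runs (hB : DPBounds W m D T k B N L S A rank) {s : State}
    (hs : SearchCtx m D T B L A rank s) (hk : s.reg rk = k) :
    Runs W powProg s (powTime L) fun s' => DPCtx W m D T k B N L S A rank s' := by
  have htab := hB.table
  have e1 : (B + 2) * S = B * S + S + S := by ring
  have hW : 1 ≤ W := by omega
  have hL := hB.L_le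
  have hk2 := hB.k_ge
  have hkW := hB.k_le
  refine Runs.seq (b₁ := 3) (R := fun s' => s'.mem aPw 0 = 1)
    (Runs.mono (Runs.of_wp (by simp [Program.wp, hW])) (by decide) fun s' h => h) ?_
  intro s1 hr1 hm1 hp1
  have hs1 := hs.congr (fun r h => hr1 r (by revert r; decide))
      (fun r h => hm1 r (by revert r; decide))
  have hk1 : s1.reg rk = k := by rw [hr1 _ (by decide), hk]
  refine Runs.seq (Runs.for_const (n := L) (b := 8) (fun j s => ∀ j' ≤ j, s.mem aPw j' = k ^ j')
    hs1.L_eq hL hW (by decide) (by decide) (by decide) ?_ ?_) ?_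
  · intro j hj
    obtain rfl : j = 0 := by omega
    simp [hp1]
  · intro j hj s2 hr2 hm2 hj2 hp2
    have hk2' : s2.reg rk = k := by rw [hr2 _ (by decide), hk1]
    refine Runs.mono (Runs.of_wp (Q := fun s' => _) ?_) (by decide) fun s' h => h
    have hpow : k ^ (j + 1) ≤ S := hB.S_eq ▸ Nat.pow_le_pow_right (by omega) hj
    have hpow' : k ^ j ≤ S := hB.S_eq ▸ Nat.pow_le_pow_right (by omega) hj.le
    rw [pow_succ] at hpow
    simp only [Program.wp, fits_get, eval_get, fits_reg, eval_reg, fits_add, fits_mul, fits_lit,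
      eval_add, eval_mul, eval_lit, hj2, hk2', hp2 j le_rfl, State.put_mem, State.set_mem, if_true]
    refine ⟨by omega, by omega, fun j' hj' => ?_⟩
    rcases Nat.le_succ_iff.1 hj' with h | rfl
    · rw [Function.update_of_ne (by omega)]
      exact hp2 j' h
    · rw [Function.update_self, pow_succ]
  · rintro s2 hr2 hm2 ⟨-, hp2⟩
    have hs2 := hs1.congr (fun r h => hr2 r (by revert r; decide))
        (fun r h => hm2 r (by revert r; decide))
    have hk2' : s2.reg rk = k := by rw [hr2 _ (by decide), hk1]
    have hSW : S ≤ W := by omega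
    refine Runs.mono (Runs.of_wp (Q := fun s' => s'.reg rS = S) ?_).frame (by decide) ?_
    · simp [Program.wp, hs2.L_eq, hp2 L le_rfl, ← hB.S_eq, hL, hSW]
    · rintro s3 ⟨hr3, hm3, hS3⟩
      have hs3 := hs2.congr (fun r h => hr3 r (by revert r; decide))
          (fun r h => hm3 r (by revert r; decide))
      exact ⟨hs3.m_eq, hs3.E_eq, hs3.D_eq, hs3.DD_eq, hs3.T_eq, by rw [hr3 _ (by decide), hk2'],
        hs3.B_eq, hS3, hs3.act_eq, hs3.rank_eq, fun j hj => by rw [hm3 _ (by decide), hp2 j hj]⟩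

/-- There is a chain of compatible block states for `k` colors. -/
def Feasible (m D T B L : ℕ) (A rank : ℕ → ℕ) (k : ℕ) : Prop :=
  ∃ a, Reach m D T k (k ^ L) (actOf m A) rank B a

/-- The situation after a successful search: the table for the least feasible number `k ≥ 2` of
colors is correct, and `rFound - 1` is reachable. -/
def Found (W m D T B N L : ℕ) (A rank : ℕ → ℕ) (k : ℕ) (s : State) : Prop :=
  2 ≤ k ∧ (∀ k', 2 ≤ k' → k' < k → ¬ Feasible m D T B L A rank k') ∧
    DPCtx W m D T k B N L (k ^ L) A rank s ∧
    (∀ i ≤ B, RowOK m D T k (k ^ L) A rank (s.mem aF) i) ∧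
    Reach m D T k (k ^ L) (actOf m A) rank B (s.reg rFound - 1)

theorem Found.congr {s s' : State} (h : Found W m D T B N L A rank k s)
    (hr : ∀ r ∈ [rm, rE, rD, rDD, rT, rk, rB, rS, rFound], s'.reg r = s.reg r)
    (ha : ∀ a ∈ [aAct, aRank, aPw, aF], s'.mem a = s.mem a) : Found W m D T B N L A rank k s' := by
  obtain ⟨h1, h2, h3, h4, h5⟩ := h
  refine ⟨h1, h2, h3.congr (fun r hr' => hr r ?_) (fun a ha' => ha a ?_), ?_, ?_⟩
  · simp only [List.mem_cons, List.not_mem_nil, or_false] at hr' ⊢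
    tauto
  · simp only [List.mem_cons, List.not_mem_nil, or_false] at ha' ⊢
    tauto
  · rwa [ha aF (by simp)]
  · rwa [hr rFound (by simp)]

/-- The time bound of `tryProg`, for any number of colors up to `m + 2`. -/
def tryTime (m D B L : ℕ) : ℕ :=
  2 + (4 + (powTime L + (dpFillTime m D B ((m + 2) ^ L) + ((m + 2) ^ L * 28 + 6))))

theorem dpFillTime_mono {S S' : ℕ} (h : S ≤ S') : dpFillTime m D B S ≤ dpFillTime m D B S' := by
  unfold dpFillTime dpCellTime
  gcongr

/-- The search succeeds if some number of colors from `2` to `m + 2` is feasible. -/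
theorem searchProg_runs
    (hB : ∀ k, 2 ≤ k → k ≤ m + 2 → DPBounds W m D T k B N L (k ^ L) A rank) {s : State}
    (hs : SearchCtx m D T B L A rank s) (htries : s.reg rTries = m + 1) (hfound : s.reg rFound = 0)
    {k₀ : ℕ} (hk₀ : 2 ≤ k₀) (hk₀m : k₀ ≤ m + 2) (hfeas : Feasible m D T B L A rank k₀) :
    Runs W searchProg s ((m + 1) * (tryTime m D B L + 8) + 6) fun s' =>
      ∃ k, k ≤ m + 2 ∧ Found W m D T B N L A rank k s' := by
  have hcells := (hB 2 le_rfl (by omega)).cells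
  refine Runs.mono (Runs.for_const (n := m + 1) (b := tryTime m D B L)
    (fun i s => (s.reg rFound = 0 → ∀ k, 2 ≤ k → k < i + 2 → ¬ Feasible m D T B L A rank k) ∧
      (s.reg rFound ≠ 0 → ∃ k < i + 2, Found W m D T B N L A rank k s))
    htries (by omega) (by omega) (by decide) (by decide) (by decide) ?_ ?_) le_rfl ?_
  · simp only [State.set_reg]
    refine ⟨fun _ k h1 h2 => by omega, fun h => ?_⟩
    simp [hfound] at h
  · rintro i hi s1 hr1 hm1 hi1 ⟨h0, h1⟩
    have hs1 := hs.congr (fun r h => hr1 r (by revert r; decide))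
        (fun r h => hm1 r (by revert r; decide))
    have hB' := hB (i + 2) (by omega) (by omega)
    have hkW := hB'.k_le
    have hset : ∀ s' : State, ∀ k, Found W m D T B N L A rank k s' →
        Found W m D T B N L A rank k (s'.set rTry (i + 1)) := by
      intro s' k h
      refine h.congr (fun r hr => ?_) fun a _ => rfl
      simp only [State.set_reg]
      rw [if_neg]
      revert r
      decide
    refine Runs.ite (b := 4 + (powTime L + (dpFillTime m D B ((m + 2) ^ L) +
        ((m + 2) ^ L * 28 + 6))))
      ?_ ?_ ?_
    · simp only [fits_reg]
      by_cases hf : s1.reg rFound = 0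
      · omega
      · obtain ⟨k, hk, hF⟩ := h1 hf
        have h2 := hF.2.2.2.2.lt
        have h3 := (hB k hF.1 (by omega)).table
        have h4 : 1 * k ^ L ≤ (B + 2) * k ^ L := Nat.mul_le_mul_right _ (by omega)
        omega
    · intro hf
      refine Runs.mono (Runs.of_wp (p := .skip) (Q := fun s' => _) ?_)
          (by simp [Program.cost]; omega)
        fun s' h => h
      simp only [Program.wp]
      refine ⟨fun h => absurd (by simpa using h) hf, fun _ => ?_⟩
      obtain ⟨k, hk, hF⟩ := h1 hf
      exact ⟨k, by omega, hset _ _ hF⟩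
    · intro hf
      rw [eval_reg] at hf
      have hpow : (i + 2) ^ L ≤ (m + 2) ^ L := Nat.pow_le_pow_left (by omega) _
      refine Runs.seq (b₁ := 4) (R := fun s' => s'.reg rk = i + 2)
        (Runs.mono (Runs.of_wp ?_) (by decide) fun s' h => h) ?_
      · simp [Program.wp, hi1]
        omega
      intro s2 hr2 hm2 hk2
      have hs2 := hs1.congr (fun r h => hr2 r (by revert r; decide))
          (fun r h => hm2 r (by revert r; decide))
      refine Runs.seq (powProg_runs hB' hs2 hk2) ?_
      intro s3 hr3 hm3 hs3
      refine Runs.seq ((dpFill_runs hB' hs3).mono (dpFillTime_mono hpow) fun s' h => h) ?_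
      intro s4 hr4 hm4 hrow4
      have hs4 := hs3.congr (fun r h => hr4 r (by revert r; decide))
          (fun r h => hm4 r (by revert r; decide))
      have hf4 : s4.reg rFound = 0 := by
        rw [hr4 _ (by decide), hr3 _ (by decide), hr2 _ (by decide), hf]
      refine Runs.mono (dpFind_runs hB' hs4 hf4 (hrow4 B le_rfl)).frame
        (by have := Nat.mul_le_mul_right 28 hpow; omega) ?_
      rintro s5 ⟨hr5, hm5, h5, h5'⟩
      have hs5 := hs4.congr (fun r h => hr5 r (by revert r; decide))
          (fun r h => hm5 r (by revert r; decide))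
      simp only [State.set_reg, Nat.reduceEqDiff, if_false]
      refine ⟨fun hz k hk1 hk2 => ?_, fun hz => ⟨i + 2, by omega, hset _ _ ?_⟩⟩
      · rcases Nat.lt_succ_iff_lt_or_eq.1 (show k < (i + 2) + 1 by omega) with h | rfl
        · exact h0 hf k hk1 h
        · rintro ⟨a, ha⟩
          exact h5 hz a ha
      · refine ⟨by omega, fun k' hk' hk'' => h0 hf k' hk' hk'', hs5, ?_, h5' hz⟩
        rwa [hm5 _ (by decide)]
  · rintro s' ⟨-, h0, h1⟩
    by_cases hf : s'.reg rFound = 0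
    · exact absurd hfeas (h0 hf k₀ hk₀ (by omega))
    · obtain ⟨k, hk, hF⟩ := h1 hf
      exact ⟨k, by omega, hF⟩

/-! ### Reading off the block states -/

/-- Follow the predecessors from the last block to the first. -/
def backProg : Program :=
  .seq (.assign rCur (.reg rFound - .lit 1)) <|
  .for rBack rBlocks <|
    .seq (.assign rI (.reg rB - .reg rBack)) <|
    .seq (.store aSt (.reg rI) (.reg rCur)) <|
    .assign rCur (cellExp (.reg rI) (.reg rCur) - .lit 1)

/-- The recorded states form a chain. In the invariant, `z` blocks have been treated, and `rCur` is
a reachable state of the block `B - z` that is compatible with the recorded state of the next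
block. -/
theorem backProg_runs (hB : DPBounds W m D T k B N L (k ^ L) A rank) {s : State}
    (hs : Found W m D T B N L A rank k s) (hb : s.reg rBlocks = B + 1) :
    Runs W backProg s (4 + ((B + 1) * (20 + 8) + 6)) fun s' =>
      (∀ i ≤ B, s'.mem aSt i < k ^ L) ∧
      ∀ i < B, Compat m D T k (actOf m A) rank i (s'.mem aSt i) (s'.mem aSt (i + 1)) := by
  obtain ⟨hk, -, hs, hrow, hreach⟩ := hs
  set S := k ^ L with hS
  have htab := hB.table
  have e1 : (B + 2) * S = B * S + S + S := by ring
  have hW : 1 ≤ W := by omega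
  have hcells := hB.cells
  have hBW : B + 1 ≤ W := by
    have : B * 1 ≤ B * D := Nat.mul_le_mul_left _ hB.D_pos
    have := hB.N_eq
    rw [Nat.succ_mul] at this
    have := hB.D_pos
    omega
  have hlt := hreach.lt
  refine Runs.seq (b₁ := 4) (R := fun s' => s'.reg rCur = s.reg rFound - 1)
    (Runs.mono (Runs.of_wp ?_) (by decide) fun s' h => h) ?_
  · simp [Program.wp, hW]
    omega
  intro s1 hr1 hm1 hc1
  have hs1 := hs.congr (fun r h => hr1 r (by revert r; decide))
      (fun r h => hm1 r (by revert r; decide))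
  have hb1 : s1.reg rBlocks = B + 1 := by rw [hr1 _ (by decide), hb]
  have hF1 : s1.mem aF = s.mem aF := hm1 _ (by decide)
  refine Runs.mono (Runs.for_const (n := B + 1) (b := 20)
    (fun z s => s.reg rCur < S ∧
      (z ≤ B → Reach m D T k S (actOf m A) rank (B - z) (s.reg rCur)) ∧
      (∀ i ≤ B, B < i + z → s.mem aSt i < S) ∧
      (∀ i < B, B < i + z → Compat m D T k (actOf m A) rank i (s.mem aSt i) (s.mem aSt (i + 1))) ∧
      (0 < z → z ≤ B →
        Compat m D T k (actOf m A) rank (B - z) (s.reg rCur) (s.mem aSt (B - z + 1))))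
    hb1 hBW hW (by decide) (by decide) (by decide) ?_ ?_) le_rfl ?_
  · simp only [State.set_reg, Nat.reduceEqDiff, if_false, hc1]
    exact ⟨hlt, fun _ => hreach, fun i hi hi' => by omega, fun i hi hi' => by omega,
      fun h => by omega⟩
  · rintro z hz s2 hr2 hm2 hz2 ⟨g1, g2, g3, g4, g5⟩
    have hs2 := hs1.congr (fun r h => hr2 r (by revert r; decide))
        (fun r h => hm2 r (by revert r; decide))
    have hF2 : s2.mem aF = s.mem aF := by rw [hm2 _ (by decide), hF1]
    have g2' := g2 (by omega)
    obtain ⟨r1, r2, r3⟩ := hrow (B - z) (by omega) _ g1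
    have c1 := cell_bound (B := B) (show B - z ≤ B by omega) g1
    have e2 : (B + 1) * S = B * S + S := by ring
    refine Runs.mono (Runs.of_wp (Q := fun s' => _) ?_) (by decide) fun s' h => h
    simp only [Program.wp, cellExp, fits_get, eval_get, fits_reg, eval_reg, fits_add, fits_mul,
      fits_sub, eval_sub, fits_lit, eval_add, eval_mul, eval_lit, hs2.B_eq, hs2.S_eq, hz2, hF2,
      State.set_reg, State.set_mem, State.put_mem, State.put_reg, Nat.reduceEqDiff, if_true,
          if_false]
    refine ⟨by omega, by omega, by omega, by omega, by omega, ?_, ?_, ?_, ?_⟩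
    · intro hz'
      have h := (r3 (B - (z + 1)) (by omega) (r2.2 g2')).1
      exact h
    · intro i hi hi'
      rw [Function.update_apply]
      split
      · exact g1
      · exact g3 i hi (by omega)
    · intro i hi hi'
      by_cases hiz : i = B - z
      · subst hiz
        rw [Function.update_self, Function.update_of_ne (by omega)]
        exact g5 (by omega) (by omega)
      · rw [Function.update_of_ne hiz, Function.update_of_ne (by omega)]
        exact g4 i hi (by omega)
    · intro _ hz'
      rw [show B - (z + 1) + 1 = B - z by omega, Function.update_self]
      exact (r3 (B - (z + 1)) (by omega) (r2.2 g2')).2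
  · rintro s' ⟨-, -, -, h1, h2, -⟩
    exact ⟨fun i hi => h1 i hi (by omega), fun i hi => h2 i hi (by omega)⟩

end Search

/-! ### Assigning slots to the times -/

section Slots

variable {W m D B N M : ℕ} {A rank : ℕ → ℕ} {σ : ℕ → ℕ} {bs : ℕ}

/-- Index of the counter of the pair `re` in the block `rt / rD` of the current pass. -/
def cntIdx : Exp := .reg rt / .reg rD * .reg rE + .reg re

/-- Treat the pair `re` at the time `rTime`: claim a slot if fewer than `rM` active times of the
pair have been seen in the block, and count the time. -/
def slotStep (cnt : ℕ) (base : Exp) : Program :=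
  .ite (.get aAct (.reg rTime * .reg rE + .reg re))
    (.seq (.ite (.op .lt (.get cnt cntIdx) (.reg rM))
        (.store aRank (.reg rTime) (base + .reg re * .reg rM + .get cnt cntIdx + .lit 1)) .skip)
      (.store cnt cntIdx (.get cnt cntIdx + .lit 1))) .skip

/-- One pass over all times, in the order given by `timeE`. -/
def slotPass (timeE : Exp) (cnt : ℕ) (base : Exp) : Program :=
  .for rt rN (.seq (.assign rTime timeE) (.for re rE (slotStep cnt base)))

/-- A forward and a backward pass. -/
def slotProg : Program :=
  .seq (slotPass (.reg rt) aBefore (.lit 0))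
    (slotPass (.reg rN - .lit 1 - .reg rt) aAfter (.reg rE * .reg rM))

open Classical in
/-- The number of active times of the pair `e` in the block `q` among the first `j` times of the
pass that visits the times in the order `σ 0, σ 1, …`. -/
noncomputable def seen (D : ℕ) (act : ℕ → ℕ → Prop) (σ : ℕ → ℕ) (q j e : ℕ) : ℕ :=
  ((Finset.range j).filter fun j' => j' / D = q ∧ act (σ j') e).card

open Classical in
theorem seen_succ (act : ℕ → ℕ → Prop) (q j e : ℕ) :
    seen D act σ q (j + 1) e = seen D act σ q j e + if j / D = q ∧ act (σ j) e then 1 else 0 := by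
  rw [seen, seen, Finset.range_add_one, Finset.filter_insert]
  split
  · rw [Finset.card_insert_of_notMem (by simp)]
  · simp

theorem seen_le (act : ℕ → ℕ → Prop) (q j e : ℕ) : seen D act σ q j e ≤ j := by
  classical
  exact (Finset.card_filter_le _ _).trans (by simp)

/-- The effect of a pass on the slot `r` of the time `σ j`, when the pairs below `e` have been
treated and the slot was `r₀` before. -/
def SlotAfter (D M bs : ℕ) (act : ℕ → ℕ → Prop) (σ : ℕ → ℕ) (r₀ j e r : ℕ) : Prop :=
  (r = r₀ ∧ ∀ e' < e, act (σ j) e' → M ≤ seen D act σ (j / D) j e') ∨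
    ∃ e' < e, act (σ j) e' ∧ seen D act σ (j / D) j e' < M ∧
      r = bs + e' * M + seen D act σ (j / D) j e' + 1

/-- The registers and arrays that are fixed during the passes. -/
structure SlotCtx (m D N M : ℕ) (A : ℕ → ℕ) (s : State) : Prop where
  E_eq : s.reg rE = m * m
  D_eq : s.reg rD = D
  N_eq : s.reg rN = N
  M_eq : s.reg rM = M
  act_eq : s.mem aAct = A

theorem SlotCtx.congr {s s' : State} (h : SlotCtx m D N M A s)
    (hr : ∀ r ∈ [rE, rD, rN, rM], s'.reg r = s.reg r)
    (ha : ∀ a ∈ [aAct], s'.mem a = s.mem a) :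
    SlotCtx m D N M A s' := by
  obtain ⟨h1, h2, h3, h4, h5⟩ := h
  simp only [List.mem_cons, List.not_mem_nil, or_false, forall_eq_or_imp, forall_eq] at hr ha
  constructor <;> simp_all

open Classical in
theorem slotStep_runs {cnt : ℕ} {base : Exp} (hDN : D ≤ N) (hA : ∀ i, A i ≤ 1)
    (hcnt : cnt ≠ aRank)
    (hbase : ∀ s : State, SlotCtx m D N M A s → base.eval s = bs ∧ base.Fits W s)
    (hW1 : (N + 1) * (m * m) + N + 1 ≤ W) (hW2 : bs + m * m * M + M + 1 ≤ W)
    {s : State} {j t e : ℕ} (hs : SlotCtx m D N M A s) (hj : j < N) (ht : t < N) (he : e < m * m)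
    (hsj : s.reg rt = j) (hst : s.reg rTime = t) (hse : s.reg re = e)
    (hc : s.mem cnt (j / D * (m * m) + e) ≤ N) :
    Runs W (slotStep cnt base) s (slotStep cnt base).cost fun s' =>
      s'.mem aRank = (if actOf m A t e ∧ s.mem cnt (j / D * (m * m) + e) < M then
        Function.update (s.mem aRank) t
          (bs + e * M + s.mem cnt (j / D * (m * m) + e) + 1) else s.mem aRank) ∧
      s'.mem cnt = (if actOf m A t e then Function.update (s.mem cnt) (j / D * (m * m) + e)
        (s.mem cnt (j / D * (m * m) + e) + 1) else s.mem cnt) := by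
  obtain ⟨hb1, hb2⟩ := hbase s hs
  have hW : 1 ≤ W := by omega
  have e1 : (N + 1) * (m * m) = N * (m * m) + m * m := by ring
  have c1 := code_lt (M := m * m) ht he
  have c0 : t * (m * m) ≤ W := by omega
  have c1' : t * (m * m) + e ≤ W := by omega
  have hq : j / D < N := (Nat.div_le_self _ _).trans_lt hj
  have c2 := code_lt (M := m * m) hq he
  have c3 : j / D * (m * m) ≤ W := by omega
  have c2' : j / D * (m * m) + e ≤ W := by omega
  have w1 : m * m ≤ W := by omega
  have w2 : e ≤ W := by omega
  have w3 : t ≤ W := by omega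
  have w4 : j ≤ W := by omega
  have w5 : D ≤ W := by omega
  have w6 : M ≤ W := by omega
  have hAW := (hA (t * (m * m) + e)).trans hW
  have hcnt' : aRank ≠ cnt := hcnt.symm
  apply Runs.of_wp
  set v := s.mem cnt (j / D * (m * m) + e) with hv
  have w7 : v + 1 ≤ W := by omega
  have w8 : v ≤ W := by omega
  by_cases h1 : A (t * (m * m) + e) = 0
  · have h1' : ¬ actOf m A t e := fun h => h.2 h1
    simp [slotStep, Program.wp, hs.E_eq, hs.act_eq, hst, hse, h1, h1', w1, w2, w3, c0, c1']
  · have h1' : actOf m A t e := ⟨he, h1⟩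
    by_cases h2 : v < M
    · have c4 := code_lt (M := M) he h2
      have w9 : e * M ≤ W := by omega
      have w10 : bs + e * M ≤ W := by omega
      have w11 : bs + e * M + v ≤ W := by omega
      have w12 : bs + e * M + v + 1 ≤ W := by omega
      simp [slotStep, cntIdx, Program.wp, hs.E_eq, hs.act_eq, hs.D_eq, hs.M_eq, hsj, hst, hse, h1,
          h1',
        h2, w1, w2, w3, c0, c1', c2', c3, hb1, hb2, hcnt, hcnt', ← hv, w4, w5, w6, w7, w8, w9, w10,
            w11,
        w12, hW, hAW]
    · simp [slotStep, cntIdx, Program.wp, hs.E_eq, hs.act_eq, hs.D_eq, hs.M_eq, hsj, hst, hse, h1,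
        h1',
        h2, w1, w2, w3, c0, c1', c2', c3, hcnt', ← hv, w4, w5, w6, w7, w8,
        hW, hAW]

/-- The time bound of `slotPass`, where `tcost` and `scost` are the costs of the order and of a
step. -/
def slotPassTime (m N tcost scost : ℕ) : ℕ := N * (tcost + 1 + (m * m * (scost + 8) + 6) + 8) + 6

theorem slotPass_runs {timeE base : Exp} {cnt : ℕ} (hDN : D ≤ N) (hA : ∀ i, A i ≤ 1)
    (hcnt : cnt ≠ aAct ∧ cnt ≠ aRank)
    (hbase : ∀ s : State, SlotCtx m D N M A s → base.eval s = bs ∧ base.Fits W s)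
    (htime : ∀ s : State, SlotCtx m D N M A s → ∀ j < N, s.reg rt = j →
      timeE.eval s = σ j ∧ timeE.Fits W s)
    (hσ : ∀ j < N, σ j < N) (hinj : ∀ i < N, ∀ j < N, σ i = σ j → i = j)
    (hW1 : (N + 1) * (m * m) + N + 1 ≤ W) (hW2 : bs + m * m * M + M + 1 ≤ W)
    {s : State} (hs : SlotCtx m D N M A s) (hc : ∀ i, s.mem cnt i = 0) :
    Runs W (slotPass timeE cnt base) s (slotPassTime m N timeE.cost (slotStep cnt base).cost)
      fun s' => ∀ j < N,
        SlotAfter D M bs (actOf m A) σ (s.mem aRank (σ j)) j (m * m) (s'.mem aRank (σ j)) := by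
  classical
  obtain ⟨hcnt1, hcnt2⟩ := hcnt
  have hmem : ∀ {s s' : State}, (∀ a, a ∉ (slotStep cnt base).wmems → s'.mem a = s.mem a) →
      s'.mem aAct = s.mem aAct := by
    intro s s' h
    refine h _ ?_
    simp [slotStep, Program.wmems, Ne.symm hcnt1]
  have hblock : ∀ {q q' e e' : ℕ}, e < m * m → e' < m * m →
      q * (m * m) + e = q' * (m * m) + e' → q = q' ∧ e = e' := fun h h' h'' => code_inj h h' h''
  refine Runs.mono (Runs.for_const (n := N) (b := timeE.cost + 1 +
      (m * m * ((slotStep cnt base).cost + 8) + 6))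
    (fun j s' => (∀ q, ∀ e < m * m, s'.mem cnt (q * (m * m) + e) = seen D (actOf m A) σ q j e) ∧
      (∀ j' < N, j ≤ j' → s'.mem aRank (σ j') = s.mem aRank (σ j')) ∧
      ∀ j' < j, SlotAfter D M bs (actOf m A) σ (s.mem aRank (σ j')) j' (m * m)
          (s'.mem aRank (σ j')))
    hs.N_eq (by omega) (by omega) (by decide) ?_ ?_ ?_ ?_) le_rfl fun s' h => h.2.2.2
  · simp [Program.wregs, Program.for, slotStep]
  · simp [Program.wregs, Program.for, slotStep]
  · simp [hc, seen]
  rintro j hj s1 hr1 hm1 hj1 ⟨hc1, hrest1, hdone1⟩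
  have hact1 : s1.mem aAct = s.mem aAct :=
    hm1 _ (by simp [slotStep, Program.for, Program.wmems, Ne.symm hcnt1])
  have hs1 : SlotCtx m D N M A s1 := hs.congr
    (fun r hr => hr1 r (by
      simp only [List.mem_cons, List.not_mem_nil, or_false] at hr
      simp only [Program.wregs, Program.for, slotStep]
      rcases hr with rfl | rfl | rfl | rfl <;> simp)) (by simpa using hact1)
  obtain ⟨ht1, ht2⟩ := htime s1 hs1 j hj hj1
  refine Runs.seq (R := fun s' => s'.reg rTime = σ j)
    (Runs.of_wp (by simp [Program.wp, ht1, ht2])) ?_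
  intro s2 hr2 hm2 ht2
  have hs2 := hs1.congr (fun r h => hr2 r (by revert r; simp [Program.wregs]))
    (fun r h => hm2 r (by simp [Program.wmems]))
  have hmem2 : ∀ a, s2.mem a = s1.mem a := fun a => hm2 a (by simp [Program.wmems])
  refine Runs.mono (Runs.for_const (n := m * m) (b := (slotStep cnt base).cost)
    (fun e s' => (∀ q, ∀ e' < m * m, s'.mem cnt (q * (m * m) + e') =
        if e' < e then seen D (actOf m A) σ q (j + 1) e' else seen D (actOf m A) σ q j e') ∧
      (∀ j' < N, j' ≠ j → s'.mem aRank (σ j') = s1.mem aRank (σ j')) ∧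
      SlotAfter D M bs (actOf m A) σ (s.mem aRank (σ j)) j e (s'.mem aRank (σ j)))
    hs2.E_eq (by have e1 : (N + 1) * (m * m) = N * (m * m) + m * m := by ring
                 omega) (by omega) (by decide) ?_ ?_ ?_ ?_) le_rfl ?_
  · simp [Program.wregs, slotStep]
  · simp [Program.wregs, slotStep]
  · simp only [State.set_mem, hmem2]
    exact ⟨by simpa using hc1, fun _ _ _ => trivial, Or.inl ⟨hrest1 j hj le_rfl, by simp⟩⟩
  · rintro e he s3 hr3 hm3 he3 ⟨hc3, hoth3, hslot3⟩
    have hs3 : SlotCtx m D N M A s3 := hs2.congr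
      (fun r hr => hr3 r (by
        simp only [List.mem_cons, List.not_mem_nil, or_false] at hr
        simp only [Program.wregs, slotStep]
        rcases hr with rfl | rfl | rfl | rfl <;> simp)) (by simpa using hmem hm3)
    have hj3 : s3.reg rt = j := by
      rw [hr3 _ (by simp [Program.wregs, slotStep]), hr2 _ (by simp [Program.wregs]), hj1]
    have ht3 : s3.reg rTime = σ j := by
      rw [hr3 _ (by simp [Program.wregs, slotStep]), ht2]
    have hce := hc3 (j / D) e he
    rw [if_neg (lt_irrefl e)] at hce
    refine Runs.mono (slotStep_runs hDN hA hcnt2 hbase hW1 hW2 hs3 hj (hσ j hj) he hj3 ht3 he3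
      (by rw [hce]; exact (seen_le _ _ _ _).trans hj.le)) le_rfl ?_
    rintro s4 ⟨hrank4, hc4⟩
    rw [hce] at hrank4 hc4
    refine ⟨fun q e' he' => ?_, fun j' hj' hne => ?_, ?_⟩
    · rw [State.set_mem, hc4]
      by_cases hqe : q * (m * m) + e' = j / D * (m * m) + e
      · obtain ⟨rfl, rfl⟩ := hblock he' he hqe
        rw [if_pos (Nat.lt_succ_self _), seen_succ]
        split
        · rename_i h
          simp [h]
        · rename_i h
          rw [hce]
          simp [h]
      · have : (if actOf m A (σ j) e then Function.update (s3.mem cnt) (j / D * (m * m) + e)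
            (seen D (actOf m A) σ (j / D) j e + 1) else s3.mem cnt) (q * (m * m) + e') =
            s3.mem cnt (q * (m * m) + e') := by
          split
          · rw [Function.update_of_ne hqe]
          · rfl
        rw [this, hc3 q e' he']
        by_cases h1 : e' = e
        · subst h1
          rw [if_neg (lt_irrefl _), if_pos (Nat.lt_succ_self _), seen_succ, if_neg, Nat.add_zero]
          rintro ⟨rfl, -⟩
          exact hqe rfl
        · by_cases h2 : e' < e
          · rw [if_pos h2, if_pos (by omega)]
          · rw [if_neg h2, if_neg (by omega)]
    · rw [State.set_mem, hrank4, ← hoth3 j' hj' hne]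
      split
      · rw [Function.update_of_ne]
        exact fun h => hne (hinj j' hj' j hj h)
      · rfl
    · rw [State.set_mem, hrank4]
      split
      · rename_i h
        exact Or.inr ⟨e, Nat.lt_succ_self _, h.1, h.2, by rw [Function.update_self]⟩
      · rename_i h
        rcases hslot3 with ⟨h1, h2⟩ | ⟨e', h1, h2, h3, h4⟩
        · refine Or.inl ⟨h1, fun e' he' ha => ?_⟩
          rcases Nat.lt_succ_iff_lt_or_eq.1 he' with h5 | rfl
          · exact h2 e' h5 ha
          · exact not_lt.1 fun h6 => h ⟨ha, h6⟩
        · exact Or.inr ⟨e', by omega, h2, h3, h4⟩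
  · rintro s3 ⟨-, hc3, hoth3, hslot3⟩
    simp only [State.set_mem]
    refine ⟨fun q e he => ?_, fun j' hj' hjj => ?_, fun j' hj' => ?_⟩
    · rw [hc3 q e he, if_pos he]
    · rw [hoth3 j' hj' (by omega), hrest1 j' hj' (by omega)]
    · rcases Nat.lt_succ_iff_lt_or_eq.1 hj' with h | rfl
      · rw [hoth3 j' (by omega) (by omega)]
        exact hdone1 j' h
      · exact hslot3

/-- Reversing the times below `N`, a multiple of `D`, reverses the blocks. -/
theorem rev_div (hN : N = (B + 1) * D) {j : ℕ} (hj : j < N) : (N - 1 - j) / D = B - j / D := by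
  have hD : 0 < D := Nat.pos_of_ne_zero (by rintro rfl; simp at hN; omega)
  have e1 := Nat.div_add_mod j D
  have l1 := Nat.mod_lt j hD
  have hq : j / D < B + 1 := Nat.div_lt_of_lt_mul (by rw [Nat.mul_comm, ← hN]; exact hj)
  obtain ⟨r, hr⟩ : ∃ r, B = j / D + r := ⟨B - j / D, by omega⟩
  have e2 : N = D * (j / D) + (r * D + D) := by rw [hN]; nth_rw 1 [hr]; ring
  have e3 : (r + 1) * D = r * D + D := by ring
  rw [show B - j / D = r by omega]
  exact Nat.div_eq_of_lt_le (by omega) (by omega)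

/-! In the forward pass the counters hold the numbers of active times before, in the backward pass
those after, the current time in its block. -/

theorem seen_id (act : ℕ → ℕ → Prop) (t e : ℕ) :
    seen D act (fun j => j) (t / D) t e = before D act t e := rfl

theorem seen_rev (act : ℕ → ℕ → Prop) (hN : N = (B + 1) * D) {t : ℕ} (ht : t < N) (e : ℕ) :
    seen D act (fun j => N - 1 - j) ((N - 1 - t) / D) (N - 1 - t) e = after D N act t e := by
  classical
  have hblk : ∀ u < N, (u / D = t / D ↔ (N - 1 - u) / D = (N - 1 - t) / D) := by
    intro u hu
    have hq : ∀ j < N, j / D < B + 1 := fun j hj =>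
      Nat.div_lt_of_lt_mul (by rw [Nat.mul_comm, ← hN]; exact hj)
    rw [rev_div hN hu, rev_div hN ht]
    have := hq u hu
    have := hq t ht
    omega
  unfold seen after
  refine Finset.card_bij' (fun j _ => N - 1 - j) (fun u _ => N - 1 - u) ?_ ?_ ?_ ?_
  · intro j hj
    simp only [Finset.mem_filter, Finset.mem_range, Finset.mem_Ioo] at hj ⊢
    refine ⟨by omega, ?_, hj.2.2⟩
    rw [hblk _ (by omega), show N - 1 - (N - 1 - j) = j by omega]
    exact hj.2.1
  · intro u hu
    simp only [Finset.mem_filter, Finset.mem_range, Finset.mem_Ioo] at hu ⊢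
    rw [show N - 1 - (N - 1 - u) = u by omega]
    exact ⟨by omega, (hblk u hu.1.2).1 hu.2.1, hu.2.2⟩
  · intro j hj
    simp only [Finset.mem_filter, Finset.mem_range] at hj
    omega
  · intro u hu
    simp only [Finset.mem_filter, Finset.mem_Ioo] at hu
    omega

/-- The time bound of `slotProg`, with common bounds for the costs in the two passes. -/
def slotTime (m N : ℕ) : ℕ := 2 * slotPassTime m N 5 100

theorem slotProg_runs (hN : N = (B + 1) * D) (hA : ∀ i, A i ≤ 1)
    (hW1 : (N + 1) * (m * m) + N + 1 ≤ W)
    (hW2 : m * m * M + m * m * M + M + 1 ≤ W) {s : State} (hs : SlotCtx m D N M A s)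
    (hz : ∀ a ∈ [aRank, aBefore, aAfter], ∀ i, s.mem a i = 0) :
    Runs W slotProg s (slotTime m N) fun s' =>
      IsSlotting m D N M (actOf m A) (s'.mem aRank) := by
  have hDN : D ≤ N := by rw [hN]; exact Nat.le_mul_of_pos_left _ (by omega)
  have hbd : ∀ {x y : ℕ}, x ≤ 5 → y ≤ 100 → slotPassTime m N x y ≤ slotPassTime m N 5 100 := by
    intro x y hx hy
    unfold slotPassTime
    gcongr
  refine Runs.mono (b := slotPassTime m N 5 100 + slotPassTime m N 5 100) ?_
    (by rw [slotTime]; omega) fun s' h => h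
  have e1 : (N + 1) * (m * m) = N * (m * m) + m * m := by ring
  refine Runs.seq ((slotPass_runs (bs := 0) (σ := fun j => j) hDN hA (by decide)
    (fun s _ => ⟨rfl, Nat.zero_le _⟩)
    (fun s _ j hj h => ⟨by simp [h], by simp only [fits_reg, h]; omega⟩) (fun j hj => hj)
    (fun i _ j _ h => h) hW1 (by omega) hs (hz _ (by simp))).mono (hbd (by decide) (by decide))
      fun s' h => h) ?_
  intro s1 hr1 hm1 h1
  have hs1 := hs.congr (fun r h => hr1 r (by revert r; decide))
      (fun r h => hm1 r (by revert r; decide))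
  refine Runs.mono (slotPass_runs (bs := m * m * M) (σ := fun j => N - 1 - j) hDN hA (by decide)
    (fun s hs => ⟨by simp [hs.E_eq, hs.M_eq], ?_⟩) (fun s hs j hj h => ⟨?_, ?_⟩)
    (fun j hj => by omega) (fun i _ j _ h => by omega) hW1 hW2 hs1 ?_)
    (hbd (by decide) (by decide)) ?_
  · simp only [fits_mul, fits_reg, eval_reg, hs.E_eq, hs.M_eq]
    omega
  · simp [hs.N_eq, h]
  · simp only [fits_sub, fits_reg, fits_lit, hs.N_eq, h]
    omega
  · rw [hm1 _ (by decide)]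
    exact hz _ (by simp)
  · intro s2 h2 t ht
    have h1t := h1 t ht
    have h2t := h2 (N - 1 - t) (by omega)
    unfold SlotAfter at h1t h2t
    dsimp only at h1t h2t
    simp only [seen_rev _ hN ht, seen_id, show N - 1 - (N - 1 - t) = t by omega] at h1t h2t
    rw [hz aRank (by simp)] at h1t
    rcases h2t with ⟨h3, h4⟩ | ⟨e, h3, h4, h5, h6⟩
    · rcases h1t with ⟨h7, h8⟩ | ⟨e, h7, h8, h9, h10⟩
      · exact Or.inl ⟨h3.trans h7, fun e he ha => ⟨h8 e he ha, h4 e he ha⟩⟩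
      · exact Or.inr (Or.inl ⟨e, h7, h8, h9, by rw [h3, h10, zero_add]⟩)
    · exact Or.inr (Or.inr ⟨e, h3, h4, h5, h6⟩)

end Slots

/-! ### Reading the input -/

section Input

variable {n W T m : ℕ} {es : List (Fin n × Fin n × List ℕ)} {inp : ℕ → ℕ}

/-- The code of an edge with its labels. -/
def encEdge (r : Fin n × Fin n × List ℕ) : List ℕ := [r.1.val, r.2.1.val, r.2.2.length] ++ r.2.2

/-- The position of the code of the `i`-th edge behind the four leading numbers. -/
def edgePos (es : List (Fin n × Fin n × List ℕ)) (i : ℕ) : ℕ := ((es.take i).flatMap encEdge).length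

/-- The array `inp` contains the codes of the edges `es`. -/
def InputOK (es : List (Fin n × Fin n × List ℕ)) (inp : ℕ → ℕ) : Prop :=
  ∀ i (h : i < es.length), inp (4 + edgePos es i) = es[i].1.val ∧
    inp (4 + edgePos es i + 1) = es[i].2.1.val ∧
    inp (4 + edgePos es i + 2) = es[i].2.2.length ∧
    ∀ l (hl : l < es[i].2.2.length), inp (4 + edgePos es i + 3 + l) = es[i].2.2[l]

theorem edgePos_succ {i : ℕ} (h : i < es.length) :
    edgePos es (i + 1) = edgePos es i + 3 + es[i].2.2.length := by
  rw [edgePos, List.take_add_one, List.getElem?_eq_getElem h]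
  simp only [Option.toList_some, List.flatMap_append, List.flatMap_singleton, List.length_append,
    edgePos, encEdge, List.length_cons, List.length_nil]
  omega

theorem edgePos_le (es : List (Fin n × Fin n × List ℕ)) (i : ℕ) :
    edgePos es i ≤ (es.flatMap encEdge).length := by
  conv_rhs => rw [← List.take_append_drop i es, List.flatMap_append, List.length_append]
  exact Nat.le_add_right _ _

theorem inputOK_of_encodes {a b c d : ℕ} :
    InputOK es fun i => ([a, b, c, d] ++ es.flatMap encEdge).getD i 0 := by
  intro i h
  have hsplit : es.flatMap encEdge =
      (es.take i).flatMap encEdge ++ (encEdge es[i] ++ (es.drop (i + 1)).flatMap encEdge) := by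
    conv_lhs => rw [← List.take_append_drop i es, List.drop_eq_getElem_cons h]
    rw [List.flatMap_append, List.flatMap_cons]
  have key : ∀ q, (hq : q < (encEdge es[i]).length) →
      ([a, b, c, d] ++ es.flatMap encEdge).getD (4 + edgePos es i + q) 0 = (encEdge es[i])[q] := by
    intro q hq
    rw [List.getD_append_right _ _ _ _ (by simp; omega), hsplit,
      List.getD_append_right _ _ _ _ (by simp [edgePos]; omega),
      List.getD_append _ _ _ _ (by simp [edgePos] at *; omega)]
    rw [List.getD_eq_getElem _ _ (by simp [edgePos] at *; omega)]
    congr 1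
    simp [edgePos]
    omega
  have hlen : (encEdge es[i]).length = 3 + es[i].2.2.length := by simp [encEdge]; omega
  refine ⟨?_, ?_, ?_, fun l hl => ?_⟩
  · have := key 0 (by omega)
    simpa [encEdge] using this
  · have := key 1 (by omega)
    simpa [encEdge] using this
  · have := key 2 (by omega)
    simpa [encEdge] using this
  · have := key (3 + l) (by omega)
    rw [← Nat.add_assoc] at this
    refine this.trans ?_
    simp [encEdge, Nat.add_comm 3 l]

/-- One step of the greedy construction of a maximal matching: `X` lists the matched vertices. -/
def addEdge (X : List (Fin n)) (r : Fin n × Fin n × List ℕ) : List (Fin n) :=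
  if r.1 ∈ X ∨ r.2.1 ∈ X then X else X ++ [r.1, r.2.1]

/-- The vertices matched by the greedy maximal matching. -/
def matched (es : List (Fin n × Fin n × List ℕ)) : List (Fin n) := es.foldl addEdge []

theorem matched_take_succ {i : ℕ} (h : i < es.length) :
    matched (es.take (i + 1)) = addEdge (matched (es.take i)) es[i] := by
  rw [matched, List.take_add_one, List.getElem?_eq_getElem h, List.foldl_append]
  rfl

theorem foldl_addEdge_nodup (es : List (Fin n × Fin n × List ℕ)) (hne : ∀ r ∈ es, r.1 ≠ r.2.1)
    (X : List (Fin n)) (hX : X.Nodup) : (es.foldl addEdge X).Nodup := by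
  induction es generalizing X with
  | nil => exact hX
  | cons r es ih =>
    refine ih (fun r' h => hne r' (List.mem_cons_of_mem _ h)) _ ?_
    unfold addEdge
    split
    · exact hX
    · rename_i h
      push Not at h
      have := hne r List.mem_cons_self
      rw [List.nodup_append]
      refine ⟨hX, by simp [this], ?_⟩
      rintro a ha b hb rfl
      simp only [List.mem_cons, List.not_mem_nil, or_false] at hb
      rcases hb with rfl | rfl
      · exact h.1 ha
      · exact h.2 ha

theorem matched_nodup (hne : ∀ r ∈ es, r.1 ≠ r.2.1) : (matched es).Nodup :=
  foldl_addEdge_nodup es hne [] List.nodup_nil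

theorem subset_foldl_addEdge (es : List (Fin n × Fin n × List ℕ)) (X : List (Fin n)) :
    X ⊆ es.foldl addEdge X := by
  induction es generalizing X with
  | nil => exact fun _ h => h
  | cons r es ih =>
    refine List.Subset.trans ?_ (ih _)
    unfold addEdge
    split
    · exact fun _ h => h
    · exact List.subset_append_left _ _

/-- The matched vertices form a vertex cover. -/
theorem matched_cover {r : Fin n × Fin n × List ℕ} (hr : r ∈ es) :
    r.1 ∈ matched es ∨ r.2.1 ∈ matched es := by
  unfold matched
  generalize ([] : List (Fin n)) = X
  induction es generalizing X with
  | nil => simp at hr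
  | cons r' es ih =>
    rcases List.mem_cons.1 hr with rfl | h
    · have hsub := subset_foldl_addEdge es (addEdge X r)
      have : r.1 ∈ addEdge X r ∨ r.2.1 ∈ addEdge X r := by
        unfold addEdge
        split
        · assumption
        · simp
      exact this.imp (@hsub _) (@hsub _)
    · exact ih h _

/-- Every vertex cover contains one vertex of each matched edge. -/
theorem matched_length_le (C : Finset (Fin n)) (hC : ∀ r ∈ es, r.1 ∈ C ∨ r.2.1 ∈ C) :
    (matched es).length ≤ 2 * C.card := by
  classical
  have main : ∀ (es : List (Fin n × Fin n × List ℕ)) (X : List (Fin n)),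
      (∀ r ∈ es, r.1 ∈ C ∨ r.2.1 ∈ C) → X.length ≤ 2 * (C.filter (· ∈ X)).card →
      (es.foldl addEdge X).length ≤ 2 * (C.filter (· ∈ es.foldl addEdge X)).card := by
    intro es
    induction es with
    | nil => intro X _ h; exact h
    | cons r es ih =>
      intro X hC hX
      refine ih _ (fun r' h => hC r' (List.mem_cons_of_mem _ h)) ?_
      unfold addEdge
      split
      · exact hX
      · rename_i h
        push Not at h
        have hlt : (C.filter (· ∈ X)).card < (C.filter (· ∈ X ++ [r.1, r.2.1])).card := by
          refine Finset.card_lt_card ⟨?_, ?_⟩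
          · intro v hv
            simp only [Finset.mem_filter, List.mem_append] at hv ⊢
            exact ⟨hv.1, Or.inl hv.2⟩
          · intro hsub
            rcases hC r List.mem_cons_self with h1 | h1
            · have := hsub (show r.1 ∈ C.filter (· ∈ X ++ [r.1, r.2.1]) by simp [h1])
              simp [h.1] at this
            · have := hsub (show r.2.1 ∈ C.filter (· ∈ X ++ [r.1, r.2.1]) by simp [h1])
              simp [h.2] at this
        simp only [List.length_append, List.length_cons, List.length_nil]
        omega
  refine (main es [] hC (by simp)).trans ?_
  exact Nat.mul_le_mul_left _ (Finset.card_filter_le _ _)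

/-- Match the two ends of the current edge if both are unmatched, and go to the next edge. -/
def matchStep : Program :=
  .seq (.assign rU (.get aIn (.reg rPtr))) <|
  .seq (.assign rV (.get aIn (.reg rPtr + .lit 1))) <|
  .seq (.ite (.get aIdx (.reg rU) + .get aIdx (.reg rV)) .skip <|
    .seq (.store aX (.reg rm) (.reg rU)) <|
    .seq (.store aX (.reg rm + .lit 1) (.reg rV)) <|
    .seq (.store aIdx (.reg rU) (.reg rm + .lit 1)) <|
    .seq (.store aIdx (.reg rV) (.reg rm + .lit 2)) <|
    .assign rm (.reg rm + .lit 2)) <|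
  .assign rPtr (.reg rPtr + .lit 3 + .get aIn (.reg rPtr + .lit 2))

/-- The registers and arrays represent the list `X` of matched vertices. -/
structure RepX (X : List (Fin n)) (s : State) : Prop where
  m_eq : s.reg rm = X.length
  idx_eq : ∀ v : Fin n, s.mem aIdx v = if v ∈ X then X.idxOf v + 1 else 0
  X_eq : ∀ i (h : i < X.length), s.mem aX i = X[i]

theorem RepX.congr {X : List (Fin n)} {s s' : State} (h : RepX X s)
    (hr : ∀ r ∈ [rm], s'.reg r = s.reg r) (ha : ∀ a ∈ [aIdx, aX], s'.mem a = s.mem a) :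
    RepX X s' := by
  obtain ⟨h1, h2, h3⟩ := h
  simp only [List.mem_cons, List.not_mem_nil, or_false, forall_eq_or_imp, forall_eq] at hr ha
  constructor <;> simp_all

/-- The test of the program is that of `addEdge`, because `aIdx` vanishes exactly at the unmatched
vertices. -/
theorem matchStep_runs {X : List (Fin n)} (hX : X.Nodup) (r : Fin n × Fin n × List ℕ)
    (hne : r.1 ≠ r.2.1) {s : State} {p : ℕ} (hs : RepX X s) (hp : s.reg rPtr = p)
    (h1 : s.mem aIn p = r.1.val) (h2 : s.mem aIn (p + 1) = r.2.1.val)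
    (h3 : s.mem aIn (p + 2) = r.2.2.length) (hpW : p + 3 + r.2.2.length ≤ W) (hnW : 2 * n + 2 ≤ W) :
    Runs W matchStep s 80 fun s' =>
      RepX (addEdge X r) s' ∧ s'.reg rPtr = p + 3 + r.2.2.length := by
  obtain ⟨u, v, ls⟩ := r
  dsimp only at *
  have hlen : X.length ≤ n := by simpa using hX.length_le_card
  have hiu := hs.idx_eq u
  have hiv := hs.idx_eq v
  have bu : s.mem aIdx u ≤ n := by
    rw [hiu]
    split
    · exact (List.idxOf_lt_length_of_mem ‹_›).trans_le hlen
    · omega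
  have bv : s.mem aIdx v ≤ n := by
    rw [hiv]
    split
    · exact (List.idxOf_lt_length_of_mem ‹_›).trans_le hlen
    · omega
  have hu := u.2
  have hv := v.2
  refine Runs.mono (Runs.of_wp (Q := fun s' => _) ?_) (by decide) fun s' h => h
  by_cases hz : s.mem aIdx u + s.mem aIdx v = 0
  · have hzu : s.mem aIdx u = 0 := by omega
    have hzv : s.mem aIdx v = 0 := by omega
    have hu' : u ∉ X := by
      intro h
      rw [if_pos h] at hiu
      omega
    have hv' : v ∉ X := by
      intro h
      rw [if_pos h] at hiv
      omega
    have hmW : s.reg rm + 2 ≤ W := by rw [hs.m_eq]; omega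
    have hadd : addEdge X (u, v, ls) = X ++ [u, v] := by simp [addEdge, hu', hv']
    simp only [matchStep, Program.wp, fits_get, eval_get, fits_reg, eval_reg, fits_add, fits_lit,
      eval_add, eval_lit, hp, h1, h2, h3, hzu, hzv, State.set_reg, State.set_mem, State.put_reg,
      State.put_mem, Nat.reduceEqDiff, if_true, if_false]
    refine ⟨by omega, by omega, by omega, fun h => by omega, fun _ => ⟨by omega, by omega, by omega,
      by omega, by omega, by omega, by omega, by omega, by omega, by omega, ?_, trivial⟩⟩
    rw [hadd]
    have hm := hs.m_eq
    refine ⟨?_, fun x => ?_, fun i hi => ?_⟩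
    · simp [hm]
    · simp only [State.set_mem, State.put_mem, Nat.reduceEqDiff, if_true,
        if_false, hm, Function.update_apply, Fin.val_inj]
      by_cases hxv : x = v
      · subst hxv
        simp [List.idxOf_append_of_notMem hv', List.idxOf_cons_ne _ hne]
      · by_cases hxu : x = u
        · subst hxu
          simp [List.idxOf_append_of_notMem hu', hne]
        · by_cases hx : x ∈ X
          · simp [hxv, hxu, hx, hs.idx_eq, List.idxOf_append_of_mem hx]
          · simp [hxv, hxu, hx, hs.idx_eq]
    · simp only [List.length_append, List.length_cons, List.length_nil] at hi
      simp only [State.set_mem, State.put_mem, Nat.reduceEqDiff, if_true,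
        if_false, hm, Function.update_apply]
      by_cases hi1 : i < X.length
      · rw [if_neg (by omega), if_neg (by omega), hs.X_eq i hi1, List.getElem_append_left hi1]
      · rw [List.getElem_append_right (by omega)]
        obtain rfl | rfl : i = X.length ∨ i = X.length + 1 := by omega
        · simp
        · simp
  · have hadd : addEdge X (u, v, ls) = X := by
      rw [addEdge, if_pos]
      by_contra h
      push Not at h
      rw [if_neg h.1] at hiu
      rw [if_neg h.2] at hiv
      omega
    simp only [matchStep, Program.wp, fits_get, eval_get, fits_reg, eval_reg, fits_add, fits_lit,
      eval_add, eval_lit, hp, h1, h2, h3, State.set_reg, State.set_mem,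
      Nat.reduceEqDiff, if_true, if_false]
    refine ⟨by omega, by omega, by omega, fun _ => ⟨by omega, ?_, trivial⟩, fun h => absurd h hz⟩
    rw [hadd]
    exact hs.congr (by simp) (by simp)

/-- The greedy matching. -/
def matchProg : Program :=
  .seq (.assign rPtr (.lit 4)) (.for rEdge rEdges matchStep)

theorem matchProg_runs (hne : ∀ r ∈ es, r.1 ≠ r.2.1) {s : State} (hin : InputOK es (s.mem aIn))
    (hes : s.reg rEdges = es.length) (hm : s.reg rm = 0) (hidx : ∀ i, s.mem aIdx i = 0)
    (hpW : 4 + (es.flatMap encEdge).length ≤ W) (hnW : 2 * n + 2 ≤ W) (heW : es.length ≤ W) :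
    Runs W matchProg s (2 + (es.length * (80 + 8) + 6)) fun s' => RepX (matched es) s' := by
  refine Runs.seq (b₁ := 2) (R := fun s' => s'.reg rPtr = 4)
    (Runs.mono (Runs.of_wp (by simp [Program.wp]; omega)) (by decide) fun s' h => h) ?_
  intro s1 hr1 hm1 hp1
  have hin1 : s1.mem aIn = s.mem aIn := hm1 _ (by decide)
  refine Runs.mono (Runs.for_const (n := es.length) (b := 80)
    (fun i s' => RepX (matched (es.take i)) s' ∧ s'.reg rPtr = 4 + edgePos es i)
    (by rw [hr1 _ (by decide), hes]) heW (by omega) (by decide) (by decide)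
        (by decide) ?_ ?_) le_rfl ?_
  · refine ⟨⟨?_, ?_, ?_⟩, ?_⟩
    · simp [matched, hr1 rm (by decide), hm]
    · intro v
      rw [State.set_mem, hm1 _ (by decide), hidx]
      simp [matched]
    · simp [matched]
    · simp [hp1, edgePos]
  · rintro i hi s2 hr2 hm2 - ⟨hX, hp2⟩
    have hin2 : s2.mem aIn = s.mem aIn := by rw [hm2 _ (by decide), hin1]
    obtain ⟨h1, h2, h3, -⟩ := hin i hi
    have hle := edgePos_le es (i + 1)
    rw [edgePos_succ hi] at hle
    refine Runs.mono (matchStep_runs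
      (matched_nodup fun r hr => hne r (List.mem_of_mem_take hr)) es[i] (hne _ (List.getElem_mem _))
      hX hp2 (by rw [hin2, h1]) (by rw [hin2, h2]) (by rw [hin2, h3]) (by omega) hnW) le_rfl ?_
    rintro s3 ⟨h4, h5⟩
    rw [matched_take_succ hi]
    refine ⟨h4.congr (by simp) (by simp), ?_⟩
    simp only [State.set_reg, Nat.reduceEqDiff, if_false, h5, edgePos_succ hi]
    omega
  · rintro s' ⟨-, h, -⟩
    rwa [List.take_length] at h

/-! ### The activity table -/

/-- Record the label with index `rLab` of the current edge if both ends are matched vertices. -/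
def actStep : Program :=
  .ite (.reg rU * .reg rV)
    (.store aAct ((.get aIn (.reg rPtr + .lit 3 + .reg rLab) - .lit 1) * .reg rE +
      ((.reg rU - .lit 1) * .reg rm + (.reg rV - .lit 1))) (.lit 1)) .skip

/-- Process the current edge and go to the next one. -/
def actEdge : Program :=
  .seq (.assign rU (.get aIdx (.get aIn (.reg rPtr)))) <|
  .seq (.assign rV (.get aIdx (.get aIn (.reg rPtr + .lit 1)))) <|
  .seq (.assign rCount (.get aIn (.reg rPtr + .lit 2))) <|
  .seq (.for rLab rCount actStep) <|
  .assign rPtr (.reg rPtr + .lit 3 + .reg rCount)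

/-- Build the table of the active pairs of matched vertices. -/
def actProg : Program :=
  .seq (.assign rE (.reg rm * .reg rm)) <|
  .seq (.assign rPtr (.lit 4)) (.for rEdge rEdges actEdge)

/-- The cell `i` of the table belongs to the edge `r` and one of the labels `ls`; the row of the
label `t` is `t - 1`. -/
def Hit (X : List (Fin n)) (r : Fin n × Fin n × List ℕ) (ls : List ℕ) (i : ℕ) : Prop :=
  r.1 ∈ X ∧ r.2.1 ∈ X ∧ ∃ t ∈ ls,
    i = (t - 1) * (X.length * X.length) + (X.idxOf r.1 * X.length + X.idxOf r.2.1)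

/-- The table is that of the edges `es`. -/
def TableOK (X : List (Fin n)) (es : List (Fin n × Fin n × List ℕ)) (A : ℕ → ℕ) : Prop :=
  ∀ i, A i ≤ 1 ∧ (A i ≠ 0 ↔ ∃ r ∈ es, Hit X r r.2.2 i)

theorem actEdge_runs {X : List (Fin n)} (r : Fin n × Fin n × List ℕ) {s : State} {p : ℕ}
    (es : List (Fin n × Fin n × List ℕ))
    (hs : RepX X s) (hE : s.reg rE = X.length * X.length) (hp : s.reg rPtr = p)
    (h1 : s.mem aIn p = r.1.val) (h2 : s.mem aIn (p + 1) = r.2.1.val)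
    (h3 : s.mem aIn (p + 2) = r.2.2.length)
    (h4 : ∀ l (hl : l < r.2.2.length), s.mem aIn (p + 3 + l) = r.2.2[l])
    (hT : ∀ t ∈ r.2.2, t ≤ T)
    (hA : TableOK X es (s.mem aAct))
    (hpW : p + 3 + r.2.2.length ≤ W) (hXn : X.length ≤ W) (hnW : 2 * n + 2 ≤ W)
    (hTW : (T + 1) * (X.length * X.length) + X.length * X.length + T ≤ W) :
    Runs W actEdge s (26 + (r.2.2.length * (40 + 8) + 6)) fun s' =>
      TableOK X (es ++ [r]) (s'.mem aAct) ∧ s'.reg rPtr = p + 3 + r.2.2.length := by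
  obtain ⟨u, v, ls⟩ := r
  dsimp only at *
  set m := X.length with hm
  have hiu := hs.idx_eq u
  have hiv := hs.idx_eq v
  have bu : s.mem aIdx u ≤ m := by
    rw [hiu]
    split
    · exact List.idxOf_lt_length_of_mem ‹_›
    · omega
  have bv : s.mem aIdx v ≤ m := by
    rw [hiv]
    split
    · exact List.idxOf_lt_length_of_mem ‹_›
    · omega
  have hu := u.2
  have hv := v.2
  refine Runs.mono (b := 4 + (6 + (5 + (ls.length * (40 + 8) + 6 + 6)))) ?_ (by omega) fun s' h => h
  refine Runs.seq (b₁ := 4) (R := fun s' => s'.reg rU = s.mem aIdx u)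
    (Runs.mono (Runs.of_wp ?_) (by decide) fun s' h => h) ?_
  · simp [Program.wp, hp, h1]
    omega
  intro s1 hr1 hm1 hU1
  have hmem1 : ∀ a, s1.mem a = s.mem a := fun a => hm1 a (by simp [Program.wmems])
  refine Runs.seq (b₁ := 6) (R := fun s' => s'.reg rV = s.mem aIdx v)
    (Runs.mono (Runs.of_wp ?_) (by decide) fun s' h => h) ?_
  · simp [Program.wp, hr1 rPtr (by decide), hp, hmem1, h2]
    omega
  intro s2 hr2 hm2 hV2
  have hmem2 : ∀ a, s2.mem a = s.mem a := fun a => (hm2 a (by simp [Program.wmems])).trans (hmem1 a)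
  refine Runs.seq (b₁ := 5) (R := fun s' => s'.reg rCount = ls.length)
    (Runs.mono (Runs.of_wp ?_) (by decide) fun s' h => h) ?_
  · simp [Program.wp, hr2 rPtr (by decide), hr1 rPtr (by decide), hp, hmem2, h3]
    omega
  intro s3 hr3 hm3 hC3
  have hmem3 : ∀ a, s3.mem a = s.mem a := fun a => (hm3 a (by simp [Program.wmems])).trans (hmem2 a)
  have hU3 : s3.reg rU = s.mem aIdx u := by rw [hr3 _ (by decide), hr2 _ (by decide), hU1]
  have hV3 : s3.reg rV = s.mem aIdx v := by rw [hr3 _ (by decide), hV2]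
  have hp3 : s3.reg rPtr = p := by
    rw [hr3 _ (by decide), hr2 _ (by decide), hr1 _ (by decide), hp]
  have hE3 : s3.reg rE = m * m := by
    rw [hr3 _ (by decide), hr2 _ (by decide), hr1 _ (by decide), hE]
  have hm3' : s3.reg rm = m := by
    rw [hr3 _ (by decide), hr2 _ (by decide), hr1 _ (by decide), hs.m_eq]
  refine Runs.seq (Runs.for_const (n := ls.length) (b := 40)
    (fun l s' => ∀ i, s'.mem aAct i ≤ 1 ∧ (s'.mem aAct i ≠ 0 ↔
      (∃ r ∈ es, Hit X r r.2.2 i) ∨ Hit X (u, v, ls) (ls.take l) i))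
    hC3 (by omega) (by omega) (by decide) (by decide) (by decide) ?_ ?_) ?_
  · intro i
    rw [State.set_mem, hmem3]
    refine ⟨(hA i).1, (hA i).2.trans ?_⟩
    simp [Hit]
  · intro l hl s4 hr4 hm4 hl4 hA4
    have hin4 : s4.mem aIn (p + 3 + l) = ls[l] := by rw [hm4 _ (by decide), hmem3, h4 l hl]
    have hU4 : s4.reg rU = s.mem aIdx u := by rw [hr4 _ (by decide), hU3]
    have hV4 : s4.reg rV = s.mem aIdx v := by rw [hr4 _ (by decide), hV3]
    have hp4 : s4.reg rPtr = p := by rw [hr4 _ (by decide), hp3]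
    have hE4 : s4.reg rE = m * m := by rw [hr4 _ (by decide), hE3]
    have hm4' : s4.reg rm = m := by rw [hr4 _ (by decide), hm3']
    have ht : ls[l] ≤ T := hT _ (List.getElem_mem _)
    have hUV : s.mem aIdx u * s.mem aIdx v ≤ m * m := Nat.mul_le_mul bu bv
    have htm : (ls[l] - 1) * (m * m) ≤ T * (m * m) := Nat.mul_le_mul_right _ (by omega)
    have e1 : (T + 1) * (m * m) = T * (m * m) + m * m := by ring
    have hpm : (s.mem aIdx u - 1) * m + (s.mem aIdx v - 1) ≤ m * m := by
      by_cases h0 : m = 0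
      · rw [h0] at bv ⊢
        omega
      · exact (code_lt (M := m) (E := m) (by omega) (by omega)).le
    refine Runs.mono (Runs.of_wp (Q := fun s' => _) ?_) (by decide) fun s' h => h
    simp only [actStep, Program.wp, fits_get, eval_get, fits_reg, eval_reg, fits_add, fits_mul,
        fits_sub,
      fits_lit, eval_add, eval_mul, eval_sub, eval_lit, hU4, hV4, hp4, hE4, hm4', hl4, hin4,
      State.set_mem, State.put_mem, if_true]
    have htake : ∀ i, Hit X (u, v, ls) (ls.take (l + 1)) i ↔ Hit X (u, v, ls) (ls.take l) i ∨
        (u ∈ X ∧ v ∈ X ∧ i = (ls[l] - 1) * (m * m) + (X.idxOf u * m + X.idxOf v)) := by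
      intro i
      unfold Hit
      rw [List.take_add_one, List.getElem?_eq_getElem hl]
      simp only [Option.toList_some, List.mem_append, List.mem_singleton]
      constructor
      · rintro ⟨h5, h6, t, h7 | rfl, h8⟩
        · exact Or.inl ⟨h5, h6, t, h7, h8⟩
        · exact Or.inr ⟨h5, h6, h8⟩
      · rintro (⟨h5, h6, t, h7, h8⟩ | ⟨h5, h6, h8⟩)
        · exact ⟨h5, h6, t, Or.inl h7, h8⟩
        · exact ⟨h5, h6, _, Or.inr rfl, h8⟩
    refine ⟨by omega, fun h0 => ⟨by omega, by omega, fun i => ?_⟩, fun h0 i => ?_⟩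
    · have huX : u ∈ X := by
        by_contra h
        rw [if_neg h] at hiu
        simp [hiu] at h0
      have hvX : v ∈ X := by
        by_contra h
        rw [if_neg h] at hiv
        simp [hiv] at h0
      rw [if_pos huX] at hiu
      rw [if_pos hvX] at hiv
      rw [hiu, hiv, Nat.add_sub_cancel, Nat.add_sub_cancel, htake, Function.update_apply]
      split
      · rename_i h
        simp [huX, hvX, h]
      · rename_i h
        rw [(hA4 i).2]
        simp [h, (hA4 i).1]
    · rw [htake, (hA4 i).2]
      refine ⟨(hA4 i).1, ⟨fun h => ?_, fun h => ?_⟩⟩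
      · rcases h with h | h
        · exact Or.inl h
        · exact Or.inr (Or.inl h)
      · rcases h with h | h | ⟨h5, h6, -⟩
        · exact Or.inl h
        · exact Or.inr h
        · rw [hiu, hiv, if_pos h5, if_pos h6] at h0
          simp at h0
  · rintro s4 hr4 hm4 ⟨-, hA4⟩
    refine Runs.mono (Runs.of_wp (Q := fun s' => _) ?_) (by decide) fun s' h => h
    have hp4 : s4.reg rPtr = p := by rw [hr4 _ (by decide), hp3]
    have hC4 : s4.reg rCount = ls.length := by rw [hr4 _ (by decide), hC3]
    simp only [Program.wp, fits_reg, eval_reg, fits_add, fits_lit, eval_add, eval_lit, hp4, hC4,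
      State.set_mem, State.set_reg, if_true]
    refine ⟨by omega, fun i => ?_, trivial⟩
    refine ⟨(hA4 i).1, (hA4 i).2.trans ?_⟩
    rw [List.take_length]
    simp only [List.mem_append, List.mem_singleton]
    constructor
    · rintro (⟨r, h5, h6⟩ | h)
      · exact ⟨r, Or.inl h5, h6⟩
      · exact ⟨_, Or.inr rfl, h⟩
    · rintro ⟨r, h5 | rfl, h6⟩
      · exact Or.inl ⟨r, h5, h6⟩
      · exact Or.inr h6

/-- The time spent on an edge is proportional to the length of its code, so the total time is
proportional to the length of the input although the numbers of labels vary. -/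
theorem actProg_runs {X : List (Fin n)} {s : State}
    (hs : RepX X s) (hin : InputOK es (s.mem aIn)) (hes : s.reg rEdges = es.length)
    (hT : ∀ r ∈ es, ∀ t ∈ r.2.2, t ≤ T) (hA : ∀ i, s.mem aAct i = 0)
    (hpW : 4 + (es.flatMap encEdge).length ≤ W) (hXn : X.length ≤ W) (hnW : 2 * n + 2 ≤ W)
    (heW : es.length ≤ W) (hTW : (T + 1) * (X.length * X.length) + X.length * X.length + T ≤ W) :
    Runs W actProg s (12 + 48 * (es.flatMap encEdge).length) fun s' =>
      TableOK X es (s'.mem aAct) ∧ s'.reg rE = X.length * X.length := by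
  have e1 : (T + 1) * (X.length * X.length) = T * (X.length * X.length) + X.length * X.length := by
    ring
  have hmono : Monotone (edgePos es) := by
    refine monotone_nat_of_le_succ fun i => ?_
    by_cases hi : i < es.length
    · rw [edgePos_succ hi]
      omega
    · rw [edgePos, edgePos, List.take_of_length_le (by omega), List.take_of_length_le (by omega)]
  have hsum : ∑ i ∈ Finset.range es.length, ((48 * (edgePos es (i + 1) - edgePos es i) - 8) + 8)
      ≤ 48 * (es.flatMap encEdge).length := by
    have h1 : ∀ i ∈ Finset.range es.length,
        (48 * (edgePos es (i + 1) - edgePos es i) - 8) + 8 =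
          48 * (edgePos es (i + 1) - edgePos es i) := by
      intro i hi
      rw [edgePos_succ (Finset.mem_range.1 hi)]
      omega
    rw [Finset.sum_congr rfl h1, ← Finset.mul_sum, Finset.sum_range_tsub hmono]
    refine Nat.mul_le_mul_left _ ?_
    exact (Nat.sub_le _ _).trans (edgePos_le es _)
  refine Runs.mono (b := 4 + (2 + (48 * (es.flatMap encEdge).length + 6))) ?_
      (by omega) fun s' h => h
  refine Runs.seq (b₁ := 4) (R := fun s' => s'.reg rE = X.length * X.length)
    (Runs.mono (Runs.of_wp ?_) (by decide) fun s' h => h) ?_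
  · simp [Program.wp, hs.m_eq]
    omega
  intro s1 hr1 hm1 hE1
  refine Runs.seq (b₁ := 2) (R := fun s' => s'.reg rPtr = 4)
    (Runs.mono (Runs.of_wp (by simp [Program.wp]; omega)) (by decide) fun s' h => h) ?_
  intro s2 hr2 hm2 hp2
  have hmem2 : ∀ a, s2.mem a = s.mem a := fun a =>
    (hm2 a (by simp [Program.wmems])).trans (hm1 a (by simp [Program.wmems]))
  have hs2 : RepX X s2 := (hs.congr (fun r h => hr1 r (by revert r; decide))
    (fun r h => hm1 r (by revert r; decide))).congr (fun r h => hr2 r (by revert r; decide))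
    (fun r h => hm2 r (by revert r; decide))
  have hE2 : s2.reg rE = X.length * X.length := by rw [hr2 _ (by decide), hE1]
  refine Runs.mono (Runs.for (n := es.length)
    (b := fun i => 48 * (edgePos es (i + 1) - edgePos es i) - 8)
    (fun i s' => TableOK X (es.take i) (s'.mem aAct) ∧ s'.reg rPtr = 4 + edgePos es i)
    (by rw [hr2 _ (by decide), hr1 _ (by decide), hes]) heW (by omega) (by decide) (by decide)
    (by decide) ?_ ?_).frame (by omega) ?_
  · refine ⟨fun i => ?_, ?_⟩
    · rw [State.set_mem, hmem2, hA]
      simp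
    · simp [hp2, edgePos]
  · rintro i hi s3 hr3 hm3 - ⟨hA3, hp3⟩
    have hs3 := hs2.congr (fun r h => hr3 r (by revert r; decide))
        (fun r h => hm3 r (by revert r; decide))
    have hin3 : s3.mem aIn = s.mem aIn := by rw [hm3 _ (by decide), hmem2]
    have hE3 : s3.reg rE = X.length * X.length := by rw [hr3 _ (by decide), hE2]
    obtain ⟨h1, h2, h3, h4⟩ := hin i hi
    have hle := edgePos_le es (i + 1)
    rw [edgePos_succ hi] at hle
    refine Runs.mono (actEdge_runs es[i] (es.take i) hs3 hE3 hp3 (by rw [hin3, h1])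
        (by rw [hin3, h2])
      (by rw [hin3, h3]) (fun l hl => by rw [hin3, h4 l hl]) (hT _ (List.getElem_mem _)) hA3
      (by omega) hXn hnW hTW) (by rw [edgePos_succ hi]; omega) ?_
    rintro s4 ⟨h5, h6⟩
    rw [List.take_add_one, List.getElem?_eq_getElem hi]
    refine ⟨h5, ?_⟩
    simp only [State.set_reg, Nat.reduceEqDiff, if_false, h6, edgePos_succ hi]
    omega
  · rintro s' ⟨hr3, -, -, h, -⟩
    rw [List.take_length] at h
    exact ⟨h, by rw [hr3 _ (by decide), hE2]⟩

end Input

/-! ### Leading numbers, derived parameters and output -/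

section Output

variable {W m D T k B N L S : ℕ} {A rank : ℕ → ℕ}

/-- Read the four leading numbers of the input. -/
def headProg : Program :=
  .seq (.assign rn (.get aIn (.lit 0))) <| .seq (.assign rT (.get aIn (.lit 1))) <|
  .seq (.assign rD (.get aIn (.lit 2))) <| .assign rEdges (.get aIn (.lit 3))

/-- Compute the parameters of the dynamic program. -/
def setupProg : Program :=
  .seq (.assign rM (.lit 2 * .reg rE + .lit 1)) <|
  .seq (.assign rB (.reg rT / .reg rD)) <|
  .seq (.assign rBlocks (.reg rB + .lit 1)) <|
  .seq (.assign rN (.reg rBlocks * .reg rD)) <|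
  .seq (.assign rL ((.lit 2 * .reg rE * .reg rM + .lit 1) * .reg rm)) <|
  .seq (.assign rDD (.reg rD + .reg rD)) <|
  .assign rTries (.reg rm + .lit 1)

/-- Write the colors of the matched vertices in the time slot `rt`. -/
def outRow : Program :=
  .for rx rm (.store aOut (.lit 2 + .reg rm + (.reg rt * .reg rm + .reg rx))
    (colorExp (.get aSt (.reg rt / .reg rD)) (.reg rt) (.reg rx)))

/-- Write the coloring. -/
def outProg : Program :=
  .seq (.store aOut (.lit 0) (.reg rk)) <|
  .seq (.store aOut (.lit 1) (.reg rm)) <|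
  .seq (.for ra rm (.store aOut (.lit 2 + .reg ra) (.get aX (.reg ra)))) <|
  .seq (.for rt rT outRow) <|
  .assign rOut (.lit 2 + .reg rm + .reg rT * .reg rm)

theorem map_range_mul (T m : ℕ) (g : ℕ → ℕ) :
    (List.range (T * m)).map g =
      (List.range T).flatMap fun t => (List.range m).map fun x => g (t * m + x) := by
  induction T with
  | zero => simp
  | succ T ih =>
    rw [Nat.succ_mul, List.range_add, List.map_append, ih, List.range_succ, List.flatMap_append,
      List.flatMap_singleton, List.map_map]
    rfl

theorem outProg_runs (hB : DPBounds W m D T k B N L S A rank) {s : State}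
    (hs : DPCtx W m D T k B N L S A rank s) (hTB : T / D = B)
    (hst : ∀ i ≤ B, s.mem aSt i < S) (hX : ∀ i < m, s.mem aX i ≤ W) (hW : T * m + m + 2 ≤ W) :
    Runs W outProg s (20 + (m * 16 + 6) + (T * (m * 40 + 14) + 6)) fun s' =>
      s'.output = [k, m] ++ (List.range m).map (s.mem aX) ++
        (List.range T).flatMap fun t => (List.range m).map fun x =>
          stateColor m k rank (s.mem aSt (t / D)) t x := by
  obtain ⟨D_pos, k_ge, k_le, S_eq, T_le, N_eq, cells, A_le, rank_le, rank_le', L_le, table⟩ := hB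
  have hSW : S ≤ W := by
    have : 1 * S ≤ (B + 2) * S := Nat.mul_le_mul_right _ (by omega)
    omega
  refine Runs.mono (b := 3 + (3 + (m * (7 + 8) + 6 + (T * ((m * (32 + 8) + 6) + 8) + 6 + 8)))) ?_
    (by ring_nf; omega) fun s' h => h
  refine Runs.seq (b₁ := 3) (R := fun s' => s'.mem aOut 0 = k)
    (Runs.mono (Runs.of_wp (by simp [Program.wp, hs.k_eq, k_le])) (by decide) fun s' h => h) ?_
  intro s1 hr1 hm1 h1
  have hs1 := hs.congr (fun r h => hr1 r (by revert r; decide))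
      (fun r h => hm1 r (by revert r; decide))
  refine Runs.seq (b₁ := 3) (R := fun s' => s'.mem aOut 0 = k ∧ s'.mem aOut 1 = m)
    (Runs.mono (Runs.of_wp (by simp [Program.wp, hs1.m_eq, h1]; omega))
        (by decide) fun s' h => h) ?_
  intro s2 hr2 hm2 h2
  have hs2 := hs1.congr (fun r h => hr2 r (by revert r; decide))
      (fun r h => hm2 r (by revert r; decide))
  have hX2 : s2.mem aX = s.mem aX := by rw [hm2 _ (by decide), hm1 _ (by decide)]
  have hst2 : s2.mem aSt = s.mem aSt := by rw [hm2 _ (by decide), hm1 _ (by decide)]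
  refine Runs.seq (Runs.for_const (n := m) (b := 7)
    (fun i s' => s'.mem aOut 0 = k ∧ s'.mem aOut 1 = m ∧
      ∀ i' < i, s'.mem aOut (2 + i') = s.mem aX i')
    hs2.m_eq (by omega) (by omega) (by decide) (by decide) (by decide) ?_ ?_) ?_
  · exact ⟨h2.1, h2.2, by simp⟩
  · rintro i hi s3 hr3 hm3 hi3 ⟨g0, g1, g2⟩
    have hX3 : s3.mem aX = s.mem aX := by rw [hm3 _ (by decide), hX2]
    have := hX i hi
    refine Runs.mono (Runs.of_wp (Q := fun s' => _) ?_) (by decide) fun s' h => h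
    simp only [Program.wp, fits_get, eval_get, fits_reg, eval_reg, fits_add, fits_lit, eval_add,
      eval_lit, hi3, hX3, State.set_mem, State.put_mem, if_true]
    refine ⟨by omega, by omega, ?_, ?_, fun i' hi' => ?_⟩
    · rw [Function.update_of_ne (by omega), g0]
    · rw [Function.update_of_ne (by omega), g1]
    · rw [Function.update_apply]
      split
      · rw [show i' = i by omega]
      · exact g2 i' (by omega)
  rintro s3 hr3 hm3 ⟨-, h3⟩
  have hs3 := hs2.congr (fun r h => hr3 r (by revert r; decide))
      (fun r h => hm3 r (by revert r; decide))
  have hst3 : s3.mem aSt = s.mem aSt := by rw [hm3 _ (by decide), hst2]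
  let col : ℕ → ℕ → ℕ := fun t x => stateColor m k rank (s.mem aSt (t / D)) t x
  have hrow : ∀ {t t' x x'}, x < m → x' < m → t * m + x = t' * m + x' → t = t' ∧ x = x' :=
    fun h h' h'' => code_inj h h' h''
  refine Runs.seq (Runs.for_const (n := T) (b := m * (32 + 8) + 6)
    (fun t s' => (s'.mem aOut 0 = k ∧ s'.mem aOut 1 = m ∧
      ∀ i' < m, s'.mem aOut (2 + i') = s.mem aX i') ∧
      ∀ t' < t, ∀ x < m, s'.mem aOut (2 + m + (t' * m + x)) = col t' x)
    hs3.T_eq (by omega) (by omega) (by decide) (by decide) (by decide) ?_ ?_) ?_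
  · exact ⟨h3, by simp⟩
  · rintro t ht s4 hr4 hm4 ht4 ⟨h4, h4'⟩
    have hs4 := hs3.congr (fun r h => hr4 r (by revert r; decide))
        (fun r h => hm4 r (by revert r; decide))
    have hst4 : s4.mem aSt = s.mem aSt := by rw [hm4 _ (by decide), hst3]
    refine Runs.mono (Runs.for_const (n := m) (b := 32)
      (fun x s' => (s'.mem aOut 0 = k ∧ s'.mem aOut 1 = m ∧
        ∀ i' < m, s'.mem aOut (2 + i') = s.mem aX i') ∧
        (∀ t' < t, ∀ x < m, s'.mem aOut (2 + m + (t' * m + x)) = col t' x) ∧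
        ∀ x' < x, s'.mem aOut (2 + m + (t * m + x')) = col t x')
      hs4.m_eq (by omega) (by omega) (by decide) (by decide) (by decide) ?_ ?_) le_rfl ?_
    · exact ⟨h4, h4', by simp⟩
    · rintro x hx s5 hr5 hm5 hx5 ⟨⟨g0, g1, g2⟩, g3, g4⟩
      have hs5 := hs4.congr (fun r h => hr5 r (by revert r; decide))
          (fun r h => hm5 r (by revert r; decide))
      have hst5 : s5.mem aSt = s.mem aSt := by rw [hm5 _ (by decide), hst4]
      have ht5 : s5.reg rt = t := by rw [hr5 _ (by decide), ht4]
      have c1 := code_lt (M := m) ht hx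
      have htN : t < N := by omega
      have r1 := rank_le t htN
      have r2 := rank_le' t htN
      have hq : t / D ≤ B := hTB ▸ Nat.div_le_div_right ht.le
      have hsq := hst _ hq
      have hpw := hs5.pw_eq (rank t * m + x) (by omega)
      have hpW : k ^ (rank t * m + x) ≤ W :=
        (Nat.pow_le_pow_right (by omega) (by omega)).trans (S_eq ▸ hSW)
      have hDN : D ≤ N := by rw [N_eq]; exact Nat.le_mul_of_pos_left _ (by omega)
      refine Runs.mono (Runs.of_wp (Q := fun s' => _) ?_) (by decide) fun s' h => h
      simp only [Program.wp, colorExp, fits_get, eval_get, fits_reg, eval_reg, fits_add, fits_mul,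
        fits_div, fits_mod, eval_div, eval_mod, eval_mul, fits_lit, eval_add,
        eval_lit, hx5, ht5, hst5, hs5.m_eq, hs5.D_eq, hs5.k_eq, hs5.rank_eq, hpw, State.set_mem,
        State.put_mem, if_true]
      refine ⟨by omega, by omega, ⟨?_, ?_, fun i' hi' => ?_⟩, fun t' ht' x' hx' => ?_,
          fun x' hx' => ?_⟩
      · rw [Function.update_of_ne (by omega), g0]
      · rw [Function.update_of_ne (by omega), g1]
      · rw [Function.update_of_ne (by omega), g2 i' hi']
      · rw [Function.update_of_ne, g3 t' ht' x' hx']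
        intro h
        have := (hrow hx' hx (show t' * m + x' = t * m + x by omega)).1
        omega
      · rw [Function.update_apply]
        split
        · rw [show x' = x by omega]
          rfl
        · exact g4 x' (by omega)
    · rintro s5 ⟨-, g1, g2, g3⟩
      refine ⟨g1, fun t' ht' x hx => ?_⟩
      rw [State.set_mem]
      rcases Nat.lt_succ_iff_lt_or_eq.1 ht' with h | rfl
      · exact g2 t' h x hx
      · exact g3 x hx
  · rintro s4 hr4 hm4 ⟨-, ⟨g0, g1, g2⟩, g3⟩
    have hs4 := hs3.congr (fun r h => hr4 r (by revert r; decide))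
        (fun r h => hm4 r (by revert r; decide))
    refine Runs.mono (Runs.of_wp (Q := fun s' => s'.reg rOut = 2 + m + T * m ∧
        s'.mem aOut = s4.mem aOut)
      ?_) (by decide) ?_
    · simp only [Program.wp, fits_reg, eval_reg, fits_add, fits_mul, fits_lit, eval_add, eval_mul,
        eval_lit, hs4.m_eq, hs4.T_eq, State.set_reg, State.set_mem, if_true]
      refine ⟨by omega, trivial, trivial⟩
    · rintro s5 ⟨hl, ho⟩
      rw [State.output, hl, ho, List.range_add, List.range_add, List.map_append, List.map_append,
        List.map_map, List.map_map, map_range_mul]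
      congr 1
      · congr 1
        · simp [List.range_succ, g0, g1]
        · refine List.map_congr_left fun i hi => ?_
          exact g2 i (List.mem_range.1 hi)
      · refine List.flatMap_congr fun t ht => List.map_congr_left fun x hx => ?_
        exact g3 t (List.mem_range.1 ht) x (List.mem_range.1 hx)

end Output

/-! ### The complexity bound -/

/-- The number of digits of a block state. -/
def digits (q : ℕ) : ℕ := (2 * (q * q) * (2 * (q * q) + 1) + 1) * q

/-- A common bound for all quantities that depend only on the number `q` of matched vertices. -/
def kBound (q : ℕ) : ℕ := (q + 2) + q * q + (2 * (q * q) + 1) + digits q + (q + 2) ^ digits q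

theorem digits_mono {m q : ℕ} (h : m ≤ q) : digits m ≤ digits q := by
  unfold digits
  gcongr

theorem kBound_mono {m q : ℕ} (h : m ≤ q) : kBound m ≤ kBound q := by
  have h1 := digits_mono h
  have h2 : (m + 2) ^ digits m ≤ (q + 2) ^ digits q :=
    (Nat.pow_le_pow_left (by omega) _).trans (Nat.pow_le_pow_right (by omega) h1)
  have h3 : m * m ≤ q * q := Nat.mul_le_mul h h
  unfold kBound
  omega

/-- The factor of the linear time bound: the running time is a sum of terms `C * K ^ i * z` with
`i ≤ 4`, where `K` is the common bound for `m ≤ 2 * ν` and `z` the size of the instance, and the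
constants `C` sum to less than `3000`. -/
def fBound (ν : ℕ) : ℕ := 3000 * kBound (2 * ν) ^ 4

theorem computable_fBound : Computable fBound := by
  have hpow : Primrec₂ fun a b : ℕ => a ^ b := Primrec₂.unpaired'.1 Nat.Primrec.pow
  have hc : ∀ c : ℕ, Primrec fun _ : ℕ => c := fun c => Primrec.const c
  have hadd : ∀ {f g : ℕ → ℕ}, Primrec f → Primrec g → Primrec fun x => f x + g x :=
    fun hf hg => Primrec.nat_add.comp hf hg
  have hmul : ∀ {f g : ℕ → ℕ}, Primrec f → Primrec g → Primrec fun x => f x * g x :=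
    fun hf hg => Primrec.nat_mul.comp hf hg
  have hpw : ∀ {f g : ℕ → ℕ}, Primrec f → Primrec g → Primrec fun x => f x ^ g x :=
    fun hf hg => hpow.comp hf hg
  have hid : Primrec fun x : ℕ => x := Primrec.id
  have hsq := hmul hid hid
  have hdig : Primrec digits :=
    hmul (hadd (hmul (hmul (hc 2) hsq) (hadd (hmul (hc 2) hsq) (hc 1))) (hc 1)) hid
  have hk : Primrec kBound :=
    hadd (hadd (hadd (hadd (hadd hid (hc 2)) hsq) (hadd (hmul (hc 2) hsq) (hc 1))) hdig)
      (hpw (hadd hid (hc 2)) hdig)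
  exact (hmul (hc 3000) (hpw (hk.comp (hmul (hc 2) hid)) (hc 4))).to_comp

section Times

variable {m D B L S K z : ℕ}

theorem checkTime_le (hD : 1 ≤ D) (hK : 1 ≤ K) (hE : m * m ≤ K) : checkTime m D ≤ 432 *
    (K * D) := by
  have h1 : scanUpdate.cost + scanTest.cost + 8 ≤ 200 := by decide
  have h2 : (D + D) * (scanUpdate.cost + scanTest.cost + 8) ≤
      (D + D) * 200 := Nat.mul_le_mul_left _ h1
  have h3 : m * m * (4 + ((D + D) * (scanUpdate.cost + scanTest.cost + 8) + 6) + 8) ≤ K *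
      (418 * D) :=
    Nat.mul_le_mul hE (by omega)
  have h4 : 1 ≤ K * D := Nat.mul_pos hK hD
  have h5 : K * (418 * D) = 418 * (K * D) := by ring
  unfold checkTime
  omega

theorem dpCellTime_le (hD : 1 ≤ D) (hK : 1 ≤ K) (hE : m * m ≤ K) (hS : S ≤ K) :
    dpCellTime m D S ≤ 500 * (K * K * D) := by
  have h1 := checkTime_le hD hK hE
  have h4 : 1 ≤ K * D := Nat.mul_pos hK hD
  have h2 : dpTryTime m D ≤ 472 * (K * D) := by
    have : (cellExp (.reg rI) (.reg ra)).cost ≤ 19 := by decide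
    unfold dpTryTime
    omega
  have h3 : S * (dpTryTime m D + 8) ≤ K * (480 * (K * D)) := Nat.mul_le_mul hS (by omega)
  have h5 : K * (480 * (K * D)) = 480 * (K * K * D) := by ring
  have h6 : 1 ≤ K * K * D := Nat.mul_pos (Nat.mul_pos hK hK) hD
  unfold dpCellTime
  omega

theorem dpFillTime_le (hD : 1 ≤ D) (hK : 1 ≤ K) (hB : 1 ≤ B) (hE : m * m ≤ K) (hS : S ≤ K)
    (hBD : B * D ≤ z) : dpFillTime m D B S ≤ 550 * (K ^ 3 * z) := by
  have h1 := dpCellTime_le hD hK hE hS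
  have h6 : 1 ≤ K * K * D := Nat.mul_pos (Nat.mul_pos hK hK) hD
  have h2 : S * (dpCellTime m D S + 8) ≤ K * (508 * (K * K * D)) := Nat.mul_le_mul hS (by omega)
  have h7 : 1 ≤ K * (K * K * D) := Nat.mul_pos hK h6
  have h5 : K * (508 * (K * K * D)) = 508 * (K * (K * K * D)) := by ring
  have h3 : B * (S * (dpCellTime m D S + 8) + 6 + 8) ≤ B * (522 * (K * (K * K * D))) :=
    Nat.mul_le_mul_left _ (by omega)
  have h8 : B * (522 * (K * (K * K * D))) = 522 * (K ^ 3 * (B * D)) := by ring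
  have h9 : K ^ 3 * (B * D) ≤ K ^ 3 * z := Nat.mul_le_mul_left _ hBD
  have h10 : K ≤ K ^ 3 * z := by
    have : 1 ≤ z := (show 1 ≤ B * D from Nat.mul_pos hB hD).trans hBD
    calc K = K ^ 1 * 1 := by ring
      _ ≤ K ^ 3 * z := Nat.mul_le_mul (Nat.pow_le_pow_right hK (by omega)) this
  unfold dpFillTime
  omega

theorem searchTime_le (hD : 1 ≤ D) (hB : 1 ≤ B) (hm : m + 2 ≤ K) (hE : m * m ≤ K) (hL : L ≤ K)
    (hS : (m + 2) ^ L ≤ K) (hBD : B * D ≤ z) :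
    (m + 1) * (tryTime m D B L + 8) + 6 ≤ 650 * (K ^ 4 * z) := by
  have hK : 1 ≤ K := by omega
  have h1 := dpFillTime_le hD hK hB hE hS hBD
  have hz : 1 ≤ z := (show 1 ≤ B * D from Nat.mul_pos hB hD).trans hBD
  have h10 : K ≤ K ^ 3 * z := by
    calc K = K ^ 1 * 1 := by ring
      _ ≤ K ^ 3 * z := Nat.mul_le_mul (Nat.pow_le_pow_right hK (by omega)) hz
  have h2 : tryTime m D B L + 8 ≤ 630 * (K ^ 3 * z) := by
    unfold tryTime powTime
    omega
  have h3 : (m + 1) * (tryTime m D B L + 8) ≤ K * (630 * (K ^ 3 * z)) :=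
    Nat.mul_le_mul (by omega) h2
  have h4 : K * (630 * (K ^ 3 * z)) = 630 * (K ^ 4 * z) := by ring
  have h5 : 1 ≤ K ^ 4 * z := Nat.mul_pos (Nat.pow_pos hK) hz
  omega

theorem slotTime_le {N : ℕ} (hK : 1 ≤ K) (hz : 1 ≤ z) (hE : m * m ≤ K) (hN : N ≤ 2 * z) :
    slotTime m N ≤ 600 * (K * z) := by
  have h1 : N * (5 + 1 + (m * m * (100 + 8) + 6) + 8) ≤ 2 * z * (128 * K) :=
    Nat.mul_le_mul hN (by omega)
  have h2 : 2 * z * (128 * K) = 256 * (K * z) := by ring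
  have h3 : 1 ≤ K * z := Nat.mul_pos hK hz
  unfold slotTime slotPassTime
  omega

end Times

/-! ### The whole program -/

/-- The approximation algorithm. -/
def mainProg : Program :=
  .seq headProg <| .seq matchProg <| .seq actProg <| .seq setupProg <| .seq slotProg <|
  .seq searchProg <| .seq backProg outProg

section Main

variable {n W T D z ν : ℕ} {es : List (Fin n × Fin n × List ℕ)}

/-- The activity relation of the pairs of matched vertices, with times counted from `0`. -/
def pairAct (X : List (Fin n)) (es : List (Fin n × Fin n × List ℕ)) (t e : ℕ) : Prop :=
  ∃ r ∈ es, r.1 ∈ X ∧ r.2.1 ∈ X ∧ t + 1 ∈ r.2.2 ∧ e = X.idxOf r.1 * X.length + X.idxOf r.2.1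

theorem actOf_iff {X : List (Fin n)} {A : ℕ → ℕ} (hA : TableOK X es A)
    (hpos : ∀ r ∈ es, ∀ t ∈ r.2.2, 1 ≤ t) (t e : ℕ) :
    actOf X.length A t e ↔ pairAct X es t e := by
  have hlt : ∀ {u v : Fin n}, u ∈ X → v ∈ X →
      X.idxOf u * X.length + X.idxOf v < X.length * X.length := fun hu hv =>
    code_lt (List.idxOf_lt_length_of_mem hu) (List.idxOf_lt_length_of_mem hv)
  rw [actOf, (hA _).2]
  constructor
  · rintro ⟨he, r, hr, hu, hv, l, hl, h⟩
    obtain ⟨rfl, rfl⟩ := code_inj he (hlt hu hv) h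
    have := hpos r hr l hl
    exact ⟨r, hr, hu, hv, by rwa [Nat.sub_add_cancel this], rfl⟩
  · rintro ⟨r, hr, hu, hv, hl, rfl⟩
    exact ⟨hlt hu hv, r, hr, hu, hv, t + 1, hl, by rw [Nat.add_sub_cancel]⟩

theorem pairAct_div_mod {X : List (Fin n)} {r : Fin n × Fin n × List ℕ} (hv : r.2.1 ∈ X) :
    (X.idxOf r.1 * X.length + X.idxOf r.2.1) / X.length = X.idxOf r.1 ∧
    (X.idxOf r.1 * X.length + X.idxOf r.2.1) % X.length = X.idxOf r.2.1 := by
  have h := List.idxOf_lt_length_of_mem hv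
  rw [Nat.add_comm, Nat.add_mul_div_right _ _ (by omega), Nat.div_eq_of_lt h,
    Nat.add_mul_mod_self_right, Nat.mod_eq_of_lt h, zero_add]
  exact ⟨rfl, rfl⟩

/-- On a state whose input array holds an instance, the program outputs a coloring of the matched
vertices with the least number `k ≥ 2` of colors that respects all windows. -/
theorem mainProg_runs (w : List ℕ) (hw : w = [n, T, D, es.length] ++ es.flatMap encEdge)
    (hD : 1 ≤ D) (hDT : D ≤ T) (hne : ∀ r ∈ es, r.1 ≠ r.2.1)
    (hlab : ∀ r ∈ es, ∀ t ∈ r.2.2, 1 ≤ t ∧ t ≤ T)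
    (hν : (matched es).length ≤ 2 * ν) (hnz : n ≤ z) (hTz : T ≤ z)
    (hez : es.length ≤ z) (hflat : (es.flatMap encEdge).length ≤ 4 * z) :
    Runs (fBound ν * z) mainProg (State.init w) (fBound ν * z) fun s' =>
      ∃ k, 2 ≤ k ∧ ∃ c : ℕ → ℕ → ℕ, (∀ t x, c t x < k) ∧
        WinOK (matched es).length D T (pairAct (matched es) es) c ∧
        s'.output = [k, (matched es).length] ++ (matched es).map Fin.val ++
          ((List.range T).flatMap fun t => (List.range (matched es).length).map fun x => c t x) ∧
        ∀ k', 2 ≤ k' → ∀ c' : ℕ → ℕ → ℕ, (∀ t x, c' t x < k') →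
          WinOK (matched es).length D T (pairAct (matched es) es) c' → k ≤ k' := by
  set X := matched es with hXdef
  set m := X.length with hm
  set K := kBound (2 * ν) with hK
  have hKm : kBound m ≤ K := kBound_mono hν
  obtain ⟨hKm2, hKE, hKM, hKL, hKS⟩ : m + 2 ≤ K ∧ m * m ≤ K ∧ 2 * (m * m) + 1 ≤ K ∧ digits m ≤ K ∧
      (m + 2) ^ digits m ≤ K := by
    unfold kBound at hKm
    refine ⟨?_, ?_, ?_, ?_, ?_⟩ <;> omega
  set E := m * m with hE
  set M := 2 * E + 1 with hM
  set L := digits m with hL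
  set B := T / D with hB
  set N := (B + 1) * D with hN
  have hLval : L = (2 * E * M + 1) * m := rfl
  have hK1 : 1 ≤ K := by omega
  have hz : 1 ≤ z := by omega
  have hB1 : 1 ≤ B := (Nat.one_le_div_iff (by omega)).2 hDT
  have hBDT : B * D ≤ T := Nat.div_mul_le_self T D
  have hBT : B ≤ T := Nat.div_le_self T D
  have hNBD : N = B * D + D := by rw [hN, Nat.succ_mul]
  have hTN : T ≤ N := by
    have h1 := Nat.div_add_mod T D
    have h2 := Nat.mod_lt T hD
    rw [← hB, Nat.mul_comm] at h1
    omega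
  have hDN : D ≤ N := by omega
  have hN2 : N ≤ 2 * z := by omega
  -- all sizes are bounded by multiples of `P`
  set P := K ^ 4 * z with hP
  set W := fBound ν * z with hWdef
  have hW : W = 3000 * P := by rw [hWdef, fBound, hP, hK]; ring
  have hKz : K * z ≤ P := by
    calc K * z = K ^ 1 * z := by ring
      _ ≤ P := Nat.mul_le_mul_right _ (Nat.pow_le_pow_right hK1 (by omega))
  have hKKz : K * K ≤ P := by
    calc K * K = K ^ 2 * 1 := by ring
      _ ≤ P := Nat.mul_le_mul (Nat.pow_le_pow_right hK1 (by omega)) hz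
  have hKP : K ≤ P := le_trans (Nat.le_mul_of_pos_right _ hz) hKz
  have hzP : z ≤ P := le_trans (Nat.le_mul_of_pos_left _ hK1) hKz
  have hNE : N * E ≤ 2 * P := by
    calc N * E ≤ 2 * z * K := Nat.mul_le_mul hN2 hKE
      _ = 2 * (K * z) := by ring
      _ ≤ 2 * P := by omega
  have hNE' : (N + 1) * E = N * E + E := by ring
  have hTE : (T + 1) * E ≤ 3 * P := by
    have : (T + 1) * E ≤ (N + 1) * E := Nat.mul_le_mul_right _ (by omega)
    omega
  have hEM : E * M ≤ P := (Nat.mul_le_mul hKE hKM).trans hKKz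
  have hTm : T * m ≤ P := by
    calc T * m ≤ z * K := Nat.mul_le_mul hTz (by omega)
      _ = K * z := by ring
      _ ≤ P := hKz
  have h2EM : 2 * E * M = 2 * (E * M) := by ring
  have hXn : m ≤ n := by simpa using (matched_nodup hne).length_le_card
  -- the initial state
  set s₀ := State.init w with hs₀
  have hin0 : s₀.mem aIn = fun i => ([n, T, D, es.length] ++ es.flatMap encEdge).getD i 0 := by
    funext i
    simp [hs₀, State.init, hw]
  have hmem0 : ∀ a, a ≠ 0 → ∀ i, s₀.mem a i = 0 := fun a ha i => by simp [hs₀, State.init, ha]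
  have hreg0 : ∀ r, r ≠ 0 → s₀.reg r = 0 := fun r hr => by simp [hs₀, State.init, hr]
  refine Runs.mono (b := 20 + (2 + (es.length * (80 + 8) + 6) +
      (12 + 48 * (es.flatMap encEdge).length +
    (60 + (slotTime m N + ((m + 1) * (tryTime m D B L + 8) + 6 + (4 + ((B + 1) * (20 + 8) + 6) +
      (20 + (m * 16 + 6) + (T * (m * 40 + 14) + 6))))))))) ?_ ?_ fun s' h => h
  swap
  · have h1 := slotTime_le (m := m) hK1 hz hKE hN2
    have h2 := searchTime_le (z := z) hD hB1 hKm2 hKE hKL hKS (hBDT.trans hTz)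
    have h3 : T * (m * 40 + 14) = 40 * (T * m) + 14 * T := by ring
    omega
  refine Runs.seq (b₁ := 20) (R := fun s' => s'.reg rn = n ∧ s'.reg rT = T ∧ s'.reg rD = D ∧
    s'.reg rEdges = es.length) (Runs.mono (Runs.of_wp ?_) (by decide) fun s' h => h) ?_
  · simp [headProg, Program.wp, hin0]
    omega
  rintro s₁ hr1 hm1 ⟨hn1, hT1, hD1, hes1⟩
  have hmem1 : ∀ a, s₁.mem a = s₀.mem a := fun a => hm1 a (by simp [headProg, Program.wmems])
  have hinput : InputOK es (s₁.mem aIn) := by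
    rw [hmem1, hin0]
    exact inputOK_of_encodes
  refine Runs.seq (matchProg_runs hne hinput hes1 (by rw [hr1 _ (by decide), hreg0 _ (by decide)])
    (fun i => by rw [hmem1, hmem0 _ (by decide)]) (by omega) (by omega) (by omega)) ?_
  intro s₂ hr2 hm2 hX2
  refine Runs.seq (actProg_runs (T := T) hX2 (by rwa [hm2 _ (by decide)])
    (by rw [hr2 _ (by decide), hes1]) (fun r hr t ht => (hlab r hr t ht).2)
    (fun i => by rw [hm2 _ (by decide), hmem1, hmem0 _ (by decide)]) (by omega)
        (by change m ≤ W; omega)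
    (by omega) (by omega) (by change (T + 1) * E + E + T ≤ W; omega)) ?_
  rintro s₃ hr3 hm3 ⟨hA3, hE3⟩
  change s₃.reg rE = E at hE3
  have hX3 := hX2.congr (fun r h => hr3 r (by revert r; decide))
      (fun r h => hm3 r (by revert r; decide))
  have hm3' : s₃.reg rm = m := hX3.m_eq
  have hT3 : s₃.reg rT = T := by rw [hr3 _ (by decide), hr2 _ (by decide), hT1]
  have hD3 : s₃.reg rD = D := by rw [hr3 _ (by decide), hr2 _ (by decide), hD1]
  have hLW : (2 * E * M + 1) * m ≤ W := by rw [← hLval]; omega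
  refine Runs.seq (b₁ := 60) (R := fun s' => s'.reg rM = M ∧ s'.reg rB = B ∧
      s'.reg rBlocks = B + 1 ∧
    s'.reg rN = N ∧ s'.reg rL = L ∧ s'.reg rDD = D + D ∧ s'.reg rTries = m + 1)
    (Runs.mono (Runs.of_wp ?_) (by decide) fun s' h => h) ?_
  · simp only [setupProg, Program.wp, fits_reg, eval_reg, fits_add, fits_mul, fits_div, fits_lit,
      eval_add, eval_mul, eval_div, eval_lit, hE3, hm3', hT3, hD3, State.set_reg, Nat.reduceEqDiff,
      if_true, if_false, ← hM, ← hB, ← hN, ← hLval]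
    refine ⟨?_, ?_, ?_, ?_, ?_, ?_, ?_, ?_⟩
    all_goals first | omega | simp
  rintro s₄ hr4 hm4 ⟨hM4, hB4, hBl4, hN4, hL4, hDD4, hTr4⟩
  have hmem4 : ∀ a, s₄.mem a = s₃.mem a := fun a => hm4 a (by simp [setupProg, Program.wmems])
  set A := s₃.mem aAct with hAdef
  have hAle : ∀ i, A i ≤ 1 := fun i => (hA3 i).1
  have hslot4 : SlotCtx m D N M A s₄ := ⟨by rw [hr4 _ (by decide), hE3],
      by rw [hr4 _ (by decide), hD3],
    hN4, hM4, hmem4 _⟩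
  refine Runs.seq (slotProg_runs hN hAle (by change (N + 1) * E + N + 1 ≤ W; omega)
    (by change E * M + E * M + M + 1 ≤ W; omega) hslot4 (fun a ha i => ?_)) ?_
  · rw [hmem4]
    simp only [List.mem_cons, List.not_mem_nil, or_false] at ha
    rcases ha with rfl | rfl | rfl <;>
      rw [hm3 _ (by decide), hm2 _ (by decide), hmem1, hmem0 _ (by decide)]
  intro s₅ hr5 hm5 hslots
  set rank := s₅.mem aRank with hrank
  have hactIff := actOf_iff hA3 (fun r hr t ht => (hlab r hr t ht).1)
  have hact : ∀ t e, actOf m A t e → t < N ∧ e < m * m := by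
    intro t e h
    obtain ⟨r, hr, -, -, ht, -⟩ := (hactIff t e).1 h
    have := (hlab r hr _ ht).2
    exact ⟨by omega, h.1⟩
  have hloop : ∀ t e, actOf m A t e → e / m ≠ e % m := by
    intro t e h
    obtain ⟨r, hr, hu, hv, ht, rfl⟩ := (hactIff t e).1 h
    obtain ⟨h1, h2⟩ := pairAct_div_mod (r := r) hv
    rw [h1, h2]
    exact fun h3 => hne r hr ((List.idxOf_inj hu).1 h3)
  have hbounds : ∀ k, 2 ≤ k → k ≤ m + 2 → DPBounds W m D T k B N L (k ^ L) A rank := by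
    intro k hk hkm
    have hSK : k ^ L ≤ K := (Nat.pow_le_pow_left hkm L).trans hKS
    refine ⟨hD, hk, by omega, rfl, hTN, hN, by change N * E + 4 * N + E + m + 4 ≤ W; omega, hAle,
      fun t ht => ?_, fun t ht => ?_, by omega, ?_⟩
    · have h1 : (rank t + 1) * m ≤ (2 * E * M + 1) * m :=
        Nat.mul_le_mul_right _ (Nat.succ_le_succ (hslots.le ht))
      rw [Nat.succ_mul] at h1
      omega
    · have h1 : rank t ≤ 2 * E * M := hslots.le ht
      omega
    · have h1 : (B + 2) * k ^ L ≤ 3 * z * K := Nat.mul_le_mul (by omega) hSK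
      have h2 : 3 * z * K = 3 * (K * z) := by ring
      omega
  have hfeas : ∀ k, 2 ≤ k → ∀ c : ℕ → ℕ → ℕ, (∀ t x, c t x < k) →
      WinOK m D T (pairAct X es) c → Feasible m D T B L A rank k := by
    intro k hk c hc hwin
    refine exists_reach hD hk hact hloop hc le_rfl hslots hLval ?_ B
    intro s hs e he hex
    obtain ⟨t, h1, h2, h3⟩ := hex
    obtain ⟨t', h4, h5, h6⟩ := hwin s hs e he ⟨t, h1, h2, (hactIff t e).1 h3⟩
    exact ⟨t', h4, h5, (hactIff t' e).2 h6.1, h6.2⟩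
  -- giving all matched vertices different colors respects all windows
  have hfeas0 : Feasible m D T B L A rank (max 2 m) := by
    refine hfeas _ (le_max_left _ _) (fun _ x => if x < m then x else 0) (fun t x => ?_) ?_
    · split <;> omega
    · rintro s hs e he ⟨t, h1, h2, h3⟩
      refine ⟨t, h1, h2, h3, ?_⟩
      have h4 := hloop t e ((hactIff t e).2 h3)
      have hm0 : 0 < m := Nat.pos_of_ne_zero (by intro h0; rw [h0] at he; omega)
      simpa [Nat.div_lt_of_lt_mul he, Nat.mod_lt _ hm0] using h4
  have hsearch5 : SearchCtx m D T B L A rank s₅ := by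
    constructor
    · rw [hr5 _ (by decide), hr4 _ (by decide), hm3']
    · rw [hr5 _ (by decide), hr4 _ (by decide), hE3]
    · rw [hr5 _ (by decide), hr4 _ (by decide), hD3]
    · rw [hr5 _ (by decide), hDD4]
    · rw [hr5 _ (by decide), hr4 _ (by decide), hT3]
    · rw [hr5 _ (by decide), hB4]
    · rw [hr5 _ (by decide), hL4]
    · rw [hm5 _ (by decide), hmem4]
    · rfl
  refine Runs.seq (searchProg_runs hbounds hsearch5 (by rw [hr5 _ (by decide), hTr4])
    (by rw [hr5 _ (by decide), hr4 _ (by decide), hr3 _ (by decide), hr2 _ (by decide),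
      hr1 _ (by decide), hreg0 _ (by decide)]) (le_max_left 2 m) (by omega) hfeas0) ?_
  rintro s₆ hr6 hm6 ⟨k, hkm, hfound⟩
  have hk2 := hfound.1
  have hbk := hbounds k hk2 hkm
  refine Runs.seq (backProg_runs hbk hfound (by rw [hr6 _ (by decide), hr5 _ (by decide), hBl4])) ?_
  rintro s₇ hr7 hm7 ⟨hst, hcompat⟩
  have hctx7 := hfound.2.2.1.congr (fun r h => hr7 r (by revert r; decide))
    (fun r h => hm7 r (by revert r; decide))
  have hX7 : s₇.mem aX = s₃.mem aX := by
    rw [hm7 _ (by decide), hm6 _ (by decide), hm5 _ (by decide), hmem4]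
  have hXval : ∀ i (hi : i < m), s₇.mem aX i = X[i].val := fun i hi => by rw [hX7, hX3.X_eq i hi]
  refine Runs.mono (outProg_runs hbk hctx7 rfl hst (fun i hi => ?_) (by omega)) le_rfl ?_
  · rw [hXval i hi]
    have := X[i].2
    omega
  intro s₈ hout
  refine ⟨k, hk2, fun t x => stateColor m k rank (s₇.mem aSt (t / D)) t x,
    fun t x => Nat.mod_lt _ (by omega), ?_, ?_, ?_⟩
  · have hwin := winOK_of_compat hD (s₇.mem aSt) hcompat
    intro s hs e he hex
    obtain ⟨t, h1, h2, h3⟩ := hex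
    obtain ⟨t', h4, h5, h6⟩ := hwin s hs e he ⟨t, h1, h2, (hactIff t e).2 h3⟩
    exact ⟨t', h4, h5, (hactIff t' e).1 h6.1, h6.2⟩
  · rw [hout]
    congr 2
    refine List.ext_getElem (by simp [hm]) fun i h1 h2 => ?_
    simp only [List.length_map, List.length_range] at h1
    simp [hXval i h1]
  · intro k' hk' c' hc' hwin
    by_contra hlt
    exact hfound.2.1 k' hk' (by omega) (hfeas k' hk' c' hc' hwin)

end Main

/-! ### From the matched vertices to the whole graph -/

section Glue

variable {n : ℕ} {G : TemporalGraph n} {es : List (Fin n × Fin n × List ℕ)}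

/-- Counting the pairs of an edge and one of its labels by time slots instead of by edges. -/
theorem sum_labels_le (hnd : (es.map fun r => s(r.1, r.2.1)).Nodup)
    (hlab : ∀ r ∈ es, r.2.2.Nodup ∧ r.2.2.toFinset = G.label s(r.1, r.2.1)) :
    (es.map fun r => r.2.2.length).sum ≤ ∑ t ∈ Finset.Icc 1 G.lifetime,
        (G.snapshotEdges t).card := by
  classical
  have h1 : (es.map fun r => r.2.2.length) =
      (es.map fun r => s(r.1, r.2.1)).map fun e => (G.label e).card := by
    rw [List.map_map]
    refine List.map_congr_left fun r hr => ?_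
    obtain ⟨h, h'⟩ := hlab r hr
    rw [Function.comp_apply, ← h', List.toFinset_card_of_nodup h]
  have h2 := Finset.sum_card_bipartiteAbove_eq_sum_card_bipartiteBelow
    (fun t e => t ∈ G.label e) (s := Finset.Icc 1 G.lifetime) (t := Finset.univ)
  have h3 : ∀ e, Finset.bipartiteBelow (fun t e => t ∈ G.label e) (Finset.Icc 1 G.lifetime) e =
      G.label e := fun e => by
    ext t
    rw [Finset.mem_bipartiteBelow]
    exact ⟨fun h => h.2, fun h => ⟨G.label_subset e h, h⟩⟩
  simp only [h3] at h2
  rw [h1, ← List.sum_toFinset _ hnd]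
  exact (Finset.sum_le_sum_of_subset (Finset.subset_univ _)).trans_eq h2.symm

theorem length_flatMap_encEdge (es : List (Fin n × Fin n × List ℕ)) :
    (es.flatMap encEdge).length = 3 * es.length + (es.map fun r => r.2.2.length).sum := by
  induction es with
  | nil => rfl
  | cons r es ih =>
    simp only [List.flatMap_cons, List.length_append, ih, encEdge, List.length_cons, List.map_cons,
      List.sum_cons, List.length_nil]
    omega

/-- The colors of a finite set can be replaced injectively by numbers below its cardinality. -/
theorem exists_renaming (S : Finset ℕ) (hS : 0 < S.card) :
    ∃ ρ : ℕ → ℕ, (∀ x, ρ x < S.card) ∧ Set.InjOn ρ S := by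
  refine ⟨fun x => if h : x ∈ S then S.equivFin ⟨x, h⟩ else 0, fun x => ?_, fun x hx y hy hxy => ?_⟩
  · dsimp only
    split
    · exact Fin.is_lt _
    · exact hS
  · rw [Finset.mem_coe] at hx hy
    simp only [hx, hy, dif_pos] at hxy
    simpa using S.equivFin.injective (Fin.ext hxy)

/-- An instance with at least one edge needs two colors. -/
theorem two_le_numColors {Δ : ℕ} (hΔ : 1 ≤ Δ) (hT : Δ ≤ G.lifetime) {ψ : Fin n → ℕ → ℕ}
    (hψ : IsProperSliding G Δ ψ) {u v : Fin n} (huv : G.graph.Adj u v) : 2 ≤ numColors G ψ := by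
  obtain ⟨t, ht⟩ := (G.label_nonempty_iff s(u, v)).2 huv
  have ht' := Finset.mem_Icc.1 (G.label_subset _ ht)
  -- a window that contains `t` and lies inside the lifetime
  obtain ⟨t', -, ht1, hne⟩ := hψ (min t (G.lifetime + 1 - Δ)) (by omega) (by omega) u v huv
    ⟨t, Finset.mem_Ico.2 ⟨by omega, by omega⟩, ht⟩
  have hmem : ∀ w : Fin n, (w, t') ∈ (Finset.univ : Finset (Fin n)) ×ˢ Finset.Icc 1 G.lifetime :=
    fun w => Finset.mem_product.2 ⟨Finset.mem_univ _, G.label_subset _ ht1⟩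
  exact Finset.one_lt_card.2 ⟨_, Finset.mem_image_of_mem _ (hmem u), _,
    Finset.mem_image_of_mem _ (hmem v), hne⟩

/-- The coloring `c` of the vertices in `X`, extended by the color `k`; the times of `c` count from
`0`. -/
def extendColoring (X : List (Fin n)) (k : ℕ) (c : ℕ → ℕ → ℕ) (v : Fin n) (t : ℕ) : ℕ :=
  if v ∈ X then c (t - 1) (X.idxOf v) else k

/-- Edges inside `X` are taken care of by `WinOK`; any other edge has exactly one end in `X`, and
the color `k` is not used there. -/
theorem extendColoring_proper {X : List (Fin n)} {k Δ : ℕ} {c : ℕ → ℕ → ℕ}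
    (hadj : ∀ u v, G.graph.Adj u v → ∃ r ∈ es, s(r.1, r.2.1) = s(u, v))
    (hlab : ∀ r ∈ es, r.2.2.toFinset = G.label s(r.1, r.2.1))
    (hcov : ∀ r ∈ es, r.1 ∈ X ∨ r.2.1 ∈ X) (hc : ∀ t x, c t x < k)
    (hwin : WinOK X.length Δ G.lifetime (pairAct X es) c) :
    IsProperSliding G Δ (extendColoring X k c) := by
  have key : ∀ r ∈ es, ∀ s, 1 ≤ s → s + Δ ≤ G.lifetime + 1 →
      (∃ t ∈ Finset.Ico s (s + Δ), t ∈ G.label s(r.1, r.2.1)) →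
      ∃ t ∈ Finset.Ico s (s + Δ), t ∈ G.label s(r.1, r.2.1) ∧
        extendColoring X k c r.1 t ≠ extendColoring X k c r.2.1 t := by
    rintro r hr s hs1 hs2 ⟨t, ht, htl⟩
    rw [Finset.mem_Ico] at ht
    by_cases h1 : r.1 ∈ X
    · by_cases h2 : r.2.1 ∈ X
      · have hlt := code_lt (List.idxOf_lt_length_of_mem h1) (List.idxOf_lt_length_of_mem h2)
        obtain ⟨hd, hmod⟩ := pairAct_div_mod (r := r) h2
        obtain ⟨t', h3, h4, ⟨r', hr', hu', hv', ht', he⟩, hne⟩ := hwin (s - 1) (by omega) _ hlt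
          ⟨t - 1, by omega, by omega, r, hr, h1, h2, by
            rw [Nat.sub_add_cancel (by omega)]
            rwa [← hlab r hr, List.mem_toFinset] at htl, rfl⟩
        obtain ⟨hd', hmod'⟩ := pairAct_div_mod (r := r') hv'
        rw [← he] at hd' hmod'
        have e1 : r.1 = r'.1 := (List.idxOf_inj h1).1 (hd.symm.trans hd')
        have e2 : r.2.1 = r'.2.1 := (List.idxOf_inj h2).1 (hmod.symm.trans hmod')
        rw [hd, hmod] at hne
        refine ⟨t' + 1, Finset.mem_Ico.2 ⟨by omega, by omega⟩, ?_, ?_⟩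
        · rw [e1, e2, ← hlab r' hr']
          exact List.mem_toFinset.2 ht'
        · simpa only [extendColoring, h1, h2, if_true, Nat.add_sub_cancel] using hne
      · refine ⟨t, Finset.mem_Ico.2 ht, htl, ?_⟩
        simp only [extendColoring, h1, h2, if_true, if_false]
        exact (hc _ _).ne
    · have h2 := (hcov r hr).resolve_left h1
      refine ⟨t, Finset.mem_Ico.2 ht, htl, ?_⟩
      simp only [extendColoring, h1, h2, if_true, if_false]
      exact (hc _ _).ne'
  intro s hs1 hs2 u v huv hex
  obtain ⟨r, hr, he⟩ := hadj u v huv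
  have := key r hr s hs1 hs2
  rw [he] at this
  obtain ⟨t, ht, htl, hne⟩ := this hex
  rcases Sym2.eq_iff.1 he with ⟨rfl, rfl⟩ | ⟨rfl, rfl⟩
  · exact ⟨t, ht, htl, hne⟩
  · exact ⟨t, ht, htl, hne.symm⟩

theorem extendColoring_encodes {X : List (Fin n)} (hX : X.Nodup) (k : ℕ) (c : ℕ → ℕ → ℕ) :
    EncodesColoring G (extendColoring X k c) ([k, X.length] ++ X.map Fin.val ++
      (List.range G.lifetime).flatMap fun t => (List.range X.length).map fun x => c t x) := by
  refine ⟨k, X, hX, fun v hv t _ => by simp [extendColoring, hv], ?_⟩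
  congr 1
  refine List.flatMap_congr fun t _ => List.ext_getElem (by simp) fun i h1 h2 => ?_
  simp [extendColoring, hX.idxOf_getElem]

theorem numColors_extendColoring_le {X : List (Fin n)} {k : ℕ} {c : ℕ → ℕ → ℕ}
    (hc : ∀ t x, c t x < k) : numColors G (extendColoring X k c) ≤ k + 1 := by
  refine (Finset.card_le_card (t := Finset.range (k + 1)) fun y hy => ?_).trans_eq
    (Finset.card_range _)
  obtain ⟨p, -, rfl⟩ := Finset.mem_image.1 hy
  have := hc (p.2 - 1) (X.idxOf p.1)
  simp only [extendColoring, Finset.mem_range]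
  split <;> omega

/-- A proper coloring `ψ` of the whole graph restricts to a coloring of the vertices in `X` with as
many colors that respects all windows. -/
theorem exists_winOK {X : List (Fin n)} {Δ : ℕ} {ψ : Fin n → ℕ → ℕ}
    (hadj : ∀ r ∈ es, G.graph.Adj r.1 r.2.1)
    (hlab : ∀ r ∈ es, r.2.2.toFinset = G.label s(r.1, r.2.1))
    (hψ : IsProperSliding G Δ ψ) (hpos : 0 < numColors G ψ) :
    ∃ c : ℕ → ℕ → ℕ, (∀ t x, c t x < numColors G ψ) ∧
      WinOK X.length Δ G.lifetime (pairAct X es) c := by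
  obtain ⟨ρ, hρ, hinj⟩ := exists_renaming _ hpos
  refine ⟨fun t x => if h : x < X.length then ρ (ψ X[x] (t + 1)) else 0, fun t x => ?_, ?_⟩
  · dsimp only
    split
    · exact hρ _
    · exact hpos
  · rintro s hs e he ⟨t, h1, h2, r, hr, hu, hv, ht, rfl⟩
    obtain ⟨t', h3, h4, h5⟩ := hψ (s + 1) (by omega) (by omega) _ _ (hadj r hr)
      ⟨t + 1, Finset.mem_Ico.2 ⟨by omega, by omega⟩, by rwa [← hlab r hr, List.mem_toFinset]⟩
    rw [Finset.mem_Ico] at h3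
    obtain ⟨hd, hmod⟩ := pairAct_div_mod (r := r) hv
    have ht' : t' - 1 + 1 = t' := by omega
    refine ⟨t' - 1, by omega, by omega, ⟨r, hr, hu, hv, ?_, rfl⟩, ?_⟩
    · rwa [ht', ← List.mem_toFinset, hlab r hr]
    · rw [hd, hmod]
      simp only [List.idxOf_lt_length_of_mem hu, List.idxOf_lt_length_of_mem hv, dif_pos,
        List.getElem_idxOf, ht']
      have hmem : ∀ w : Fin n, ψ w t' ∈ ((Finset.univ ×ˢ Finset.Icc 1 G.lifetime).image
          fun p : Fin n × ℕ => ψ p.1 p.2) := fun w => Finset.mem_image_of_mem _ (a := (w, t'))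
        (Finset.mem_product.2 ⟨Finset.mem_univ _, Finset.mem_Icc.2 ⟨by omega, by omega⟩⟩)
      exact fun h => h5 (hinj (hmem _) (hmem _) h)

end Glue
end SWColoring

theorem mainTheorem11 :
    ∃ (P : SWColoring.Program) (f : ℕ → ℕ), Computable f ∧
      ∀ (n : ℕ) (G : SWColoring.TemporalGraph n) (Δ ν : ℕ) (w : List ℕ),
        1 ≤ Δ → Δ ≤ G.lifetime →
        G.graph.vertexCoverNum = (ν : ℕ∞) →
        SWColoring.EncodesInstance G Δ w →
        ∃ (time : ℕ) (s : SWColoring.State) (φ : Fin n → ℕ → ℕ),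
          SWColoring.Exec (f ν * G.size) P (SWColoring.State.init w) time s ∧
          time ≤ f ν * G.size ∧
          SWColoring.EncodesColoring G φ s.output ∧
          SWColoring.IsProperSliding G Δ φ ∧
          ∀ ψ : Fin n → ℕ → ℕ, SWColoring.IsProperSliding G Δ ψ →
            SWColoring.numColors G φ ≤ SWColoring.numColors G ψ + 1 := by
  open SWColoring in
  refine ⟨mainProg, fBound, computable_fBound, ?_⟩
  rintro n G Δ ν w hΔ hΔT hν ⟨es, hnd, hedge, hlab, hw⟩
  have hadj : ∀ r ∈ es, G.graph.Adj r.1 r.2.1 := fun r hr =>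
    (hedge s(r.1, r.2.1)).2 (List.mem_map_of_mem (f := fun r => s(r.1, r.2.1)) hr)
  have hne : ∀ r ∈ es, r.1 ≠ r.2.1 := fun r hr => (hadj r hr).ne
  have hmem : ∀ r ∈ es, ∀ t ∈ r.2.2, 1 ≤ t ∧ t ≤ G.lifetime := fun r hr t ht => by
    rw [← List.mem_toFinset, (hlab r hr).2] at ht
    exact Finset.mem_Icc.1 (G.label_subset _ ht)
  set X := matched es with hX
  have hXν : X.length ≤ 2 * ν := by
    classical
    obtain ⟨C, hC, hcov⟩ := G.graph.vertexCoverNum_exists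
    have hcard : C.toFinset.card = ν := by
      rw [hν, Set.encard_eq_coe_toFinset_card] at hC
      exact_mod_cast hC
    rw [← hcard]
    exact matched_length_le _ fun r hr => by simpa using hcov (hadj r hr)
  have hsize : G.size = n + (G.lifetime + ∑ t ∈ Finset.Icc 1 G.lifetime,
      (G.snapshotEdges t).card) := by
    rw [TemporalGraph.size, Finset.sum_add_distrib]
    simp
  have hsum := sum_labels_le hnd hlab
  have hlen : es.length ≤ (es.map fun r => r.2.2.length).sum := by
    have := List.length_le_sum_of_one_le (es.map fun r => r.2.2.length) fun i hi => by
      obtain ⟨r, hr, rfl⟩ := List.mem_map.1 hi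
      obtain ⟨t, ht⟩ := (G.label_nonempty_iff s(r.1, r.2.1)).2 (hadj r hr)
      rw [← (hlab r hr).2, List.mem_toFinset] at ht
      exact List.length_pos_of_mem ht
    simpa using this
  have hflat := length_flatMap_encEdge es
  obtain ⟨time, s, hexec, htime, k, hk, c, hc, hwin, hout, hmin⟩ :=
    mainProg_runs (z := G.size) w hw hΔ hΔT hne hmem hXν (by omega) (by omega) (by omega) (by omega)
  refine ⟨time, s, extendColoring X k c, hexec, htime, ?_, ?_, fun ψ hψ => ?_⟩
  · rw [hout]
    exact extendColoring_encodes (matched_nodup hne) k c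
  · refine extendColoring_proper (fun u v huv => ?_) (fun r hr => (hlab r hr).2)
      (fun r hr => matched_cover hr) hc hwin
    simpa using (hedge s(u, v)).1 huv
  · rcases es.eq_nil_or_concat with rfl | ⟨es', r, rfl⟩
    · -- without edges the single color `k` is used
      refine le_trans (Finset.card_le_card (t := {k}) fun y hy => ?_) (by simp)
      obtain ⟨p, -, rfl⟩ := Finset.mem_image.1 hy
      simp [extendColoring, hX, matched]
    · have h2 := two_le_numColors hΔ hΔT hψ (hadj r (by simp))
      obtain ⟨c', hc', hwin'⟩ := exists_winOK (X := X) hadj (fun r hr => (hlab r hr).2) hψ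
          (by omega)
      have := hmin _ h2 c' hc' hwin'
      have := numColors_extendColoring_le (G := G) (X := X) hc
      omega
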